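/- **Conventions.** Let $\Bbbk=\bigoplus_{i\in\mathbb Z}\Bbbk^i$ be a graded strongly commutative ring: $ba=(-1)^{|a||b|}ab$ for homogeneous $a,b$, and $c^2=0$ for $c$ of odd degree. Modules are $\mathbb Z$-graded left $\Bbbk$-modules, with right action $xc=(-1)^{|c||x|}cx$; $\otimes=\otimes_{\Bbbk}$. Maps are left $\Bbbk$-linear and homogeneous and are written on the right, so $fg$ means first $f$, then $g$, and $(x\otimes y)(f\otimes g)=(-1)^{|y||f|}xf\otimes yg$. A map of degree $d$ from $\Bbbk$ is determined by the image of $1$, an element of degree $d$. The shift is $M[a]^k=M^{a+k}$, and $\sigma^a:M\to M[a]$ is the identity map, of degree $-a$ ($\sigma=\sigma^1$; we also write $\sigma:M[-1]\to M$ and $\sigma^{-1}:M[1]\to M$ for the identity maps of degrees $-1$ and $1$). For a module $X$ put $XT^{\ge}=\bigoplus_{n\ge0}X^{\otimes n}$. **Curved algebras.** A *unit-complemented curved algebra* $(A,m_2,m_1,m_0,\eta,\mathsf v)$ consists of a module $A$ and maps $m_2:A\otimes A\to A$, $m_1:A\to A$, $m_0:\Bbbk\to A$, $\eta:\Bbbk\to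 A$, $\mathsf v:A\to\Bbbk$ of degrees $0,1,2,0,0$ with $$(1\otimes m_2)m_2=(m_2\otimes1)m_2,\quad m_2m_1=(1\otimes m_1+m_1\otimes1)m_2,\quad m_1^2=(m_0\otimes1-1\otimes m_0)m_2,\quad m_0m_1=0,$$ $$(1\otimes\eta)m_2=1=(\eta\otimes1)m_2,\quad \eta m_1=0,\quad \eta\mathsf v=1_{\Bbbk}.$$ In the category $\mathsf{UCCAlg}$ of these, a morphism $A\to B$ is a pair $(f_1,\underline f)$ with $f_1:A\to B$ of degree $0$ and $\underline f\in\Bbbk^1$ such that $(f_1\otimes f_1)m_2=m_2f_1$, $f_1m_1=m_1f_1$, $m_0f_1=m_0$, $\eta f_1=\eta$. The composite of $f$ and $g$ is $(f_1g_1,\underline f+\underline g)$, and the identity is $(\mathrm{id},0)$. Put $\bar A=\operatorname{Ker}\mathsf v$ and $\mathrm{pr}=1-\mathsf v\eta:A\to\bar A$. **Curved coalgebras.** A *curved augmented coalgebra* $(C,\delta_2,\delta_1,\delta_0,\varepsilon,\mathsf w)$ consists of a module $C$ and maps $\delta_2:C\to C\otimes C$, $\delta_1:C\to C$, $\delta_0:C\to\Bbbk$,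 $\varepsilon:C\to\Bbbk$, $\mathsf w:\Bbbk\to C$ of degrees $0,1,2,0,0$ with $$\delta_2(1\otimes\delta_2)=\delta_2(\delta_2\otimes1),\quad \delta_1\delta_2=\delta_2(1\otimes\delta_1+\delta_1\otimes1),\quad \delta_1^2=\delta_2(1\otimes\delta_0-\delta_0\otimes1),\quad \delta_1\delta_0=0,$$ $$\delta_2(1\otimes\varepsilon)=1=\delta_2(\varepsilon\otimes1),\quad \delta_1\varepsilon=0,\quad \mathsf w\varepsilon=1_{\Bbbk},\quad \mathsf w\delta_2=\mathsf w\otimes\mathsf w,$$ and conilpotent: with $\bar C=\operatorname{Ker}\varepsilon$, $\mathrm{pr}=1-\varepsilon\mathsf w:C\to\bar C$ and the reduced comultiplication $\bar\delta_2=\delta_2(\mathrm{pr}\otimes\mathrm{pr}):\bar C\to\bar C\otimes\bar C$, every element of $\bar C$ is annihilated by some iterate $\bar C\to\bar C^{\otimes n}$, $n>1$. In the category $\mathsf{CACoalg}$ of these, a morphism $C\to D$ is a pair of maps $g_1:C\to D$, $g_0:C\to\Bbbk$ of degrees $0,1$ with $$\delta_2(g_1\otimes g_1)=g_1\delta_2,\quad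 \delta_1g_1+\delta_2(g_0\otimes g_1-g_1\otimes g_0)=g_1\delta_1,\quad \delta_0-\delta_1g_0-\delta_2(g_0\otimes g_0)=g_1\delta_0,\quad g_1\varepsilon=\varepsilon,\quad \mathsf wg_1=\mathsf w.$$ The composite of $f$ and $g$ is $(f_1g_1,\;f_0+f_1g_0)$, and the identity is $(\mathrm{id},0)$. **Subcategories.** $\mathsf{uccAlg}\subset\mathsf{UCCAlg}$ and $\mathsf{caCoalg}\subset\mathsf{CACoalg}$ have all the objects, and the morphisms with $\underline f=0$, respectively with $\mathsf wg_0=0$. **Bar.** For a unit-complemented curved algebra $A$, $\mathrm{Bar}\,A=\bar A[1]T^{\ge}$ has the cut comultiplication $\delta_2(x_1\cdots x_n)=\sum_{k=0}^nx_1\cdots x_k\otimes x_{k+1}\cdots x_n$, counit the projection to $\Bbbk=\bar A[1]^{\otimes 0}$ and $\mathsf w$ the inclusion of $\Bbbk$. Put $b_0=m_0\sigma$, $b_1=-\sigma^{-1}m_1\sigma$, $b_2=-(\sigma^{-1}\otimes\sigma^{-1})m_2\sigma$. The map $\delta_1$ is the coderivation $\sum 1^{\otimes r}\otimes\bar b_k\otimes1^{\otimes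 t}$ with $\bar b_k:\bar A[1]^{\otimes k}\to\bar A[1]$ ($k=0,1,2$) induced by $b_k$ through the inclusion $\bar A\subset A$ and $\mathrm{pr}$. The functional $\delta_0$ is $-b_k\sigma^{-1}\mathsf v$ on $\bar A[1]^{\otimes k}$ for $k=0,1,2$ and $0$ for $k>2$. For a morphism $(f_1,\underline f):A\to B$, the first component of $\mathrm{Bar}\,f$ is $\sum_n\bar f_1^{\otimes n}$, where $\bar f_1:\bar A[1]\to\bar B[1]$ is induced by $f_1$ through inclusion and $\mathrm{pr}$. The second component is $\underline f$ on $\Bbbk$, the map $\sigma^{-1}f_1\mathsf v:\bar A[1]\to\Bbbk$ on $\bar A[1]$, and $0$ on longer tensors. **Cobar.** For a curved augmented coalgebra $C$, $\mathrm{Cobar}\,C=\bar C[-1]T^{\ge}$ is the tensor algebra, with $\eta$ the inclusion of $\Bbbk$ and $\mathsf v$ the projection to $\Bbbk$. Put $\xi_0=\sigma\delta_0$, $\xi_1=-\sigma\delta_1\sigma^{-1}$, $\xi_2=-\sigma\delta_2(\sigma^{-1}\otimes\sigma^{-1})$. The map $m_1$ is the degree $1$ derivation whose restriction to $\bar C[-1]$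 is $\bar\xi_0+\bar\xi_1+\bar\xi_2$, where $\bar\xi_k:\bar C[-1]\to\bar C[-1]^{\otimes k}$ is induced by $\xi_k$ through inclusion and $\mathrm{pr}$. The curvature is $m_0=-\mathsf w\otimes\mathsf w-\mathsf w\xi_0-\mathsf w\xi_1-\mathsf w\xi_2=-\mathsf w\delta_0+\mathsf w\delta_1\sigma^{-1}\in\Bbbk\oplus\bar C[-1]$ (here $\mathsf w$ is viewed in $C[-1]$ in the first expression, and $\mathsf w\xi_2=-\mathsf w\otimes\mathsf w$). For a morphism $(g_1,g_0):C\to D$, the first component of $\mathrm{Cobar}\,g$ is the algebra homomorphism whose restriction to $\bar C[-1]$ is the sum of the map $\bar C[-1]\to\bar D[-1]$ given by $g_1$ and the map $\bar C[-1]\to\Bbbk$ given by $g_0$, and $\underline{\mathrm{Cobar}\,g}=\mathsf wg_0$. **Statement.** The above formulas define functors $\mathrm{Bar}:\mathsf{UCCAlg}\to\mathsf{CACoalg}$ and $\mathrm{Cobar}:\mathsf{CACoalg}\to\mathsf{UCCAlg}$. They restrict (commuting on the nose with the inclusions of subcategories) to functors $$\mathrm{Cobar}:\mathsf{caCoalg}\rightleftarrows\mathsf{uccAlg}:\mathrm{Bar},$$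 and the restricted functors are adjoint to each other, $\mathrm{Cobar}$ being left adjoint to $\mathrm{Bar}$. -/

import Mathlib

open CategoryTheory DirectSum TensorProduct

universe u

/-- The sign `(-1) ^ n`. -/
def koszulSign (n : ℤ) : ℤ := ((n.negOnePow : ℤˣ) : ℤ)

theorem koszulSign_even {n : ℤ} (h : Even n) : koszulSign n = 1 := by
  simp [koszulSign, Int.negOnePow_even n h]

theorem koszulSign_odd {n : ℤ} (h : Odd n) : koszulSign n = -1 := by
  simp [koszulSign, Int.negOnePow_odd n h]

theorem koszulSign_zero : koszulSign 0 = 1 := koszulSign_even (by simp)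

theorem koszulSign_add (m n : ℤ) : koszulSign (m + n) = koszulSign m * koszulSign n := by
  simp [koszulSign, Int.negOnePow_add]

theorem koszulSign_mul_self (n : ℤ) : koszulSign n * koszulSign n = 1 := by
  rw [← koszulSign_add]; exact koszulSign_even (by simp)

/-- Graded strong commutativity of a `ℤ`-graded ring: `b a = (-1)^{|a||b|} a b` for homogeneous
`a`, `b`, and `c² = 0` for every `c` of odd degree. -/
class IsGradedStronglyCommutative {𝕜 : Type u} [Ring 𝕜] (𝒦 : ℤ → AddSubgroup 𝕜) : Prop where
  comm : ∀ {i j : ℤ} {a b : 𝕜}, a ∈ 𝒦 i → b ∈ 𝒦 j → b * a = koszulSign (i * j) • (a * b)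
  sq : ∀ {i : ℤ} {c : 𝕜}, Odd i → c ∈ 𝒦 i → c * c = 0

theorem isInternal_of_proj {M : Type u} [AddCommGroup M] (deg : ℤ → AddSubgroup M)
    (p : ℤ → M →+ M) (h₁ : ∀ i x, x ∈ deg i → p i x = x)
    (h₂ : ∀ i j x, x ∈ deg i → i ≠ j → p j x = 0) (h₃ : ∀ x, x ∈ ⨆ i, deg i) :
    DirectSum.IsInternal deg := by
  constructor
  · rw [injective_iff_map_eq_zero]
    have key : ∀ (z : ⨁ i, deg i) (i : ℤ),
        p i (DirectSum.coeAddMonoidHom deg z) = (z i : M) := by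
      intro z i
      induction z using DirectSum.induction_on with
      | zero => simp
      | of j x =>
        rw [DirectSum.coeAddMonoidHom_of]
        by_cases hij : j = i
        · subst hij; rw [h₁ _ _ x.2, DirectSum.of_eq_same]
        · rw [h₂ j i _ x.2 hij, DirectSum.of_eq_of_ne _ _ _ (Ne.symm hij)]; rfl
      | add x y hx hy => simp [hx, hy]
    intro z hz
    refine DFinsupp.ext fun i => ?_
    have := key z i
    rw [hz, map_zero] at this
    exact Subtype.ext this.symm
  · intro x
    refine AddSubgroup.iSup_induction (C := fun x => ∃ z, DirectSum.coeAddMonoidHom deg z = x) deg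
      (h₃ x) ?_ ?_ ?_
    · intro i x hx
      exact ⟨DirectSum.of (fun i => deg i) i ⟨x, hx⟩, by simp⟩
    · exact ⟨0, by simp⟩
    · rintro x y ⟨a, rfl⟩ ⟨b, rfl⟩
      exact ⟨a + b, by simp⟩

section Graded

variable {𝕜 : Type u} [Ring 𝕜]

/-- A `ℤ`-graded left module over the graded ring `𝕜 = ⨁ 𝒦 i`. -/
structure GrMod (𝒦 : ℤ → AddSubgroup 𝕜) where
  carrier : Type u
  [grp : AddCommGroup carrier]
  [mod : Module 𝕜 carrier]
  /-- the homogeneous component of degree `i` -/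
  deg : ℤ → AddSubgroup carrier
  isInternal : DirectSum.IsInternal deg
  smul_mem : ∀ {i j : ℤ} {c : 𝕜} {x : carrier}, c ∈ 𝒦 i → x ∈ deg j → c • x ∈ deg (i + j)

attribute [instance] GrMod.grp GrMod.mod

variable {𝒦 : ℤ → AddSubgroup 𝕜}

namespace GrMod

instance : CoeSort (GrMod 𝒦) (Type u) := ⟨GrMod.carrier⟩

noncomputable instance (M : GrMod 𝒦) : DirectSum.Decomposition M.deg :=
  M.isInternal.chooseDecomposition

theorem induction (M : GrMod 𝒦) {p : M → Prop} (h₀ : p 0) (h₁ : ∀ i x, x ∈ M.deg i → p x)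
    (h₂ : ∀ x y, p x → p y → p (x + y)) (x : M) : p x :=
  DirectSum.Decomposition.inductionOn M.deg h₀ (fun {i} m => h₁ i m m.2) h₂ x

/-- The projection of `M` onto its component of degree `i`. -/
noncomputable def proj (M : GrMod 𝒦) (i : ℤ) : M →+ M where
  toFun x := (DirectSum.decompose M.deg x i : M)
  map_zero' := by simp
  map_add' := by simp

theorem proj_same (M : GrMod 𝒦) {i : ℤ} {x : M} (h : x ∈ M.deg i) : M.proj i x = x :=
  DirectSum.decompose_of_mem_same _ h

theorem proj_ne (M : GrMod 𝒦) {i j : ℤ} {x : M} (h : x ∈ M.deg i) (hij : i ≠ j) :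
    M.proj j x = 0 :=
  DirectSum.decompose_of_mem_ne _ h hij

theorem proj_mem (M : GrMod 𝒦) (i : ℤ) (x : M) : M.proj i x ∈ M.deg i :=
  (DirectSum.decompose M.deg x i).2

theorem mem_iSup (M : GrMod 𝒦) (x : M) : x ∈ ⨆ i, M.deg i :=
  M.induction (zero_mem _) (fun i _ hx => (le_iSup M.deg i) hx) (fun _ _ => add_mem) x

/-- Additive extension of a family of additive maps given on the homogeneous components. -/
noncomputable def ofComponents (M : GrMod 𝒦) {P : Type u} [AddCommGroup P]
    (φ : (i : ℤ) → M.deg i →+ P) : M →+ P :=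
  (DirectSum.toAddMonoid φ).comp (DirectSum.decomposeAddEquiv M.deg).toAddMonoidHom

theorem ofComponents_apply (M : GrMod 𝒦) {P : Type u} [AddCommGroup P]
    (φ : (i : ℤ) → M.deg i →+ P) {i : ℤ} {x : M} (h : x ∈ M.deg i) :
    M.ofComponents φ x = φ i ⟨x, h⟩ := by
  simp [ofComponents, DirectSum.decompose_of_mem _ h]

/-- The additive map `x ↦ (-1)^{d|x|} x`. -/
noncomputable def sgn (M : GrMod 𝒦) (d : ℤ) : M →+ M :=
  M.ofComponents fun i => koszulSign (d * i) • (M.deg i).subtype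

theorem sgn_apply (M : GrMod 𝒦) (d : ℤ) {i : ℤ} {x : M} (h : x ∈ M.deg i) :
    M.sgn d x = koszulSign (d * i) • x := by
  simp [sgn, M.ofComponents_apply _ h]

theorem sgn_smul (M : GrMod 𝒦) (d : ℤ) {i : ℤ} {c : 𝕜} (hc : c ∈ 𝒦 i) (x : M) :
    M.sgn d (c • x) = koszulSign (d * i) • c • M.sgn d x := by
  refine M.induction (p := fun x => M.sgn d (c • x) = koszulSign (d * i) • c • M.sgn d x)
    ?_ ?_ ?_ x
  · simp
  · intro j x hx
    rw [M.sgn_apply d (M.smul_mem hc hx), M.sgn_apply d hx, mul_add, koszulSign_add, mul_smul,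
      smul_comm c]
  · intro x y hx hy
    simp only [smul_add, map_add, hx, hy]

/-- The shift `M[a]`: the same module, with `M[a]^k = M^{a+k}`. -/
def shift (M : GrMod 𝒦) (a : ℤ) : GrMod 𝒦 where
  carrier := M
  deg k := M.deg (a + k)
  isInternal := isInternal_of_proj _ (fun i => M.proj (a + i)) (fun i x hx => M.proj_same hx)
    (fun i j x hx hij => M.proj_ne hx (by simpa using hij)) (fun x => by
      refine M.induction (p := fun x => x ∈ ⨆ i, M.deg (a + i)) (zero_mem _) ?_
        (fun _ _ => add_mem) x
      intro i x hx
      refine (le_iSup (fun i => M.deg (a + i)) (i - a)) ?_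
      simpa using hx)
  smul_mem {i j c x} hc hx := by
    have := M.smul_mem hc hx
    rwa [show i + (a + j) = a + (i + j) by ring] at this

end GrMod

/-- The ground ring as a graded module over itself. -/
abbrev GrMod.unit (𝒦 : ℤ → AddSubgroup 𝕜) [GradedRing 𝒦] : GrMod 𝒦 where
  carrier := 𝕜
  deg := 𝒦
  isInternal := DirectSum.Decomposition.isInternal 𝒦
  smul_mem hc hx := SetLike.mul_mem_graded hc hx

/-- A homogeneous `𝕜`-linear map of degree `d`. Maps are left linear; in the source they are
written on the right of the argument, so no sign appears in `(c x).f = c (x.f)`. -/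
structure GrHom (d : ℤ) (M N : GrMod 𝒦) where
  toLin : M →ₗ[𝕜] N
  map_deg : ∀ {i : ℤ} {x : M}, x ∈ M.deg i → toLin x ∈ N.deg (i + d)

namespace GrHom

variable {d e : ℤ} {M N P : GrMod 𝒦}

instance : CoeFun (GrHom d M N) (fun _ => M → N) := ⟨fun f => f.toLin⟩

theorem ext {f g : GrHom d M N} (h : ∀ x, f x = g x) : f = g := by
  cases f; cases g; congr; exact LinearMap.ext h

/-- Change of the name of the degree. -/
def cast (f : GrHom d M N) (h : d = e) : GrHom e M N := ⟨f.toLin, h ▸ f.map_deg⟩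

/-- The identity map. -/
def id (M : GrMod 𝒦) : GrHom 0 M M := ⟨LinearMap.id, fun h => by simpa using h⟩

instance : Zero (GrHom d M N) := ⟨⟨0, fun _ => by simp⟩⟩

instance : Add (GrHom d M N) :=
  ⟨fun f g => ⟨f.toLin + g.toLin, fun h => add_mem (f.map_deg h) (g.map_deg h)⟩⟩

instance : Neg (GrHom d M N) := ⟨fun f => ⟨-f.toLin, fun h => neg_mem (f.map_deg h)⟩⟩

/-- Composition in diagrammatic order: first `f`, then `g`. -/
def comp (f : GrHom d M N) (g : GrHom e N P) : GrHom (d + e) M P :=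
  ⟨g.toLin ∘ₗ f.toLin, fun {i x} h => by
    have := g.map_deg (f.map_deg h)
    rwa [add_assoc] at this⟩

@[simp] theorem id_apply (x : M) : GrHom.id M x = x := rfl
@[simp] theorem zero_apply (x : M) : (0 : GrHom d M N) x = 0 := rfl
@[simp] theorem add_apply (f g : GrHom d M N) (x : M) : (f + g) x = f x + g x := rfl
@[simp] theorem neg_apply (f : GrHom d M N) (x : M) : (-f) x = -f x := rfl
@[simp] theorem comp_apply (f : GrHom d M N) (g : GrHom e N P) (x : M) :
    f.comp g x = g (f x) := rfl
@[simp] theorem cast_apply (f : GrHom d M N) (h : d = e) (x : M) : f.cast h x = f x := rfl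

/-- The "identity map" `σ^a : M → M[a]` of degree `-a`. -/
def sig (M : GrMod 𝒦) (a : ℤ) : GrHom (-a) M (M.shift a) where
  toLin := { toFun := fun x => x, map_add' := fun _ _ => rfl, map_smul' := fun _ _ => rfl }
  map_deg {i x} h := by
    change x ∈ M.deg (a + (i + -a))
    rwa [show a + (i + -a) = i by ring]

/-- The inverse of `σ^a`, of degree `a`. -/
def sigInv (M : GrMod 𝒦) (a : ℤ) : GrHom a (M.shift a) M where
  toLin := { toFun := fun x => x, map_add' := fun _ _ => rfl, map_smul' := fun _ _ => rfl }
  map_deg {i x} h := by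
    have h' : (show M from x) ∈ M.deg (a + i) := h
    rwa [add_comm] at h'

theorem proj_comm (f : GrHom d M N) (i : ℤ) (x : M) :
    N.proj (i + d) (f x) = f (M.proj i x) := by
  refine M.induction (p := fun x => N.proj (i + d) (f x) = f (M.proj i x)) ?_ ?_ ?_ x
  · simp
  · intro j x hx
    by_cases hij : j = i
    · subst hij
      rw [M.proj_same hx, N.proj_same (f.map_deg hx)]
    · rw [M.proj_ne hx hij, N.proj_ne (f.map_deg hx) (by simpa using hij), map_zero]
  · intro x y hx hy
    simp only [map_add, hx, hy]

end GrHom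

/-- The kernel of a homogeneous map, as a graded submodule. -/
def GrMod.ker {d : ℤ} {M N : GrMod 𝒦} (f : GrHom d M N) : GrMod 𝒦 where
  carrier := LinearMap.ker f.toLin
  deg i := (M.deg i).comap (LinearMap.ker f.toLin).subtype.toAddMonoidHom
  isInternal := by
    have hp : ∀ (i : ℤ) (x : M), f x = 0 → f (M.proj i x) = 0 := fun i x hx => by
      rw [← GrHom.proj_comm, hx, map_zero]
    refine isInternal_of_proj _ (fun i => AddMonoidHom.mk'
      (fun x : LinearMap.ker f.toLin => (⟨M.proj i x, hp i x x.2⟩ : LinearMap.ker f.toLin)) ?_)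
      ?_ ?_ ?_
    · intro a b; ext; simp
    · intro i x hx
      exact Subtype.ext (M.proj_same hx)
    · intro i j x hx hij
      exact Subtype.ext (M.proj_ne hx hij)
    · intro x
      classical
      have hx : x = ∑ i ∈ (DirectSum.decompose M.deg (x : M)).support,
          (⟨M.proj i x, hp i x x.2⟩ : LinearMap.ker f.toLin) := by
        ext
        conv_lhs => rw [← DirectSum.sum_support_decompose M.deg (x : M)]
        rw [Submodule.coe_sum]
        rfl
      rw [hx]
      refine sum_mem fun i _ => ?_
      refine (le_iSup (fun i => (M.deg i).comap
        (LinearMap.ker f.toLin).subtype.toAddMonoidHom) i) ?_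
      exact M.proj_mem i x
  smul_mem hc hx := M.smul_mem hc hx

/-- The inclusion of the kernel. -/
def GrHom.kerIncl {d : ℤ} {M N : GrMod 𝒦} (f : GrHom d M N) : GrHom 0 (GrMod.ker f) M where
  toLin := (LinearMap.ker f.toLin).subtype
  map_deg {i x} h := by
    rw [add_zero]; exact h

/-- The direct sum of a sequence of graded modules. -/
def GrMod.dsum (F : ℕ → GrMod 𝒦) : GrMod 𝒦 where
  carrier := ⨁ n, F n
  deg i :=
    { carrier := {z | ∀ n, z n ∈ (F n).deg i}
      zero_mem' := fun n => by simp
      add_mem' := fun ha hb n => by simpa using add_mem (ha n) (hb n)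
      neg_mem' := fun {x} ha n => by
        have h : (-x) n = -(x n) := rfl
        rw [h]; exact neg_mem (ha n) }
  isInternal := by
    refine isInternal_of_proj _ (fun i => DirectSum.map fun n => (F n).proj i) ?_ ?_ ?_
    · intro i x hx
      refine DFinsupp.ext fun n => ?_
      rw [DirectSum.map_apply]
      exact (F n).proj_same (hx n)
    · intro i j x hx hij
      refine DFinsupp.ext fun n => ?_
      rw [DirectSum.map_apply]
      exact (F n).proj_ne (hx n) hij
    · intro z
      induction z using DirectSum.induction_on with
      | zero => exact zero_mem _
      | add x y hx hy => exact add_mem hx hy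
      | of n x =>
        refine (F n).induction (p := fun x => DirectSum.of (fun n => (F n : Type u)) n x ∈ _)
          ?_ ?_ ?_ x
        · rw [map_zero]; exact zero_mem _
        · intro i x hx
          refine AddSubgroup.mem_iSup_of_mem i ?_
          intro m
          by_cases h : m = n
          · subst h; rw [DirectSum.of_eq_same]; exact hx
          · rw [DirectSum.of_eq_of_ne _ _ _ h]; exact zero_mem _
        · intro x y hx hy
          rw [map_add]; exact add_mem hx hy
  smul_mem hc hx n := by
    rw [DirectSum.smul_apply]
    exact (F n).smul_mem hc (hx n)

/-- The inclusion of the `n`-th summand. -/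
def GrHom.inj (F : ℕ → GrMod 𝒦) (n : ℕ) : GrHom 0 (F n) (GrMod.dsum F) where
  toLin := DirectSum.lof 𝕜 ℕ (fun n => (F n : Type u)) n
  map_deg {i x} hx m := by
    rw [add_zero]
    change DirectSum.of (fun n => (F n : Type u)) n x m ∈ _
    by_cases h : m = n
    · subst h; rw [DirectSum.of_eq_same]; exact hx
    · rw [DirectSum.of_eq_of_ne _ _ _ h]; exact zero_mem _

/-- The map out of a direct sum with prescribed restrictions to the summands. -/
def GrHom.dsumLift {d : ℤ} {F : ℕ → GrMod 𝒦} {N : GrMod 𝒦} (f : (n : ℕ) → GrHom d (F n) N) :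
    GrHom d (GrMod.dsum F) N where
  toLin := DirectSum.toModule 𝕜 ℕ N fun n => (f n).toLin
  map_deg {i x} hx := by
    classical
    let z : ⨁ n, (F n : Type u) := x
    have h : z = ∑ n ∈ DFinsupp.support z, DirectSum.lof 𝕜 ℕ (fun n => (F n : Type u)) n (z n) :=
      (DirectSum.sum_support_of z).symm
    change DirectSum.toModule 𝕜 ℕ N (fun n => (f n).toLin) z ∈ _
    rw [h, map_sum]
    refine sum_mem fun n _ => ?_
    rw [DirectSum.toModule_lof]
    exact (f n).map_deg (hx n)

@[simp] theorem GrHom.dsumLift_inj {d : ℤ} {F : ℕ → GrMod 𝒦} {N : GrMod 𝒦}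
    (f : (n : ℕ) → GrHom d (F n) N) (n : ℕ) (x : F n) :
    GrHom.dsumLift f (GrHom.inj F n x) = f n x :=
  DirectSum.toModule_lof (N := N) (φ := fun n => (f n).toLin) 𝕜 n x

section Tensor

namespace GrMod

/-- The relations `x·c ⊗ y = x ⊗ c·y` defining the tensor product over `𝕜`, where
`x·c = (-1)^{|c||x|} c x` is the right action on a graded left module. -/
def tensorRel (M N : GrMod 𝒦) : Set (M ⊗[ℤ] N) :=
  {z | ∃ (i j : ℤ) (c : 𝕜) (x : M) (y : N), c ∈ 𝒦 i ∧ x ∈ M.deg j ∧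
    z = koszulSign (i * j) • ((c • x) ⊗ₜ[ℤ] y) - x ⊗ₜ[ℤ] (c • y)}

/-- The underlying left module of `M ⊗_𝕜 N`. -/
abbrev TensorCarrier (M N : GrMod 𝒦) : Type u :=
  (M ⊗[ℤ] N) ⧸ Submodule.span 𝕜 (tensorRel M N)

/-- The map `(x, y) ↦ x ⊗ y`. -/
def tmkLin (M N : GrMod 𝒦) : M →ₗ[𝕜] N →ₗ[ℤ] TensorCarrier M N where
  toFun x := ((Submodule.span 𝕜 (tensorRel M N)).mkQ.restrictScalars ℤ) ∘ₗ
    (TensorProduct.mk ℤ M N x)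
  map_add' x y := by ext z; exact congrArg _ (TensorProduct.add_tmul x y z)
  map_smul' c x := by ext; rfl

/-- Extension of a left linear balanced map to the tensor product. -/
def tlift {M N : GrMod 𝒦} {P : Type u} [AddCommGroup P] [Module 𝕜 P]
    (φ : M →ₗ[𝕜] N →ₗ[ℤ] P)
    (h : ∀ (i j : ℤ) (c : 𝕜) (x : M) (y : N), c ∈ 𝒦 i → x ∈ M.deg j →
      koszulSign (i * j) • φ (c • x) y = φ x (c • y)) : TensorCarrier M N →ₗ[𝕜] P :=
  Submodule.liftQ _ (TensorProduct.AlgebraTensorModule.lift φ) (by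
    rw [Submodule.span_le]
    rintro _ ⟨i, j, c, x, y, hc, hx, rfl⟩
    have := h i j c x y hc hx
    rw [SetLike.mem_coe, LinearMap.mem_ker, map_sub, map_zsmul, sub_eq_zero]
    exact this)

theorem tlift_mk {M N : GrMod 𝒦} {P : Type u} [AddCommGroup P] [Module 𝕜 P]
    (φ : M →ₗ[𝕜] N →ₗ[ℤ] P) (h) (x : M) (y : N) : tlift φ h (tmkLin M N x y) = φ x y := rfl

theorem tmk_balanced {M N : GrMod 𝒦} {i j : ℤ} {c : 𝕜} {x : M} (y : N)
    (hc : c ∈ 𝒦 i) (hx : x ∈ M.deg j) :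
    tmkLin M N x (c • y) = koszulSign (i * j) • c • tmkLin M N x y := by
  symm
  have := (Submodule.Quotient.eq (Submodule.span 𝕜 (tensorRel M N))
    (x := koszulSign (i * j) • ((c • x) ⊗ₜ[ℤ] y)) (y := x ⊗ₜ[ℤ] (c • y))).2
    (Submodule.subset_span ⟨i, j, c, x, y, hc, hx, rfl⟩)
  exact this

theorem tensor_induction {M N : GrMod 𝒦} {p : TensorCarrier M N → Prop} (h₀ : p 0)
    (h₁ : ∀ i j x y, x ∈ M.deg i → y ∈ N.deg j → p (tmkLin M N x y))
    (h₂ : ∀ x y, p x → p y → p (x + y)) (z : TensorCarrier M N) : p z := by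
  obtain ⟨z, rfl⟩ := Submodule.Quotient.mk_surjective _ z
  induction z using TensorProduct.induction_on with
  | zero => exact h₀
  | add x y hx hy => exact h₂ _ _ hx hy
  | tmul x y =>
    change p (tmkLin M N x y)
    refine M.induction (p := fun x => p (tmkLin M N x y)) ?_ ?_ ?_ x
    · simpa using h₀
    · intro i x hx
      refine N.induction (p := fun y => p (tmkLin M N x y)) ?_ ?_ ?_ y
      · simpa using h₀
      · intro j y hy; exact h₁ i j x y hx hy
      · intro a b ha hb; simpa using h₂ _ _ ha hb
    · intro a b ha hb; simpa using h₂ _ _ ha hb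

variable [GradedRing 𝒦] [IsGradedStronglyCommutative 𝒦]

theorem scalar_induction {p : 𝕜 → Prop} (h₀ : p 0) (h₁ : ∀ i c, c ∈ 𝒦 i → p c)
    (h₂ : ∀ a b, p a → p b → p (a + b)) (c : 𝕜) : p c :=
  DirectSum.Decomposition.inductionOn 𝒦 h₀ (fun {i} m => h₁ i m m.2) h₂ c

theorem smul_smul_comm {M : GrMod 𝒦} {i j : ℤ} {a b : 𝕜} (ha : a ∈ 𝒦 i) (hb : b ∈ 𝒦 j) (x : M) :
    b • a • x = koszulSign (i * j) • a • b • x := by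
  rw [← mul_smul, IsGradedStronglyCommutative.comm ha hb, smul_assoc, mul_smul]

/-- Extension of an additive balanced map to the tensor product. -/
def tliftAdd {M N : GrMod 𝒦} {P : Type u} [AddCommGroup P]
    (φ : M →ₗ[ℤ] N →ₗ[ℤ] P)
    (h : ∀ (i j : ℤ) (c : 𝕜) (x : M) (y : N), c ∈ 𝒦 i → x ∈ M.deg j →
      koszulSign (i * j) • φ (c • x) y = φ x (c • y)) : TensorCarrier M N →+ P :=
  QuotientAddGroup.lift (Submodule.span 𝕜 (tensorRel M N)).toAddSubgroup
    (TensorProduct.lift φ : M ⊗[ℤ] N →ₗ[ℤ] P).toAddMonoidHom (by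
      intro z hz
      refine Submodule.closure_induction
        (p := fun z _ => (TensorProduct.lift φ) z = 0) ?_ ?_ ?_ hz
      · exact map_zero _
      · intro x y _ _ hx hy
        rw [map_add, hx, hy, add_zero]
      · rintro r _ ⟨i, j, c, x, y, hc, hx, rfl⟩
        refine scalar_induction (𝒦 := 𝒦) (p := fun r => TensorProduct.lift φ (r •
          (koszulSign (i * j) • ((c • x) ⊗ₜ[ℤ] y) - x ⊗ₜ[ℤ] (c • y))) = 0) ?_ ?_ ?_ r
        · rw [zero_smul, map_zero]
        · intro k r hr
          have h1 := h i (k + j) c (r • x) y hc (M.smul_mem hr hx)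
          rw [smul_sub, smul_comm r, TensorProduct.smul_tmul', TensorProduct.smul_tmul', map_sub,
            TensorProduct.lift.tmul, TensorProduct.smul_tmul' r x, TensorProduct.lift.tmul, ← h1,
            smul_smul_comm hc hr, map_zsmul, map_zsmul, LinearMap.smul_apply, LinearMap.smul_apply,
            smul_smul, mul_add i, koszulSign_add (i * k), mul_comm (koszulSign (i * k)), sub_self]
        · intro a b ha hb
          rw [add_smul, map_add, ha, hb, add_zero])

theorem tliftAdd_mk {M N : GrMod 𝒦} {P : Type u} [AddCommGroup P]
    (φ : M →ₗ[ℤ] N →ₗ[ℤ] P) (h) (x : M) (y : N) : tliftAdd φ h (tmkLin M N x y) = φ x y := rfl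

/-- The tensor product over `𝕜` of graded modules, with left action `c (x ⊗ y) = c x ⊗ y` and
`|x ⊗ y| = |x| + |y|`. -/
def tensor (M N : GrMod 𝒦) : GrMod 𝒦 where
  carrier := TensorCarrier M N
  deg k := AddSubgroup.closure {z | ∃ (i j : ℤ) (x : M) (y : N), i + j = k ∧ x ∈ M.deg i ∧
    y ∈ N.deg j ∧ z = tmkLin M N x y}
  isInternal := by
    let φ : ℤ → M →ₗ[ℤ] N →ₗ[ℤ] TensorCarrier M N := fun k =>
      (M.ofComponents fun i => AddMonoidHom.mk' (fun x : M.deg i =>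
        (tmkLin M N x) ∘ₗ (N.proj (k - i)).toIntLinearMap) (by
          intro a b; ext; simp)).toIntLinearMap
    have hφ : ∀ k i x y, x ∈ M.deg i → φ k x y = tmkLin M N x (N.proj (k - i) y) := by
      intro k i x y hx
      exact congrArg (fun f : N →ₗ[ℤ] TensorCarrier M N => f y)
        (M.ofComponents_apply (P := N →ₗ[ℤ] TensorCarrier M N) _ hx)
    have hproj : ∀ (k i : ℤ) (c : 𝕜) (y : N), c ∈ 𝒦 i →
        N.proj k (c • y) = c • N.proj (k - i) y := by
      intro k i c y hc
      refine N.induction (p := fun y => N.proj k (c • y) = c • N.proj (k - i) y) ?_ ?_ ?_ y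
      · simp
      · intro j y hy
        by_cases hk : i + j = k
        · subst hk
          rw [N.proj_same (N.smul_mem hc hy), add_sub_cancel_left, N.proj_same hy]
        · rw [N.proj_ne (N.smul_mem hc hy) hk, N.proj_ne hy (by omega), smul_zero]
      · intro a b ha hb
        simp only [smul_add, map_add, ha, hb]
    have hbal : ∀ k, ∀ (i j : ℤ) (c : 𝕜) (x : M) (y : N), c ∈ 𝒦 i → x ∈ M.deg j →
        koszulSign (i * j) • φ k (c • x) y = φ k x (c • y) := by
      intro k i j c x y hc hx
      rw [hφ k _ _ _ (M.smul_mem hc hx), hφ k _ _ _ hx, hproj _ i c y hc, tmk_balanced _ hc hx,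
        map_smul, LinearMap.smul_apply, show k - (i + j) = k - j - i by ring]
    refine isInternal_of_proj _ (fun k => tliftAdd (φ k) (hbal k)) ?_ ?_ ?_
    · intro k z hz
      induction hz using AddSubgroup.closure_induction with
      | mem z hz =>
        obtain ⟨i, j, x, y, rfl, hx, hy, rfl⟩ := hz
        rw [tliftAdd_mk, hφ _ _ _ _ hx, add_sub_cancel_left, N.proj_same hy]
      | zero => exact map_zero _
      | add x y _ _ hx hy => rw [map_add, hx, hy]
      | neg x _ hx => rw [map_neg, hx]
    · intro k l z hz hkl
      induction hz using AddSubgroup.closure_induction with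
      | mem z hz =>
        obtain ⟨i, j, x, y, rfl, hx, hy, rfl⟩ := hz
        rw [tliftAdd_mk, hφ _ _ _ _ hx, N.proj_ne hy (by omega), map_zero]
      | zero => exact map_zero _
      | add x y _ _ hx hy => rw [map_add, hx, hy, add_zero]
      | neg x _ hx => rw [map_neg, hx, neg_zero]
    · intro z
      refine tensor_induction (zero_mem _) ?_ (fun _ _ => add_mem) z
      intro i j x y hx hy
      exact AddSubgroup.mem_iSup_of_mem (i + j)
        (AddSubgroup.subset_closure ⟨i, j, x, y, rfl, hx, hy, rfl⟩)
  smul_mem {i j c z} hc hz := by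
    induction hz using AddSubgroup.closure_induction with
    | mem z hz =>
      obtain ⟨a, b, x, y, rfl, hx, hy, rfl⟩ := hz
      refine AddSubgroup.subset_closure ⟨i + a, b, c • x, y, by ring, M.smul_mem hc hx, hy, ?_⟩
      rw [map_smul]; rfl
    | zero => rw [smul_zero]; exact zero_mem _
    | add x y _ _ hx hy => rw [smul_add]; exact add_mem hx hy
    | neg x _ hx => rw [smul_neg]; exact neg_mem hx

/-- The element `x ⊗ y`. -/
def tmk {M N : GrMod 𝒦} (x : M) (y : N) : M.tensor N := tmkLin M N x y

theorem tmk_mem {M N : GrMod 𝒦} {i j : ℤ} {x : M} {y : N} (hx : x ∈ M.deg i) (hy : y ∈ N.deg j) :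
    tmk x y ∈ (M.tensor N).deg (i + j) :=
  AddSubgroup.subset_closure ⟨i, j, x, y, rfl, hx, hy, rfl⟩

theorem tmk_add {M N : GrMod 𝒦} (x : M) (y y' : N) : tmk x (y + y') = tmk x y + tmk x y' :=
  map_add (tmkLin M N x) y y'

theorem add_tmk {M N : GrMod 𝒦} (x x' : M) (y : N) : tmk (x + x') y = tmk x y + tmk x' y :=
  congrArg (fun f => f y) (map_add (tmkLin M N) x x')

theorem smul_tmk {M N : GrMod 𝒦} (c : 𝕜) (x : M) (y : N) : tmk (c • x) y = c • tmk x y :=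
  congrArg (fun f => f y) (map_smul (tmkLin M N) c x)

theorem tmk_zsmul {M N : GrMod 𝒦} (n : ℤ) (x : M) (y : N) : tmk x (n • y) = n • tmk x y :=
  map_zsmul (tmkLin M N x) n y

theorem zsmul_tmk {M N : GrMod 𝒦} (n : ℤ) (x : M) (y : N) : tmk (n • x) y = n • tmk x y :=
  congrArg (fun f => f y) (map_zsmul (tmkLin M N) n x)

theorem tmk_smul {M N : GrMod 𝒦} {i j : ℤ} {c : 𝕜} {x : M} (y : N)
    (hc : c ∈ 𝒦 i) (hx : x ∈ M.deg j) :
    tmk x (c • y) = koszulSign (i * j) • c • tmk x y :=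
  tmk_balanced y hc hx

end GrMod

open GrMod

variable [GradedRing 𝒦] [IsGradedStronglyCommutative 𝒦]

namespace GrHom

variable {d e : ℤ} {M N P M' N' : GrMod 𝒦}

/-- The homogeneous map of degree `d` out of a tensor product with `x ⊗ y ↦ φ x y`. -/
def tlift (φ : M → N → P) (hl : ∀ x x' y, φ (x + x') y = φ x y + φ x' y)
    (hr : ∀ x y y', φ x (y + y') = φ x y + φ x y')
    (hs : ∀ (i j k : ℤ) (c : 𝕜) (x : M) (y : N), c ∈ 𝒦 i → x ∈ M.deg j → y ∈ N.deg k →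
      φ (c • x) y = c • φ x y)
    (hb : ∀ (i j k : ℤ) (c : 𝕜) (x : M) (y : N), c ∈ 𝒦 i → x ∈ M.deg j → y ∈ N.deg k →
      φ x (c • y) = koszulSign (i * j) • φ (c • x) y)
    (hd : ∀ (i j : ℤ) (x : M) (y : N), x ∈ M.deg i → y ∈ N.deg j →
      φ x y ∈ P.deg (i + j + d)) : GrHom d (M.tensor N) P :=
  have hl0 : ∀ y, φ 0 y = 0 := fun y => by simpa using hl 0 0 y
  have hr0 : ∀ x, φ x 0 = 0 := fun x => by simpa using hr x 0 0
  let ψ : M →ₗ[𝕜] N →ₗ[ℤ] P :=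
    { toFun := fun x => (AddMonoidHom.mk' (φ x) (hr x)).toIntLinearMap
      map_add' := fun x x' => by ext y; exact hl x x' y
      map_smul' := fun c x => by
        ext y
        change φ (c • x) y = c • φ x y
        refine scalar_induction (𝒦 := 𝒦) (p := fun c => φ (c • x) y = c • φ x y) ?_ ?_ ?_ c
        · simp only [zero_smul, hl0]
        · intro i c hc
          refine M.induction (p := fun x => φ (c • x) y = c • φ x y) ?_ ?_ ?_ x
          · simp only [smul_zero, hl0]
          · intro j x hx
            refine N.induction (p := fun y => φ (c • x) y = c • φ x y) ?_ ?_ ?_ y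
            · simp only [smul_zero, hr0]
            · intro k y hy; exact hs i j k c x y hc hx hy
            · intro a b ha hb; simp only [smul_add, hr, ha, hb]
          · intro a b ha hb; simp only [smul_add, hl, ha, hb]
        · intro a b ha hb; simp only [add_smul, hl, ha, hb] }
  have hψ : ∀ (i j : ℤ) (c : 𝕜) (x : M) (y : N), c ∈ 𝒦 i → x ∈ M.deg j →
      koszulSign (i * j) • ψ (c • x) y = ψ x (c • y) := fun i j c x y hc hx => by
    change koszulSign (i * j) • φ (c • x) y = φ x (c • y)
    refine N.induction (p := fun y => koszulSign (i * j) • φ (c • x) y = φ x (c • y)) ?_ ?_ ?_ y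
    · simp only [smul_zero, hr0]
    · intro k y hy; exact (hb i j k c x y hc hx hy).symm
    · intro a b ha hb; simp only [smul_add, hr, ha, hb]
  { toLin := GrMod.tlift ψ hψ
    map_deg := fun {k z} hz => by
      change GrMod.tlift ψ hψ z ∈ _
      induction hz using AddSubgroup.closure_induction with
      | mem z hz =>
        obtain ⟨i, j, x, y, rfl, hx, hy, rfl⟩ := hz
        rw [GrMod.tlift_mk]
        exact hd i j x y hx hy
      | zero => exact (map_zero (GrMod.tlift ψ hψ)).symm ▸ zero_mem _
      | add x y _ _ hx hy => exact (map_add (GrMod.tlift ψ hψ) x y).symm ▸ add_mem hx hy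
      | neg x _ hx => exact (map_neg (GrMod.tlift ψ hψ) x).symm ▸ neg_mem hx }

theorem tlift_tmk (φ : M → N → P) (hl hr hs hb hd) (x : M) (y : N) :
    tlift (d := d) φ hl hr hs hb hd (tmk x y) = φ x y := rfl

/-- Homogeneous maps out of a tensor product agree if they agree on homogeneous tensors. -/
theorem tensor_ext_apply {f : GrHom d (M.tensor N) P} {g : GrHom e (M.tensor N) P}
    (h : ∀ i j x y, x ∈ M.deg i → y ∈ N.deg j → f (tmk x y) = g (tmk x y))
    (z : M.tensor N) : f z = g z := by
  refine GrMod.tensor_induction (p := fun z => f.toLin z = g.toLin z) ?_ h ?_ z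
  · exact (map_zero f.toLin).trans (map_zero g.toLin).symm
  · intro a b ha hb
    exact (map_add f.toLin a b).trans ((congrArg₂ (· + ·) ha hb).trans (map_add g.toLin a b).symm)

/-- The tensor product of homogeneous maps,
`(x ⊗ y).(f ⊗ g) = (-1)^{|y||f|} x.f ⊗ y.g`. -/
noncomputable def tens (f : GrHom d M M') (g : GrHom e N N') :
    GrHom (d + e) (M.tensor N) (M'.tensor N') :=
  tlift (fun x y => tmk (f x) (g (N.sgn d y)))
    (fun x x' y => by rw [map_add, add_tmk])
    (fun x y y' => by rw [map_add, map_add, tmk_add])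
    (fun i j k c x y _ _ _ => by rw [map_smul, smul_tmk])
    (fun i j k c x y hc hx hy => by
      rw [f.toLin.map_smul, smul_tmk, N.sgn_smul d hc, map_zsmul, g.toLin.map_smul, tmk_zsmul,
        tmk_smul _ hc (f.map_deg hx), smul_smul, mul_add i, koszulSign_add, mul_comm d i,
        mul_comm (koszulSign (i * j)), ← mul_assoc, koszulSign_mul_self, one_mul])
    (fun i j x y hx hy => by
      rw [N.sgn_apply d hy, map_zsmul, tmk_zsmul]
      refine zsmul_mem ?_ _
      have := tmk_mem (f.map_deg hx) (g.map_deg hy)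
      rwa [show i + d + (j + e) = i + j + (d + e) by ring] at this)

theorem tens_tmk (f : GrHom d M M') (g : GrHom e N N') (x : M) {j : ℤ} {y : N}
    (hy : y ∈ N.deg j) :
    f.tens g (tmk x y) = koszulSign (d * j) • tmk (f x) (g y) := by
  change tmk (f x) (g (N.sgn d y)) = _
  rw [N.sgn_apply d hy, map_zsmul, tmk_zsmul]

/-- The left unit isomorphism `𝕜 ⊗ M → M`, `c ⊗ x ↦ c x`. -/
def lunit (M : GrMod 𝒦) : GrHom 0 ((GrMod.unit 𝒦).tensor M) M :=
  tlift (fun (c : 𝕜) x => c • x)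
    (fun a b x => add_smul a b x)
    (fun a x y => smul_add a x y)
    (fun i j k c a x _ _ _ => mul_smul c a x)
    (fun i j k c a x hc ha _ => by
      change a • c • x = koszulSign (i * j) • ((c * a) • x)
      rw [mul_smul, smul_smul_comm hc ha])
    (fun i j a x ha hx => by
      rw [add_zero]
      exact M.smul_mem ha hx)

theorem lunit_tmk (M : GrMod 𝒦) (c : 𝕜) (x : M) :
    lunit M (tmk (M := GrMod.unit 𝒦) c x) = c • x := rfl

/-- The inverse left unit isomorphism `M → 𝕜 ⊗ M`, `x ↦ 1 ⊗ x`. -/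
def lunitInv (M : GrMod 𝒦) : GrHom 0 M ((GrMod.unit 𝒦).tensor M) where
  toLin :=
    { toFun := fun x => tmk (M := GrMod.unit 𝒦) (1 : 𝕜) x
      map_add' := fun x y => tmk_add _ x y
      map_smul' := fun c x => by
        refine scalar_induction (𝒦 := 𝒦) (p := fun c => tmk (M := GrMod.unit 𝒦) (1 : 𝕜) (c • x) =
          c • tmk (M := GrMod.unit 𝒦) (1 : 𝕜) x) ?_ ?_ ?_ c
        · simp only [zero_smul]; exact map_zero (tmkLin (GrMod.unit 𝒦) M (1 : 𝕜))
        · intro i c hc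
          rw [tmk_smul (M := GrMod.unit 𝒦) x hc
            (show (1 : 𝕜) ∈ 𝒦 0 from SetLike.one_mem_graded 𝒦), mul_zero, koszulSign_zero, one_smul]
        · intro a b ha hb
          simp only [add_smul, ← ha, ← hb]
          exact tmk_add _ _ _ }
  map_deg {i x} hx := by
    have := tmk_mem (M := GrMod.unit 𝒦) (show (1 : 𝕜) ∈ 𝒦 0 from SetLike.one_mem_graded 𝒦) hx
    rwa [show (0 : ℤ) + i = i + 0 by ring] at this

/-- The right action `x ↦ x·c`, `x·c = (-1)^{|c||x|} c x`, of a scalar. -/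
noncomputable def rsmul (M : GrMod 𝒦) (c : 𝕜) : M →+ M :=
  M.ofComponents fun i => AddMonoidHom.mk'
    (fun x : M.deg i => ((GrMod.unit 𝒦).sgn i c : 𝕜) • (x : M))
    (fun a b => smul_add _ _ _)

theorem rsmul_apply (M : GrMod 𝒦) {i j : ℤ} {x : M} {c : 𝕜} (hx : x ∈ M.deg i) (hc : c ∈ 𝒦 j) :
    rsmul M c x = koszulSign (i * j) • c • x := by
  rw [rsmul, M.ofComponents_apply _ hx]
  change ((GrMod.unit 𝒦).sgn i c : 𝕜) • x = _
  rw [(GrMod.unit 𝒦).sgn_apply i hc]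
  exact smul_assoc _ _ _

theorem rsmul_add (M : GrMod 𝒦) (c c' : 𝕜) (x : M) :
    rsmul M (c + c') x = rsmul M c x + rsmul M c' x := by
  refine M.induction (p := fun x => rsmul M (c + c') x = rsmul M c x + rsmul M c' x) ?_ ?_ ?_ x
  · simp only [map_zero, add_zero]
  · intro i x hx
    simp only [rsmul, M.ofComponents_apply _ hx]
    change ((GrMod.unit 𝒦).sgn i (c + c') : 𝕜) • x = ((GrMod.unit 𝒦).sgn i c : 𝕜) • x +
      ((GrMod.unit 𝒦).sgn i c' : 𝕜) • x
    rw [← add_smul]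
    exact congrArg (· • x) (map_add ((GrMod.unit 𝒦).sgn i) c c')
  · intro a b ha hb
    rw [map_add, map_add, map_add, ha, hb]; abel

/-- The right unit isomorphism `M ⊗ 𝕜 → M`, `x ⊗ c ↦ x·c`. -/
noncomputable def runit (M : GrMod 𝒦) : GrHom 0 (M.tensor (GrMod.unit 𝒦)) M :=
  tlift (N := GrMod.unit 𝒦) (fun x c => rsmul M c x)
    (fun x y c => map_add _ _ _)
    (fun x c c' => rsmul_add M c c' x)
    (fun i j k a x c ha hx hc => by
      rw [rsmul_apply M (M.smul_mem ha hx) hc, rsmul_apply M hx hc, smul_comm a,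
        smul_smul_comm ha hc, smul_smul, add_mul, koszulSign_add, mul_right_comm,
        koszulSign_mul_self, one_mul])
    (fun i j k a x c ha hx hc => by
      rw [rsmul_apply M hx ((GrMod.unit 𝒦).smul_mem ha hc), rsmul_apply M (M.smul_mem ha hx) hc,
        smul_smul_comm ha hc, smul_smul, smul_smul]
      change koszulSign (j * (i + k)) • ((a * c) • x) = _
      rw [mul_smul, add_mul, koszulSign_add, mul_add, koszulSign_add, mul_comm j i]
      congr 1
      have h1 := koszulSign_mul_self (i * k)
      linear_combination (- koszulSign (i * j) * koszulSign (j * k)) * h1)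
    (fun i j x c hx hc => by
      rw [rsmul_apply M hx hc]
      refine zsmul_mem ?_ _
      have := M.smul_mem hc hx
      rwa [show j + i = i + j + 0 by ring] at this)

theorem runit_tmk (M : GrMod 𝒦) (x : M) (c : 𝕜) :
    runit M (tmk (N := GrMod.unit 𝒦) x c) = rsmul M c x := rfl

/-- `x ⊗ y ↦ x ⊗ (y ⊗ p)`. -/
def assocAux (M N P : GrMod 𝒦) (p : P) : M.tensor N →+ M.tensor (N.tensor P) :=
  (GrMod.tlift (P := (M.tensor (N.tensor P)).carrier)
    { toFun := fun x => (AddMonoidHom.mk' (fun y => tmk x (tmk y p))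
        (fun y y' => by rw [add_tmk, tmk_add])).toIntLinearMap
      map_add' := fun x x' => by ext y; exact add_tmk _ _ _
      map_smul' := fun c x => by ext y; exact smul_tmk _ _ _ }
    (fun i j c x y hc hx => by
      change koszulSign (i * j) • tmk (c • x) (tmk y p) = tmk x (tmk (c • y) p)
      rw [smul_tmk, smul_tmk, tmk_smul _ hc hx])).toAddMonoidHom

theorem assocAux_tmk (M N P : GrMod 𝒦) (x : M) (y : N) (p : P) :
    assocAux M N P p (tmk x y) = tmk x (tmk y p) := rfl

/-- Induction on the homogeneous elements of a tensor product. -/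
theorem tensor_deg_induction {k : ℤ} {p : M.tensor N → Prop} (h₀ : p 0)
    (h₁ : ∀ i j x y, i + j = k → x ∈ M.deg i → y ∈ N.deg j → p (tmk x y))
    (h₂ : ∀ x y, p x → p y → p (x + y)) (h₃ : ∀ x, p x → p (-x))
    {z : M.tensor N} (hz : z ∈ (M.tensor N).deg k) : p z := by
  induction hz using AddSubgroup.closure_induction with
  | mem z hz =>
    obtain ⟨i, j, x, y, h, hx, hy, rfl⟩ := hz
    exact h₁ i j x y h hx hy
  | zero => exact h₀
  | add x y _ _ hx hy => exact h₂ x y hx hy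
  | neg x _ hx => exact h₃ x hx

/-- Induction on the elements of a tensor product. -/
theorem tensor_ind {p : M.tensor N → Prop} (h₀ : p 0)
    (h₁ : ∀ i j x y, x ∈ M.deg i → y ∈ N.deg j → p (tmk x y))
    (h₂ : ∀ x y, p x → p y → p (x + y)) (z : M.tensor N) : p z :=
  GrMod.tensor_induction (p := p) h₀ h₁ h₂ z

/-- The associativity isomorphism `(M ⊗ N) ⊗ P → M ⊗ (N ⊗ P)`. -/
def assoc (M N P : GrMod 𝒦) : GrHom 0 ((M.tensor N).tensor P) (M.tensor (N.tensor P)) :=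
  tlift (fun z p => assocAux M N P p z)
    (fun z z' p => map_add _ _ _)
    (fun z p p' => by
      refine tensor_ind (p := fun z => assocAux M N P (p + p') z =
        assocAux M N P p z + assocAux M N P p' z) ?_ ?_ ?_ z
      · simp only [map_zero, add_zero]
      · intro i j x y _ _
        simp only [assocAux_tmk, tmk_add]
      · intro a b ha hb
        simp only [map_add, ha, hb]; abel)
    (fun i j k c z p hc hz hp => by
      refine tensor_ind (p := fun z => assocAux M N P p (c • z) = c • assocAux M N P p z)
        ?_ ?_ ?_ z
      · simp only [map_zero, smul_zero]
      · intro i j x y _ _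
        rw [← smul_tmk, assocAux_tmk, assocAux_tmk, smul_tmk]
      · intro a b ha hb
        simp only [smul_add, map_add, ha, hb])
    (fun i j k c z p hc hz hp => by
      refine tensor_deg_induction (p := fun z => assocAux M N P (c • p) z =
        koszulSign (i * j) • assocAux M N P p (c • z)) ?_ ?_ ?_ ?_ hz
      · simp only [map_zero, smul_zero]
      · rintro a b x y rfl hx hy
        rw [← smul_tmk, assocAux_tmk, assocAux_tmk, smul_tmk, tmk_smul _ hc hy, tmk_zsmul,
          tmk_smul _ hc hx, smul_smul, mul_add, koszulSign_add, mul_comm (koszulSign (i * b))]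
      · intro a b ha hb
        simp only [smul_add, map_add, ha, hb]
      · intro a ha
        simp only [smul_neg, map_neg, ha])
    (fun i j z p hz hp => by
      refine tensor_deg_induction (p := fun z => assocAux M N P p z ∈
        (M.tensor (N.tensor P)).deg (i + j + 0)) ?_ ?_ ?_ ?_ hz
      · rw [map_zero]; exact zero_mem _
      · rintro a b x y rfl hx hy
        have := tmk_mem hx (tmk_mem hy hp)
        rwa [show a + (b + j) = a + b + j + 0 by ring] at this
      · intro a b ha hb
        rw [map_add]; exact add_mem ha hb
      · intro a ha
        rw [map_neg]; exact neg_mem ha)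

theorem assoc_tmk (M N P : GrMod 𝒦) (x : M) (y : N) (p : P) :
    assoc M N P (tmk (tmk x y) p) = tmk x (tmk y p) := rfl

theorem assocInv_bal {i j : ℤ} {c : 𝕜} {y : N} (x : M) (p : P) (hc : c ∈ 𝒦 i) (hy : y ∈ N.deg j) :
    koszulSign (i * j) • tmk (tmk x (c • y)) p = tmk (tmk x y) (c • p) := by
  refine M.induction (p := fun x => koszulSign (i * j) • tmk (tmk x (c • y)) p =
    tmk (tmk x y) (c • p)) ?_ ?_ ?_ x
  · have h0 : ∀ y : N, tmk (0 : M) y = 0 := fun y => by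
      have := zsmul_tmk 0 (0 : M) y
      simpa only [zero_smul] using this
    have h1 : ∀ q : P, tmk (0 : M.tensor N) q = 0 := fun q => by
      have := zsmul_tmk 0 (0 : M.tensor N) q
      simpa only [zero_smul] using this
    rw [h0, h0, h1, h1, smul_zero]
  · intro k x hx
    rw [tmk_smul _ hc hx, zsmul_tmk, smul_tmk, tmk_smul _ hc (tmk_mem hx hy), smul_smul, mul_add,
      koszulSign_add, mul_comm (koszulSign (i * j))]
  · intro a b ha hb
    simp only [add_tmk, smul_add, ha, hb]

/-- `y ⊗ p ↦ (x ⊗ y) ⊗ p`. -/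
def assocInvAux (M N P : GrMod 𝒦) (x : M) : N.tensor P →+ (M.tensor N).tensor P :=
  GrMod.tliftAdd (M := N) (N := P)
    (LinearMap.mk₂ ℤ (fun y p => tmk (tmk x y) p)
      (fun a b p => by rw [tmk_add, add_tmk]) (fun n a p => by rw [tmk_zsmul, zsmul_tmk])
      (fun a p q => by rw [tmk_add]) (fun n a p => by rw [tmk_zsmul]))
    (fun _ _ _ _ p hc hy => assocInv_bal x p hc hy)

theorem assocInvAux_tmk (M N P : GrMod 𝒦) (x : M) (y : N) (p : P) :
    assocInvAux M N P x (tmk y p) = tmk (tmk x y) p := rfl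

/-- The inverse associativity isomorphism `M ⊗ (N ⊗ P) → (M ⊗ N) ⊗ P`. -/
def assocInv (M N P : GrMod 𝒦) : GrHom 0 (M.tensor (N.tensor P)) ((M.tensor N).tensor P) :=
  tlift (fun x z => assocInvAux M N P x z)
    (fun x x' z => by
      refine tensor_ind (p := fun z => assocInvAux M N P (x + x') z =
        assocInvAux M N P x z + assocInvAux M N P x' z) ?_ ?_ ?_ z
      · simp only [map_zero, add_zero]
      · intro i j y p _ _
        simp only [assocInvAux_tmk, add_tmk]
      · intro s t hs ht
        simp only [map_add, hs, ht]; abel)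
    (fun x z z' => map_add _ _ _)
    (fun i j k c x z _ _ _ => by
      refine tensor_ind (p := fun z => assocInvAux M N P (c • x) z = c • assocInvAux M N P x z)
        ?_ ?_ ?_ z
      · simp only [map_zero, smul_zero]
      · intro i j y p _ _
        rw [assocInvAux_tmk, assocInvAux_tmk, smul_tmk, smul_tmk]
      · intro s t hs ht
        simp only [map_add, smul_add, hs, ht])
    (fun i j k c x z hc hx _ => by
      refine tensor_ind (p := fun z => assocInvAux M N P x (c • z) =
        koszulSign (i * j) • assocInvAux M N P (c • x) z) ?_ ?_ ?_ z
      · simp only [map_zero, smul_zero]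
      · intro k l y p _ _
        rw [← smul_tmk, assocInvAux_tmk, assocInvAux_tmk, tmk_smul _ hc hx, zsmul_tmk, smul_tmk,
          smul_tmk, smul_tmk]
      · intro s t hs ht
        simp only [map_add, smul_add, hs, ht])
    (fun i j x z hx hz => by
      refine tensor_deg_induction (p := fun z => assocInvAux M N P x z ∈
        ((M.tensor N).tensor P).deg (i + j + 0)) ?_ ?_ ?_ ?_ hz
      · rw [map_zero]; exact zero_mem _
      · rintro a b y p rfl hy hp
        have := tmk_mem (tmk_mem hx hy) hp
        rwa [show i + a + b = i + (a + b) + 0 by ring] at this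
      · intro a b ha hb
        rw [map_add]; exact add_mem ha hb
      · intro a ha
        rw [map_neg]; exact neg_mem ha)

theorem assocInv_tmk (M N P : GrMod 𝒦) (x : M) (y : N) (p : P) :
    assocInv M N P (tmk x (tmk y p)) = tmk (tmk x y) p := rfl

/-- The homogeneous map `𝕜 → M`, `c ↦ c m`, given by an element `m` of degree `d`. -/
def ofElem {m : M} (hm : m ∈ M.deg d) : GrHom d (GrMod.unit 𝒦) M where
  toLin := LinearMap.toSpanSingleton 𝕜 M m
  map_deg hc := M.smul_mem hc hm

theorem dsum_deg_induction {F : ℕ → GrMod 𝒦} {j : ℤ} {p : (⨁ n, (F n : Type u)) → Prop} (h₀ : p 0)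
    (h₁ : ∀ n x, x ∈ (F n).deg j → p (DirectSum.of (fun n => (F n : Type u)) n x))
    (h₂ : ∀ x y, p x → p y → p (x + y)) {z : ⨁ n, (F n : Type u)}
    (hz : ∀ n, z n ∈ (F n).deg j) : p z := by
  classical
  rw [← DirectSum.sum_support_of z]
  exact Finset.sum_induction _ p h₂ h₀ fun n _ => h₁ n _ (hz n)

/-- A family of maps `F n ⊗ N → P` extends to `(⨁ F n) ⊗ N → P`. -/
def dsumTensorLift {F : ℕ → GrMod 𝒦} (f : (n : ℕ) → GrHom d ((F n).tensor N) P) :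
    GrHom d ((GrMod.dsum F).tensor N) P :=
  let φ : N → (⨁ n, (F n : Type u)) →+ P := fun y => DirectSum.toAddMonoid fun n =>
    AddMonoidHom.mk' (fun x => f n (tmk x y)) (fun x x' => by rw [add_tmk, map_add])
  have hφ : ∀ (y : N) (n : ℕ) (x : F n),
      φ y (DirectSum.of (fun n => (F n : Type u)) n x) = f n (tmk x y) :=
    fun y n x => DirectSum.toAddMonoid_of _ _ _
  have hof : ∀ (c : 𝕜) (n : ℕ) (x : F n), c • DirectSum.of (fun n => (F n : Type u)) n x =
      DirectSum.of (fun n => (F n : Type u)) n (c • x) := fun c n x =>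
    (map_smul (DirectSum.lof 𝕜 ℕ (fun n => (F n : Type u)) n) c x).symm
  tlift (M := GrMod.dsum F) (fun z y => φ y z)
    (fun z z' y => map_add _ _ _)
    (fun z y y' => by
      refine DirectSum.induction_on (motive := fun z => φ (y + y') z = φ y z + φ y' z) z ?_ ?_ ?_
      · simp only [map_zero, add_zero]
      · intro n x
        rw [hφ, hφ, hφ, tmk_add, map_add]
      · intro a b ha hb
        rw [map_add, map_add, map_add, ha, hb]; abel)
    (fun i j k c z y _ _ _ => by
      refine DirectSum.induction_on (motive := fun z => φ y (c • z) = c • φ y z) z ?_ ?_ ?_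
      · simp only [smul_zero, map_zero]
      · intro n x
        rw [hof, hφ, hφ, smul_tmk, (f n).toLin.map_smul]
      · intro a b ha hb
        rw [smul_add, map_add, map_add, ha, hb, smul_add])
    (fun i j k c z y hc hz _ => by
      refine dsum_deg_induction (p := fun z => φ (c • y) z = koszulSign (i * j) • φ y (c • z))
        ?_ ?_ ?_ hz
      · simp only [smul_zero, map_zero]
      · intro n x hx
        rw [hof, hφ, hφ, smul_tmk, tmk_smul _ hc hx, map_zsmul]
      · intro a b ha hb
        rw [smul_add, map_add, map_add, ha, hb, smul_add])
    (fun i j z y hz hy => by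
      refine dsum_deg_induction (p := fun z => φ y z ∈ P.deg (i + j + d)) ?_ ?_ ?_ hz
      · rw [map_zero]; exact zero_mem _
      · intro n x hx
        rw [hφ]
        exact (f n).map_deg (tmk_mem hx hy)
      · intro a b ha hb
        rw [map_add]; exact add_mem ha hb)

theorem dsumTensorLift_tmk {F : ℕ → GrMod 𝒦} (f : (n : ℕ) → GrHom d ((F n).tensor N) P)
    (n : ℕ) (x : F n) (y : N) :
    dsumTensorLift f (tmk (GrHom.inj F n x) y) = f n (tmk x y) :=
  DirectSum.toAddMonoid_of (β := fun n => (F n : Type u)) (fun n =>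
    AddMonoidHom.mk' (fun x => f n (tmk x y)) (fun x x' => by rw [add_tmk, map_add])) n x

/-- A family of maps `N ⊗ F n → P` extends to `N ⊗ (⨁ F n) → P`. -/
def tensorDsumLift {F : ℕ → GrMod 𝒦} (f : (n : ℕ) → GrHom d (N.tensor (F n)) P) :
    GrHom d (N.tensor (GrMod.dsum F)) P :=
  let φ : N → (⨁ n, (F n : Type u)) →+ P := fun y => DirectSum.toAddMonoid fun n =>
    AddMonoidHom.mk' (fun x => f n (tmk y x)) (fun x x' => by rw [tmk_add, map_add])
  have hφ : ∀ (y : N) (n : ℕ) (x : F n),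
      φ y (DirectSum.of (fun n => (F n : Type u)) n x) = f n (tmk y x) :=
    fun y n x => DirectSum.toAddMonoid_of _ _ _
  have hof : ∀ (c : 𝕜) (n : ℕ) (x : F n), c • DirectSum.of (fun n => (F n : Type u)) n x =
      DirectSum.of (fun n => (F n : Type u)) n (c • x) := fun c n x =>
    (map_smul (DirectSum.lof 𝕜 ℕ (fun n => (F n : Type u)) n) c x).symm
  tlift (N := GrMod.dsum F) (fun y z => φ y z)
    (fun y y' z => by
      refine DirectSum.induction_on (motive := fun z => φ (y + y') z = φ y z + φ y' z) z ?_ ?_ ?_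
      · simp only [map_zero, add_zero]
      · intro n x
        rw [hφ, hφ, hφ, add_tmk, map_add]
      · intro a b ha hb
        rw [map_add, map_add, map_add, ha, hb]; abel)
    (fun y z z' => map_add _ _ _)
    (fun i j k c y z _ _ _ => by
      refine DirectSum.induction_on (motive := fun z => φ (c • y) z = c • φ y z) z ?_ ?_ ?_
      · simp only [smul_zero, map_zero]
      · intro n x
        rw [hφ, hφ, smul_tmk, (f n).toLin.map_smul]
      · intro a b ha hb
        rw [map_add, map_add, ha, hb, smul_add])
    (fun i j k c y z hc hy _ => by
      refine DirectSum.induction_on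
        (motive := fun z => φ y (c • z) = koszulSign (i * j) • φ (c • y) z) z ?_ ?_ ?_
      · simp only [smul_zero, map_zero]
      · intro n x
        rw [hof, hφ, hφ, smul_tmk, tmk_smul _ hc hy, map_zsmul]
      · intro a b ha hb
        rw [smul_add, map_add, map_add, ha, hb, smul_add])
    (fun i j y z hy hz => by
      refine dsum_deg_induction (p := fun z => φ y z ∈ P.deg (i + j + d)) ?_ ?_ ?_ hz
      · rw [map_zero]; exact zero_mem _
      · intro n x hx
        rw [hφ]
        exact (f n).map_deg (tmk_mem hy hx)
      · intro a b ha hb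
        rw [map_add]; exact add_mem ha hb)

theorem tensorDsumLift_tmk {F : ℕ → GrMod 𝒦} (f : (n : ℕ) → GrHom d (N.tensor (F n)) P)
    (n : ℕ) (x : F n) (y : N) :
    tensorDsumLift f (tmk y (GrHom.inj F n x)) = f n (tmk y x) :=
  DirectSum.toAddMonoid_of (β := fun n => (F n : Type u)) (fun n =>
    AddMonoidHom.mk' (fun x => f n (tmk y x)) (fun x x' => by rw [tmk_add, map_add])) n x

theorem map_rsmul (f : GrHom 0 M N) {i : ℤ} {c : 𝕜} (hc : c ∈ 𝒦 i) (x : M) :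
    f (rsmul M c x) = rsmul N c (f x) := by
  refine M.induction (p := fun x => f (rsmul M c x) = rsmul N c (f x)) ?_ ?_ ?_ x
  · simp only [map_zero]
  · intro j x hx
    have hfx := f.map_deg hx
    rw [add_zero] at hfx
    rw [rsmul_apply M hx hc, rsmul_apply N hfx hc, map_zsmul, f.toLin.map_smul]
  · intro a b ha hb
    simp only [map_add, ha, hb]

end GrHom

end Tensor
section TensorAlgebra

open GrMod

variable [GradedRing 𝒦] [IsGradedStronglyCommutative 𝒦]

theorem GrMod.one_mem_unit : (1 : 𝕜) ∈ (GrMod.unit 𝒦).deg 0 := SetLike.one_mem_graded 𝒦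

/-- The tensor powers: `X^{⊗0} = 𝕜` and `X^{⊗(n+1)} = X ⊗ X^{⊗n}`. -/
def GrMod.tpow (X : GrMod 𝒦) : ℕ → GrMod 𝒦
  | 0 => GrMod.unit 𝒦
  | n + 1 => X.tensor (tpow X n)

/-- `X T^≥ = ⨁_{n ≥ 0} X^{⊗n}`. -/
def GrMod.T (X : GrMod 𝒦) : GrMod 𝒦 := GrMod.dsum X.tpow

namespace TensorConstr

variable (X : GrMod 𝒦)

/-- The inclusion `X^{⊗n} → X T^≥`. -/
def inj (n : ℕ) : GrHom 0 (X.tpow n) X.T := GrHom.inj X.tpow n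

/-- The isomorphism `X → X^{⊗1}`, `x ↦ x ⊗ 1`. -/
def toPowOne : GrHom 0 X (X.tpow 1) where
  toLin :=
    { toFun := fun x => tmk (N := GrMod.unit 𝒦) x (1 : 𝕜)
      map_add' := fun x y => add_tmk x y _
      map_smul' := fun c x => smul_tmk c x _ }
  map_deg {i x} hx := tmk_mem (N := GrMod.unit 𝒦) hx one_mem_unit

/-- The inclusion of generators `X → X T^≥`. -/
def gen : GrHom 0 X X.T := (toPowOne X).comp (inj X 1)

/-- The unit `1 ∈ X^{⊗0} = 𝕜 ⊂ X T^≥`. -/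
def tone : X.T := inj X 0 (show (GrMod.unit 𝒦 : Type u) from (1 : 𝕜))

theorem tone_mem : tone X ∈ X.T.deg 0 := by
  have := (inj X 0).map_deg (i := 0) (x := (show (GrMod.unit 𝒦 : Type u) from (1 : 𝕜)))
    (one_mem_unit (𝒦 := 𝒦))
  rwa [add_zero] at this

/-- The projection `X T^≥ → X^{⊗0} = 𝕜`. -/
def proj₀ : GrHom 0 X.T (GrMod.unit 𝒦) :=
  GrHom.dsumLift fun
    | 0 => GrHom.id (GrMod.unit 𝒦)
    | _ + 1 => 0

theorem proj₀_tone : proj₀ X (tone X) = (1 : 𝕜) := GrHom.dsumLift_inj _ _ _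

/-- The map `X ⊗ X T^≥ → X T^≥`, `x ⊗ (x₁ ⋯ xₙ) ↦ x x₁ ⋯ xₙ`. -/
def cons : GrHom 0 (X.tensor X.T) X.T :=
  GrHom.tensorDsumLift fun n => inj X (n + 1)

/-- The multiplication `X^{⊗n} ⊗ X T^≥ → X T^≥`, by recursion
`c · z = c z`, `(x ⊗ w) · z = x ⊗ (w · z)`. -/
noncomputable def mulAux : (n : ℕ) → GrHom 0 ((X.tpow n).tensor X.T) X.T
  | 0 => GrHom.lunit X.T
  | n + 1 => (((GrHom.assoc X (X.tpow n) X.T).comp ((GrHom.id X).tens (mulAux n))).comp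
      (cons X)).cast (by norm_num)

/-- The multiplication (concatenation) of the tensor algebra. -/
noncomputable def mul : GrHom 0 (X.T.tensor X.T) X.T := GrHom.dsumTensorLift (mulAux X)

/-- The element `1 ⊗ 1` of `X T^≥ ⊗ X T^≥`. -/
def toneTone : X.T.tensor X.T := tmk (tone X) (tone X)

theorem toneTone_mem : toneTone X ∈ (X.T.tensor X.T).deg 0 := by
  have := tmk_mem (tone_mem X) (tone_mem X)
  rwa [add_zero] at this

/-- The map `z ↦ 1 ⊗ z`. -/
noncomputable def oneTensor : GrHom 0 X.T (X.T.tensor X.T) :=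
  ((GrHom.lunitInv X.T).comp ((inj X 0).tens (GrHom.id X.T))).cast (by norm_num)

/-- The map `x ⊗ (z ⊗ z') ↦ x z ⊗ z'`. -/
noncomputable def consTensor : GrHom 0 (X.tensor (X.T.tensor X.T)) (X.T.tensor X.T) :=
  ((GrHom.assocInv X X.T X.T).comp ((cons X).tens (GrHom.id X.T))).cast (by norm_num)

/-- The cut coproduct on `X^{⊗n}`, by recursion `Δ(c) = c (1 ⊗ 1)`,
`Δ(x w) = 1 ⊗ x w + (x · ⊗ 1) Δ(w)`. -/
noncomputable def comulAux : (n : ℕ) → GrHom 0 (X.tpow n) (X.T.tensor X.T)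
  | 0 => GrHom.ofElem (toneTone_mem X)
  | n + 1 => ((inj X (n + 1)).comp (oneTensor X)).cast (by norm_num) +
      (((GrHom.id X).tens (comulAux n)).comp (consTensor X)).cast (by norm_num)

/-- The cut coproduct `Δ(x₁ ⋯ xₙ) = ∑_{k=0}^n x₁ ⋯ x_k ⊗ x_{k+1} ⋯ xₙ`. -/
noncomputable def comul : GrHom 0 X.T (X.T.tensor X.T) := GrHom.dsumLift (comulAux X)

variable {X}

/-- `f^{⊗n} : X^{⊗n} → Y^{⊗n}`. -/
noncomputable def powMap {Y : GrMod 𝒦} (f : GrHom 0 X Y) : (n : ℕ) → GrHom 0 (X.tpow n) (Y.tpow n)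
  | 0 => GrHom.id (GrMod.unit 𝒦)
  | n + 1 => (f.tens (powMap f n)).cast (by norm_num)

/-- The map `X T^≥ → Y T^≥` with components `f^{⊗n}`. -/
noncomputable def map {Y : GrMod 𝒦} (f : GrHom 0 X Y) : GrHom 0 X.T Y.T :=
  GrHom.dsumLift fun n => ((powMap f n).comp (inj Y n)).cast (by norm_num)

/-- The homogeneous map out of `X T^≥` with components `φ₀` on `𝕜`, `φ₁` on `X`, `φ₂` on `X ⊗ X`
and zero on the other tensor powers. -/
noncomputable def ofLow {d : ℤ} {N : GrMod 𝒦} (φ₀ : GrHom d (GrMod.unit 𝒦) N) (φ₁ : GrHom d X N)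
    (φ₂ : GrHom d (X.tensor X) N) : GrHom d X.T N :=
  GrHom.dsumLift fun
    | 0 => φ₀
    | 1 => ((GrHom.runit X).comp φ₁).cast (by ring)
    | 2 => (((GrHom.id X).tens (GrHom.runit X)).comp φ₂).cast (by ring)
    | _ + 3 => 0

/-- The algebra homomorphism `X T^≥ → Y T^≥` with restriction `φ` to the generators, on `X^{⊗n}`:
`c ↦ c`, `x ⊗ w ↦ φ(x) · f(w)`. -/
noncomputable def algHomAux {Y : GrMod 𝒦} (φ : GrHom 0 X Y.T) :
    (n : ℕ) → GrHom 0 (X.tpow n) Y.T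
  | 0 => inj Y 0
  | n + 1 => ((φ.tens (algHomAux φ n)).comp (mul Y)).cast (by norm_num)

/-- The algebra homomorphism `X T^≥ → Y T^≥` with restriction `φ` to the generators. -/
noncomputable def algHom {Y : GrMod 𝒦} (φ : GrHom 0 X Y.T) : GrHom 0 X.T Y.T :=
  GrHom.dsumLift (algHomAux φ)

/-- The degree `1` derivation with restriction `ξ` to the generators, on `X^{⊗n}`: `c ↦ 0`,
`(x ⊗ w).D = x · (w.D) + (-1)^{|w|} (x.ξ) · w`. -/
noncomputable def derAux (ξ : GrHom 1 X X.T) : (n : ℕ) → GrHom 1 (X.tpow n) X.T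
  | 0 => 0
  | n + 1 => (((GrHom.id X).tens (derAux ξ n)).comp (cons X)).cast (by norm_num) +
      ((ξ.tens (inj X n)).comp (mul X)).cast (by norm_num)

/-- The degree `1` derivation of `X T^≥` with restriction `ξ` to the generators. -/
noncomputable def der (ξ : GrHom 1 X X.T) : GrHom 1 X.T X.T := GrHom.dsumLift (derAux ξ)

/-- The maps `b₂ ⊗ 1^{⊗ n-2}` on `X^{⊗n}`. -/
noncomputable def head₂ (b₂ : GrHom 1 (X.tensor X) X) : (n : ℕ) → GrHom 1 (X.tpow n) X.T
  | 0 => 0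
  | 1 => 0
  | n + 2 => ((GrHom.assocInv X X (X.tpow n)).comp ((b₂.tens (GrHom.id (X.tpow n))).comp
      (inj X (n + 1)))).cast (by norm_num)

/-- The maps `b₁ ⊗ 1^{⊗ n-1}` on `X^{⊗n}`. -/
noncomputable def head₁ (b₁ : GrHom 1 X X) : (n : ℕ) → GrHom 1 (X.tpow n) X.T
  | 0 => 0
  | n + 1 => ((b₁.tens (GrHom.id (X.tpow n))).comp (inj X (n + 1))).cast (by norm_num)

/-- The maps `b₀ ⊗ 1^{⊗ n}` on `X^{⊗n}`. -/
noncomputable def head₀ (b₀ : GrHom 1 (GrMod.unit 𝒦) X) (n : ℕ) : GrHom 1 (X.tpow n) X.T :=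
  ((GrHom.lunitInv (X.tpow n)).comp ((b₀.tens (GrHom.id (X.tpow n))).comp
    (inj X (n + 1)))).cast (by norm_num)

/-- The map `∑_{r+k+t=n} 1^{⊗r} ⊗ b_k ⊗ 1^{⊗t}` on `X^{⊗n}`, by recursion on `n`: the terms with
`r > 0` are `1 ⊗` (the map on `X^{⊗(n-1)}`), the terms with `r = 0` are the `head` maps. -/
noncomputable def coderAux (b₀ : GrHom 1 (GrMod.unit 𝒦) X) (b₁ : GrHom 1 X X)
    (b₂ : GrHom 1 (X.tensor X) X) : (n : ℕ) → GrHom 1 (X.tpow n) X.T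
  | 0 => head₀ b₀ 0
  | n + 1 => (((GrHom.id X).tens (coderAux b₀ b₁ b₂ n)).comp (cons X)).cast (by norm_num) +
      (head₀ b₀ (n + 1) + head₁ b₁ (n + 1) + head₂ b₂ (n + 1))

/-- The degree `1` coderivation of `X T^≥` with components `b₀`, `b₁`, `b₂`. -/
noncomputable def coder (b₀ : GrHom 1 (GrMod.unit 𝒦) X) (b₁ : GrHom 1 X X)
    (b₂ : GrHom 1 (X.tensor X) X) : GrHom 1 X.T X.T :=
  GrHom.dsumLift (coderAux b₀ b₁ b₂)

end TensorConstr

end TensorAlgebra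

section Curved

open GrMod

variable [GradedRing 𝒦] [IsGradedStronglyCommutative 𝒦]

variable (𝒦) in
/-- The data `(A, m₂, m₁, m₀, η, v)` of a curved algebra with complemented unit. The `𝕜`-linear
maps `m₀ : 𝕜 → A` and `η : 𝕜 → A` are given by the images `m₀` and `one` of `1 ∈ 𝕜`. -/
structure AlgData where
  A : GrMod 𝒦
  m₂ : GrHom 0 (A.tensor A) A
  m₁ : GrHom 1 A A
  m₀ : A
  one : A
  v : GrHom 0 A (GrMod.unit 𝒦)
  m₀_mem : m₀ ∈ A.deg 2
  one_mem : one ∈ A.deg 0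
  /-- `η v = 1` -/
  v_one : v one = (1 : 𝕜)

namespace AlgData

/-- The axioms of a unit-complemented curved algebra. -/
structure IsUnitComplementedCurved (A : AlgData 𝒦) : Prop where
  /-- `(1 ⊗ m₂) m₂ = (m₂ ⊗ 1) m₂` -/
  assoc : ∀ x y z : A.A, A.m₂ (tmk x (A.m₂ (tmk y z))) = A.m₂ (tmk (A.m₂ (tmk x y)) z)
  /-- `m₂ m₁ = (1 ⊗ m₁ + m₁ ⊗ 1) m₂` -/
  leibniz : ∀ z : A.A.tensor A.A,
    A.m₁ (A.m₂ z) = A.m₂ ((GrHom.id A.A).tens A.m₁ z) + A.m₂ (A.m₁.tens (GrHom.id A.A) z)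
  /-- `m₁² = (m₀ ⊗ 1 - 1 ⊗ m₀) m₂` -/
  curvature : ∀ x : A.A, A.m₁ (A.m₁ x) = A.m₂ (tmk A.m₀ x) - A.m₂ (tmk x A.m₀)
  /-- `m₀ m₁ = 0` -/
  bianchi : A.m₁ A.m₀ = 0
  /-- `(1 ⊗ η) m₂ = 1` -/
  mul_one : ∀ x : A.A, A.m₂ (tmk x A.one) = x
  /-- `(η ⊗ 1) m₂ = 1` -/
  one_mul : ∀ x : A.A, A.m₂ (tmk A.one x) = x
  /-- `η m₁ = 0` -/
  m₁_one : A.m₁ A.one = 0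

/-- `Ā = Ker v`. -/
def bar (A : AlgData 𝒦) : GrMod 𝒦 := GrMod.ker A.v

/-- The inclusion `Ā → A`. -/
def incl (A : AlgData 𝒦) : GrHom 0 A.bar A.A := A.v.kerIncl

/-- The projection `1 - v η : A → Ā`. -/
def pr (A : AlgData 𝒦) : GrHom 0 A.A A.bar where
  toLin := LinearMap.codRestrict (LinearMap.ker A.v.toLin)
    (LinearMap.id - (LinearMap.toSpanSingleton 𝕜 A.A A.one) ∘ₗ A.v.toLin) (fun x => by
      rw [LinearMap.mem_ker]
      change A.v (x - (A.v x : 𝕜) • A.one) = 0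
      rw [map_sub, A.v.toLin.map_smul, A.v_one]
      exact sub_eq_zero.2 (_root_.mul_one (A.v x : 𝕜)).symm)
  map_deg {i x} hx := by
    rw [add_zero]
    change x - (A.v x : 𝕜) • A.one ∈ A.A.deg i
    refine sub_mem hx ?_
    have := A.A.smul_mem (A.v.map_deg hx) A.one_mem
    simpa only [add_zero] using this

/-- `σ⁻¹` followed by the inclusion, `Ā[1] → Ā → A`. -/
def lift (A : AlgData 𝒦) : GrHom 1 (A.bar.shift 1) A.A :=
  ((GrHom.sigInv A.bar 1).comp A.incl).cast (by norm_num)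

/-- `A → Ā → Ā[1]`, the projection followed by `σ`. -/
def proj (A : AlgData 𝒦) : GrHom (-1) A.A (A.bar.shift 1) :=
  (A.pr.comp (GrHom.sig A.bar 1)).cast (by norm_num)

end AlgData

variable (𝒦) in
/-- A unit-complemented curved algebra. -/
structure UCCAlg extends AlgData 𝒦 where
  isUnitComplementedCurved : toAlgData.IsUnitComplementedCurved

namespace UCCAlg

/-- A morphism of unit-complemented curved algebras: a pair `(f₁, und)`, where the degree `1` map
`𝕜 → 𝕜` is given by the image `und ∈ 𝕜¹` of `1`. -/
@[ext]
structure Hom (A B : UCCAlg 𝒦) where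
  f₁ : GrHom 0 A.A B.A
  und : 𝕜
  und_mem : und ∈ 𝒦 1
  map_m₂ : ∀ z : A.A.tensor A.A, B.m₂ (f₁.tens f₁ z) = f₁ (A.m₂ z)
  map_m₁ : ∀ x : A.A, B.m₁ (f₁ x) = f₁ (A.m₁ x)
  map_m₀ : f₁ A.m₀ = B.m₀
  map_one : f₁ A.one = B.one

noncomputable instance : Category (UCCAlg 𝒦) where
  Hom := Hom
  id A :=
    { f₁ := GrHom.id A.A
      und := 0
      und_mem := zero_mem _
      map_m₂ := fun z => by
        have h : (GrHom.id A.A).tens (GrHom.id A.A) z = GrHom.id (A.A.tensor A.A) z := by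
          refine GrHom.tensor_ext_apply ?_ z
          intro i j x y _ hy
          rw [GrHom.tens_tmk _ _ _ hy, zero_mul, koszulSign_zero, one_smul]; rfl
        rw [h]; rfl
      map_m₁ := fun _ => rfl
      map_m₀ := rfl
      map_one := rfl }
  comp {A B C} f g :=
    { f₁ := (f.f₁.comp g.f₁).cast (by norm_num)
      und := g.und + f.und
      und_mem := add_mem g.und_mem f.und_mem
      map_m₂ := fun z => by
        have h : ((f.f₁.comp g.f₁).cast (by norm_num : (0 : ℤ) + 0 = 0)).tens
            ((f.f₁.comp g.f₁).cast (by norm_num : (0 : ℤ) + 0 = 0)) z =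
            ((f.f₁.tens f.f₁).comp (g.f₁.tens g.f₁)) z := by
          refine GrHom.tensor_ext_apply ?_ z
          intro i j x y _ hy
          have hy' := f.f₁.map_deg hy
          rw [GrHom.tens_tmk _ _ _ hy, GrHom.comp_apply, GrHom.tens_tmk _ _ _ hy, map_zsmul,
            GrHom.tens_tmk _ _ _ hy', zero_mul, zero_mul, koszulSign_zero, one_smul, one_smul,
            one_smul]
          rfl
        rw [h, GrHom.comp_apply, g.map_m₂, f.map_m₂]; rfl
      map_m₁ := fun x => by
        simp only [GrHom.cast_apply, GrHom.comp_apply, g.map_m₁, f.map_m₁]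
      map_m₀ := by simp only [GrHom.cast_apply, GrHom.comp_apply, f.map_m₀, g.map_m₀]
      map_one := by simp only [GrHom.cast_apply, GrHom.comp_apply, f.map_one, g.map_one] }
  id_comp f := Hom.ext rfl (add_zero _)
  comp_id f := Hom.ext rfl (zero_add _)
  assoc f g h := Hom.ext rfl (add_assoc _ _ _).symm

end UCCAlg

variable (𝒦) in
/-- The data `(C, δ₂, δ₁, δ₀, ε, w)` of a curved coalgebra with split counit: the map
`w : 𝕜 → C` is given by the image `w` of `1 ∈ 𝕜`. -/
structure CoalgData where
  C : GrMod 𝒦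
  δ₂ : GrHom 0 C (C.tensor C)
  δ₁ : GrHom 1 C C
  δ₀ : GrHom 2 C (GrMod.unit 𝒦)
  ε : GrHom 0 C (GrMod.unit 𝒦)
  w : C
  w_mem : w ∈ C.deg 0
  /-- `w ε = 1` -/
  ε_w : ε w = (1 : 𝕜)

namespace CoalgData

/-- `C̄ = Ker ε`. -/
def bar (C : CoalgData 𝒦) : GrMod 𝒦 := GrMod.ker C.ε

/-- The inclusion `C̄ → C`. -/
def incl (C : CoalgData 𝒦) : GrHom 0 C.bar C.C := C.ε.kerIncl

/-- The projection `1 - ε w : C → C̄`. -/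
def pr (C : CoalgData 𝒦) : GrHom 0 C.C C.bar where
  toLin := LinearMap.codRestrict (LinearMap.ker C.ε.toLin)
    (LinearMap.id - (LinearMap.toSpanSingleton 𝕜 C.C C.w) ∘ₗ C.ε.toLin) (fun x => by
      rw [LinearMap.mem_ker]
      change C.ε (x - (C.ε x : 𝕜) • C.w) = 0
      rw [map_sub, C.ε.toLin.map_smul, C.ε_w]
      exact sub_eq_zero.2 (_root_.mul_one (C.ε x : 𝕜)).symm)
  map_deg {i x} hx := by
    rw [add_zero]
    change x - (C.ε x : 𝕜) • C.w ∈ C.C.deg i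
    refine sub_mem hx ?_
    have := C.C.smul_mem (C.ε.map_deg hx) C.w_mem
    simpa only [add_zero] using this

/-- `σ` followed by the inclusion, `C̄[-1] → C̄ → C`. -/
def lift (C : CoalgData 𝒦) : GrHom (-1) (C.bar.shift (-1)) C.C :=
  ((GrHom.sigInv C.bar (-1)).comp C.incl).cast (by norm_num)

/-- `C → C̄ → C̄[-1]`, the projection followed by `σ⁻¹`. -/
def proj (C : CoalgData 𝒦) : GrHom 1 C.C (C.bar.shift (-1)) :=
  (C.pr.comp (GrHom.sig C.bar (-1))).cast (by norm_num)

/-- The reduced comultiplication `C̄ → C → C ⊗ C → C̄ ⊗ C̄`. -/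
noncomputable def redComul (C : CoalgData 𝒦) : GrHom 0 C.bar (C.bar.tensor C.bar) :=
  (C.incl.comp (C.δ₂.comp (C.pr.tens C.pr))).cast (by norm_num)

/-- The iterated reduced comultiplication `C̄ → C̄^{⊗(n+1)}`. -/
noncomputable def redIter (C : CoalgData 𝒦) : (n : ℕ) → GrHom 0 C.bar (C.bar.tpow (n + 1))
  | 0 => TensorConstr.toPowOne C.bar
  | n + 1 => (C.redComul.comp ((GrHom.id C.bar).tens (redIter C n))).cast (by norm_num)

/-- The axioms of a curved augmented coalgebra. -/
structure IsCurvedAugmented (C : CoalgData 𝒦) : Prop where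
  /-- `δ₂ (1 ⊗ δ₂) = δ₂ (δ₂ ⊗ 1)` -/
  coassoc : ∀ x : C.C, (GrHom.id C.C).tens C.δ₂ (C.δ₂ x) =
    GrHom.assoc C.C C.C C.C (C.δ₂.tens (GrHom.id C.C) (C.δ₂ x))
  /-- `δ₁ δ₂ = δ₂ (1 ⊗ δ₁ + δ₁ ⊗ 1)` -/
  coleibniz : ∀ x : C.C, C.δ₂ (C.δ₁ x) =
    (GrHom.id C.C).tens C.δ₁ (C.δ₂ x) + C.δ₁.tens (GrHom.id C.C) (C.δ₂ x)
  /-- `δ₁² = δ₂ (1 ⊗ δ₀ - δ₀ ⊗ 1)` -/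
  curvature : ∀ x : C.C, C.δ₁ (C.δ₁ x) =
    GrHom.runit C.C ((GrHom.id C.C).tens C.δ₀ (C.δ₂ x)) -
      GrHom.lunit C.C (C.δ₀.tens (GrHom.id C.C) (C.δ₂ x))
  /-- `δ₁ δ₀ = 0` -/
  bianchi : ∀ x : C.C, C.δ₀ (C.δ₁ x) = 0
  /-- `δ₂ (1 ⊗ ε) = 1` -/
  counit_right : ∀ x : C.C, GrHom.runit C.C ((GrHom.id C.C).tens C.ε (C.δ₂ x)) = x
  /-- `δ₂ (ε ⊗ 1) = 1` -/
  counit_left : ∀ x : C.C, GrHom.lunit C.C (C.ε.tens (GrHom.id C.C) (C.δ₂ x)) = x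
  /-- `δ₁ ε = 0` -/
  ε_δ₁ : ∀ x : C.C, C.ε (C.δ₁ x) = 0
  /-- `w δ₂ = w ⊗ w` -/
  δ₂_w : C.δ₂ C.w = tmk C.w C.w
  /-- conilpotency: `⋃_{n > 1} Ker (C̄ → C̄^{⊗n}) = C̄` -/
  conilpotent : ∀ x : C.bar, ∃ n : ℕ, 1 ≤ n ∧ C.redIter n x = 0

end CoalgData

variable (𝒦) in
/-- A curved augmented coalgebra. -/
structure CACoalg extends CoalgData 𝒦 where
  isCurvedAugmented : toCoalgData.IsCurvedAugmented

namespace CACoalg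

/-- A morphism of curved augmented coalgebras: a pair `(g₁, g₀)`. -/
@[ext]
structure Hom (C D : CACoalg 𝒦) where
  g₁ : GrHom 0 C.C D.C
  g₀ : GrHom 1 C.C (GrMod.unit 𝒦)
  /-- `δ₂ (g₁ ⊗ g₁) = g₁ δ₂` -/
  map_δ₂ : ∀ x : C.C, g₁.tens g₁ (C.δ₂ x) = D.δ₂ (g₁ x)
  /-- `δ₁ g₁ + δ₂ (g₀ ⊗ g₁ - g₁ ⊗ g₀) = g₁ δ₁` -/
  map_δ₁ : ∀ x : C.C, g₁ (C.δ₁ x) + (GrHom.lunit D.C (g₀.tens g₁ (C.δ₂ x)) -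
    GrHom.runit D.C (g₁.tens g₀ (C.δ₂ x))) = D.δ₁ (g₁ x)
  /-- `δ₀ - δ₁ g₀ - δ₂ (g₀ ⊗ g₀) = g₁ δ₀` -/
  map_δ₀ : ∀ x : C.C, C.δ₀ x - g₀ (C.δ₁ x) -
    GrHom.lunit (GrMod.unit 𝒦) (g₀.tens g₀ (C.δ₂ x)) = D.δ₀ (g₁ x)
  /-- `g₁ ε = ε` -/
  map_ε : ∀ x : C.C, D.ε (g₁ x) = C.ε x
  /-- `w g₁ = w` -/
  map_w : g₁ C.w = D.w

/-- The identity morphism `(id, 0)`. -/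
noncomputable def idHom (C : CACoalg 𝒦) : Hom C C where
  g₁ := GrHom.id C.C
  g₀ := 0
  map_δ₂ x := by
    have h : ∀ z, (GrHom.id C.C).tens (GrHom.id C.C) z = GrHom.id (C.C.tensor C.C) z := by
      refine GrHom.tensor_ext_apply ?_
      intro i j x y _ hy
      rw [GrHom.tens_tmk _ _ _ hy, zero_mul, koszulSign_zero, one_smul]; rfl
    rw [h]; rfl
  map_δ₁ x := by
    have h₁ : ∀ z, GrHom.lunit C.C ((0 : GrHom 1 C.C (GrMod.unit 𝒦)).tens (GrHom.id C.C) z) = 0 := by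
      refine GrHom.tensor_ind (by simp only [map_zero]) ?_ ?_
      · intro i j x y _ hy
        rw [GrHom.tens_tmk _ _ _ hy, map_zsmul]
        change koszulSign (1 * j) • ((0 : 𝕜) • y) = 0
        rw [zero_smul, smul_zero]
      · intro a b ha hb
        rw [map_add, map_add, ha, hb, add_zero]
    have h₂ : ∀ z, GrHom.runit C.C ((GrHom.id C.C).tens (0 : GrHom 1 C.C (GrMod.unit 𝒦)) z) = 0 := by
      refine GrHom.tensor_ind (by simp only [map_zero]) ?_ ?_
      · intro i j x y hx hy
        rw [GrHom.tens_tmk _ _ _ hy, map_zsmul]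
        erw [GrHom.runit_tmk, GrHom.rsmul_apply _ hx (zero_mem (𝒦 0))]
        rw [zero_smul, smul_zero, smul_zero]
      · intro a b ha hb
        rw [map_add, map_add, ha, hb, add_zero]
    rw [h₁, h₂, sub_zero, add_zero]; rfl
  map_δ₀ x := by
    have h₁ : ∀ z, GrHom.lunit (GrMod.unit 𝒦) ((0 : GrHom 1 C.C (GrMod.unit 𝒦)).tens
        (0 : GrHom 1 C.C (GrMod.unit 𝒦)) z) = 0 := by
      refine GrHom.tensor_ind (by simp only [map_zero]) ?_ ?_
      · intro i j x y _ hy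
        rw [GrHom.tens_tmk _ _ _ hy, map_zsmul]
        change koszulSign (1 * j) • ((0 : 𝕜) * (0 : 𝕜)) = 0
        rw [mul_zero, smul_zero]
      · intro a b ha hb
        rw [map_add, map_add, ha, hb, add_zero]
    rw [h₁, GrHom.zero_apply, sub_zero, sub_zero]; rfl
  map_ε _ := rfl
  map_w := rfl

theorem comp_left {A B C : GrMod 𝒦} (f₁ : GrHom 0 A B) (f₀ : GrHom 1 A (GrMod.unit 𝒦))
    (g₁ : GrHom 0 B C) (g₀ : GrHom 1 B (GrMod.unit 𝒦)) (z : A.tensor A) :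
    GrHom.lunit C ((f₀ + (f₁.comp g₀).cast (by norm_num)).tens
      ((f₁.comp g₁).cast (by norm_num : (0 : ℤ) + 0 = 0)) z) =
    g₁ (GrHom.lunit B (f₀.tens f₁ z)) + GrHom.lunit C (g₀.tens g₁ (f₁.tens f₁ z)) := by
  revert z
  refine GrHom.tensor_ind (by simp only [map_zero, add_zero]) ?_ ?_
  · intro i j x y hx hy
    have hy' := f₁.map_deg hy
    rw [add_zero] at hy'
    rw [GrHom.tens_tmk _ _ _ hy, GrHom.tens_tmk _ _ _ hy, GrHom.tens_tmk _ _ _ hy, zero_mul,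
      koszulSign_zero, one_smul, GrHom.tens_tmk _ _ _ hy', map_zsmul, map_zsmul, map_zsmul,
      map_zsmul]
    erw [GrHom.lunit_tmk, GrHom.lunit_tmk, GrHom.lunit_tmk]
    rw [g₁.toLin.map_smul, ← smul_add, ← add_smul]
    rfl
  · intro a b ha hb
    simp only [map_add, ha, hb]; abel

theorem comp_right {A B C : GrMod 𝒦} (f₁ : GrHom 0 A B) (f₀ : GrHom 1 A (GrMod.unit 𝒦))
    (g₁ : GrHom 0 B C) (g₀ : GrHom 1 B (GrMod.unit 𝒦)) (z : A.tensor A) :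
    GrHom.runit C (((f₁.comp g₁).cast (by norm_num : (0 : ℤ) + 0 = 0)).tens
      (f₀ + (f₁.comp g₀).cast (by norm_num)) z) =
    g₁ (GrHom.runit B (f₁.tens f₀ z)) + GrHom.runit C (g₁.tens g₀ (f₁.tens f₁ z)) := by
  revert z
  refine GrHom.tensor_ind (by simp only [map_zero, add_zero]) ?_ ?_
  · intro i j x y hx hy
    have hy' := f₁.map_deg hy
    rw [add_zero] at hy'
    rw [GrHom.tens_tmk _ _ _ hy, GrHom.tens_tmk _ _ _ hy, GrHom.tens_tmk _ _ _ hy, zero_mul,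
      koszulSign_zero, one_smul, one_smul, one_smul, GrHom.tens_tmk _ _ _ hy', zero_mul,
      koszulSign_zero, one_smul]
    erw [GrHom.runit_tmk, GrHom.runit_tmk, GrHom.runit_tmk, GrHom.map_rsmul g₁ (f₀.map_deg hy),
      GrHom.rsmul_add]
    rfl
  · intro a b ha hb
    simp only [map_add, ha, hb]; abel

theorem comp_scalar {A B : GrMod 𝒦} (f₁ : GrHom 0 A B) (f₀ : GrHom 1 A (GrMod.unit 𝒦))
    (g₀ : GrHom 1 B (GrMod.unit 𝒦)) (z : A.tensor A) :
    GrHom.lunit (GrMod.unit 𝒦) ((f₀ + (f₁.comp g₀).cast (by norm_num)).tens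
      (f₀ + (f₁.comp g₀).cast (by norm_num)) z) =
    GrHom.lunit (GrMod.unit 𝒦) (f₀.tens f₀ z) +
      GrHom.lunit (GrMod.unit 𝒦) (g₀.tens g₀ (f₁.tens f₁ z)) +
      (g₀ (GrHom.lunit B (f₀.tens f₁ z)) - g₀ (GrHom.runit B (f₁.tens f₀ z))) := by
  revert z
  refine GrHom.tensor_ind (by simp only [map_zero, add_zero, sub_zero]) ?_ ?_
  · intro i j x y hx hy
    have hy' := f₁.map_deg hy
    have hx' := f₁.map_deg hx
    rw [add_zero] at hy' hx'
    rw [GrHom.tens_tmk _ _ _ hy, GrHom.tens_tmk _ _ _ hy, GrHom.tens_tmk _ _ _ hy,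
      GrHom.tens_tmk _ _ _ hy, GrHom.tens_tmk _ _ _ hy, zero_mul,
      koszulSign_zero, one_smul, one_smul, GrHom.tens_tmk _ _ _ hy', one_mul]
    simp only [map_zsmul]
    erw [GrHom.lunit_tmk, GrHom.lunit_tmk, GrHom.lunit_tmk, GrHom.lunit_tmk, GrHom.runit_tmk,
      GrHom.rsmul_apply B hx' (f₀.map_deg hy)]
    rw [g₀.toLin.map_smul, map_zsmul, g₀.toLin.map_smul]
    have hc := IsGradedStronglyCommutative.comm (𝒦 := 𝒦) (g₀.map_deg hx') (f₀.map_deg hy)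
    have hs : koszulSign (i * (j + 1)) * koszulSign ((i + 1) * (j + 1)) = - koszulSign j := by
      rw [← koszulSign_add, show i * (j + 1) + (i + 1) * (j + 1) = 2 * (i * (j + 1)) + (j + 1) by
        ring, koszulSign_add, koszulSign_add j, koszulSign_even (by simp), koszulSign_odd odd_one]
      ring
    have hc' : koszulSign (i * (j + 1)) • ((f₀ y : 𝕜) * (g₀ (f₁ x) : 𝕜)) =
        - (koszulSign j • ((g₀ (f₁ x) : 𝕜) * (f₀ y : 𝕜))) := by
      rw [hc, smul_smul, hs, neg_smul]
    change koszulSign j • (((f₀ x : 𝕜) + g₀ (f₁ x)) * ((f₀ y : 𝕜) + g₀ (f₁ y))) =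
      koszulSign j • ((f₀ x : 𝕜) * (f₀ y : 𝕜)) +
        koszulSign j • ((g₀ (f₁ x) : 𝕜) * (g₀ (f₁ y) : 𝕜)) +
        (koszulSign j • ((f₀ x : 𝕜) * (g₀ (f₁ y) : 𝕜)) -
          koszulSign (i * (j + 1)) • ((f₀ y : 𝕜) * (g₀ (f₁ x) : 𝕜)))
    rw [hc']
    simp only [add_mul, mul_add, smul_add]
    abel
  · intro a b ha hb
    simp only [map_add, ha, hb]; abel

/-- Composition of morphisms: `h₁ = f₁ g₁`, `h₀ = f₀ + f₁ g₀`. -/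
noncomputable def compHom {C D E : CACoalg 𝒦} (f : Hom C D) (g : Hom D E) : Hom C E where
  g₁ := (f.g₁.comp g.g₁).cast (by norm_num)
  g₀ := f.g₀ + (f.g₁.comp g.g₀).cast (by norm_num)
  map_δ₂ x := by
    have h : ∀ z, ((f.g₁.comp g.g₁).cast (by norm_num : (0 : ℤ) + 0 = 0)).tens
        ((f.g₁.comp g.g₁).cast (by norm_num : (0 : ℤ) + 0 = 0)) z =
        ((f.g₁.tens f.g₁).comp (g.g₁.tens g.g₁)) z := by
      refine GrHom.tensor_ext_apply ?_
      intro i j x y _ hy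
      have hy' := f.g₁.map_deg hy
      rw [GrHom.tens_tmk _ _ _ hy, GrHom.comp_apply, GrHom.tens_tmk _ _ _ hy, map_zsmul,
        GrHom.tens_tmk _ _ _ hy', zero_mul, zero_mul, koszulSign_zero, one_smul, one_smul,
        one_smul]
      rfl
    rw [h, GrHom.comp_apply, f.map_δ₂, g.map_δ₂]; rfl
  map_δ₁ x := by
    rw [comp_left, comp_right, f.map_δ₂, GrHom.cast_apply, GrHom.comp_apply, GrHom.cast_apply,
      GrHom.comp_apply, ← g.map_δ₁, ← f.map_δ₁, map_add, map_sub]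
    abel
  map_δ₀ x := by
    rw [comp_scalar, f.map_δ₂, GrHom.add_apply, GrHom.cast_apply, GrHom.comp_apply,
      GrHom.cast_apply, GrHom.comp_apply, ← g.map_δ₀, ← f.map_δ₀, ← f.map_δ₁, map_add, map_sub]
    abel
  map_ε x := by rw [GrHom.cast_apply, GrHom.comp_apply, g.map_ε, f.map_ε]
  map_w := by rw [GrHom.cast_apply, GrHom.comp_apply, f.map_w, g.map_w]

noncomputable instance : Category (CACoalg 𝒦) where
  Hom := Hom
  id := idHom
  comp := compHom
  id_comp f := Hom.ext rfl (GrHom.ext fun x => zero_add _)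
  comp_id f := Hom.ext rfl (GrHom.ext fun x => add_zero _)
  assoc f g h := Hom.ext rfl (GrHom.ext fun x => add_assoc _ _ _)

end CACoalg
section BarConstruction

open TensorConstr

namespace UCCAlg

/-- The shift `Ā[1]`. -/
def X (A : UCCAlg 𝒦) : GrMod 𝒦 := A.bar.shift 1

theorem proj_m₀_mem (A : UCCAlg 𝒦) : A.proj A.m₀ ∈ A.X.deg 1 := A.proj.map_deg A.m₀_mem

/-- `b̄₀`, the component `𝕜 → A[1] → Ā[1]` with `b₀ = m₀ σ`. -/
def b₀ (A : UCCAlg 𝒦) : GrHom 1 (GrMod.unit 𝒦) A.X := GrHom.ofElem A.proj_m₀_mem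

/-- `b̄₁`, the component `Ā[1] → A[1] → A[1] → Ā[1]` with `b₁ = - σ⁻¹ m₁ σ`. -/
def b₁ (A : UCCAlg 𝒦) : GrHom 1 A.X A.X := -(A.lift.comp (A.m₁.comp A.proj)).cast (by norm_num)

/-- `b̄₂`, the component `Ā[1] ⊗ Ā[1] → A[1] ⊗ A[1] → A[1] → Ā[1]` with
`b₂ = (σ ⊗ σ)⁻¹ m₂ σ = - (σ⁻¹ ⊗ σ⁻¹) m₂ σ`. -/
noncomputable def b₂ (A : UCCAlg 𝒦) : GrHom 1 (A.X.tensor A.X) A.X :=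
  -((A.lift.tens A.lift).comp (A.m₂.comp A.proj)).cast (by norm_num)

/-- The functional `δ₀`: minus the composition of `b₀`, `b₁`, `b₂` (on `𝕜`, `Ā[1]`, `Ā[1] ⊗ Ā[1]`)
with `σ⁻¹ v : A[1] → A → 𝕜`, and zero on longer tensors. -/
noncomputable def barδ₀ (A : UCCAlg 𝒦) : GrHom 2 A.X.T (GrMod.unit 𝒦) :=
  ofLow (-((GrHom.ofElem A.m₀_mem).comp A.v).cast (by norm_num))
    ((A.lift.comp (A.m₁.comp A.v)).cast (by norm_num))
    (((A.lift.tens A.lift).comp (A.m₂.comp A.v)).cast (by norm_num))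

/-- The bar construction on objects: `Ā[1] T^≥` with the cut comultiplication, the coderivation
with components `b̄₀`, `b̄₁`, `b̄₂`, the functional `δ₀`, the counit `pr₀` and the splitting `in₀`. -/
noncomputable def barObj (A : UCCAlg 𝒦) : CoalgData 𝒦 where
  C := A.X.T
  δ₂ := TensorConstr.comul A.X
  δ₁ := TensorConstr.coder A.b₀ A.b₁ A.b₂
  δ₀ := A.barδ₀
  ε := TensorConstr.proj₀ A.X
  w := TensorConstr.tone A.X
  w_mem := TensorConstr.tone_mem A.X
  ε_w := TensorConstr.proj₀_tone A.X

variable {A B : UCCAlg 𝒦}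

/-- The coalgebra morphism with components `f̄₁^{⊗n}`, where
`f̄₁ : Ā[1] → A[1] → B[1] → B̄[1]`. -/
noncomputable def barMap₁ (f : Hom A B) : GrHom 0 A.X.T B.X.T :=
  TensorConstr.map ((A.lift.comp (f.f₁.comp B.proj)).cast (by norm_num))

/-- The degree `1` functional with components `und : 𝕜 → 𝕜` and `Ā[1] → A → B → 𝕜`,
the composition with `v` of the components `f₀ = und η` and `f₁` of `f`. -/
noncomputable def barMap₀ (f : Hom A B) : GrHom 1 A.X.T (GrMod.unit 𝒦) :=
  ofLow (GrHom.ofElem (M := GrMod.unit 𝒦) f.und_mem)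
    ((A.lift.comp (f.f₁.comp B.v)).cast (by norm_num)) 0

end UCCAlg

namespace CACoalg

/-- The shift `C̄[-1]`. -/
def X (C : CACoalg 𝒦) : GrMod 𝒦 := C.bar.shift (-1)

/-- `ξ̄₀ : C̄[-1] → C[-1] → 𝕜` with `ξ₀ = σ δ₀`. -/
def ξ₀ (C : CACoalg 𝒦) : GrHom 1 C.X (GrMod.unit 𝒦) := (C.lift.comp C.δ₀).cast (by norm_num)

/-- `ξ̄₁ : C̄[-1] → C[-1] → C[-1] → C̄[-1]` with `ξ₁ = - σ δ₁ σ⁻¹`. -/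
def ξ₁ (C : CACoalg 𝒦) : GrHom 1 C.X C.X := -(C.lift.comp (C.δ₁.comp C.proj)).cast (by norm_num)

/-- `ξ̄₂ : C̄[-1] → C[-1] → C[-1] ⊗ C[-1] → C̄[-1] ⊗ C̄[-1]` with
`ξ₂ = σ δ₂ (σ ⊗ σ)⁻¹ = - σ δ₂ (σ⁻¹ ⊗ σ⁻¹)`. -/
noncomputable def ξ₂ (C : CACoalg 𝒦) : GrHom 1 C.X (C.X.tensor C.X) :=
  -(C.lift.comp (C.δ₂.comp (C.proj.tens C.proj))).cast (by norm_num)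

/-- The restriction to the generators `C̄[-1]` of the differential of the cobar construction. -/
noncomputable def cobarGen (C : CACoalg 𝒦) : GrHom 1 C.X C.X.T :=
  (C.ξ₀.comp (TensorConstr.inj C.X 0)).cast (by norm_num) +
  (C.ξ₁.comp (TensorConstr.gen C.X)).cast (by norm_num) +
  (C.ξ₂.comp (((GrHom.id C.X).tens (TensorConstr.toPowOne C.X)).comp
    (TensorConstr.inj C.X 2))).cast (by norm_num)

/-- The curvature element `- w ⊗ w - w ξ₀ - w ξ₁ - w ξ₂`, `w` being viewed in `C[-1]`. Since
`w ξ₂ = - w ⊗ w`, this is `- w ξ₀ - w ξ₁`, where `w ξ₀ = w δ₀` and `w ξ₁ = - w δ₁ σ⁻¹`. -/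
noncomputable def cobarM₀ (C : CACoalg 𝒦) : C.X.T :=
  -(TensorConstr.inj C.X 0 (C.δ₀ C.w)) + TensorConstr.gen C.X (C.proj (C.δ₁ C.w))

theorem cobarM₀_mem (C : CACoalg 𝒦) : C.cobarM₀ ∈ C.X.T.deg 2 :=
  add_mem (neg_mem ((TensorConstr.inj C.X 0).map_deg (C.δ₀.map_deg C.w_mem)))
    ((TensorConstr.gen C.X).map_deg (C.proj.map_deg (C.δ₁.map_deg C.w_mem)))

/-- The cobar construction on objects: the tensor algebra `C̄[-1] T^≥` with the derivation with
components `ξ̄₀`, `ξ̄₁`, `ξ̄₂`, the curvature element, the unit `in₀` and the splitting `pr₀`. -/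
noncomputable def cobarObj (C : CACoalg 𝒦) : AlgData 𝒦 where
  A := C.X.T
  m₂ := TensorConstr.mul C.X
  m₁ := TensorConstr.der C.cobarGen
  m₀ := C.cobarM₀
  one := TensorConstr.tone C.X
  v := TensorConstr.proj₀ C.X
  m₀_mem := C.cobarM₀_mem
  one_mem := TensorConstr.tone_mem C.X
  v_one := TensorConstr.proj₀_tone C.X

variable {C D : CACoalg 𝒦}

/-- The algebra homomorphism with components `g₁| : C̄[-1] → D̄[-1]` and `g₀| : C̄[-1] → 𝕜`. -/
noncomputable def cobarMap₁ (g : Hom C D) : GrHom 0 C.X.T D.X.T :=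
  TensorConstr.algHom (
    (C.lift.comp (g.g₁.comp (D.proj.comp (TensorConstr.gen D.X)))).cast (by norm_num) +
    (C.lift.comp (g.g₀.comp (TensorConstr.inj D.X 0))).cast (by norm_num))

/-- The scalar component `w g₀ ∈ 𝕜¹` of a morphism. -/
def Hom.und (g : Hom C D) : 𝕜 := g.g₀ C.w

end CACoalg

/-- `F` is the bar construction. -/
structure IsBarConstruction (F : UCCAlg 𝒦 ⥤ CACoalg 𝒦) : Prop where
  obj : ∀ A : UCCAlg 𝒦, (F.obj A).toCoalgData = A.barObj
  map₁ : ∀ {A B : UCCAlg 𝒦} (f : A ⟶ B), HEq (CACoalg.Hom.g₁ (F.map f)) (UCCAlg.barMap₁ f)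
  map₀ : ∀ {A B : UCCAlg 𝒦} (f : A ⟶ B), HEq (CACoalg.Hom.g₀ (F.map f)) (UCCAlg.barMap₀ f)

/-- `F` is the cobar construction. -/
structure IsCobarConstruction (F : CACoalg 𝒦 ⥤ UCCAlg 𝒦) : Prop where
  obj : ∀ C : CACoalg 𝒦, (F.obj C).toAlgData = C.cobarObj
  map₁ : ∀ {C D : CACoalg 𝒦} (g : C ⟶ D), HEq (UCCAlg.Hom.f₁ (F.map g)) (CACoalg.cobarMap₁ g)
  map_und : ∀ {C D : CACoalg 𝒦} (g : C ⟶ D), UCCAlg.Hom.und (F.map g) = CACoalg.Hom.und g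

variable (𝒦) in
/-- The morphisms of curved algebras with vanishing scalar component. -/
def uccMorphisms : MorphismProperty (UCCAlg 𝒦) := fun _ _ f => UCCAlg.Hom.und f = 0

instance : (uccMorphisms 𝒦).IsMultiplicative where
  id_mem _ := rfl
  comp_mem f g hf hg := by
    change UCCAlg.Hom.und g + UCCAlg.Hom.und f = 0
    rw [show UCCAlg.Hom.und f = 0 from hf, show UCCAlg.Hom.und g = 0 from hg, add_zero]

variable (𝒦) in
/-- The morphisms of curved coalgebras with vanishing scalar component. -/
def caMorphisms : MorphismProperty (CACoalg 𝒦) := fun _ _ g => CACoalg.Hom.und g = 0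

instance : (caMorphisms 𝒦).IsMultiplicative where
  id_mem _ := rfl
  comp_mem {C D E} f g hf hg := by
    change (CACoalg.Hom.g₀ f C.w : 𝕜) + CACoalg.Hom.g₀ g (CACoalg.Hom.g₁ f C.w) = 0
    rw [CACoalg.Hom.map_w]
    rw [show (CACoalg.Hom.g₀ f C.w : 𝕜) = 0 from hf, show (CACoalg.Hom.g₀ g D.w : 𝕜) = 0 from hg,
      add_zero]

variable (𝒦) in
/-- The category with all unit-complemented curved algebras as objects and the morphisms with
vanishing scalar component. -/
abbrev UccAlg := WideSubcategory (uccMorphisms 𝒦)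

variable (𝒦) in
/-- The category with all curved augmented coalgebras as objects and the morphisms with
vanishing scalar component. -/
abbrev CaCoalg := WideSubcategory (caMorphisms 𝒦)

end BarConstruction

end Curved

end Graded

-- Everything is controlled by twisting cochains: maps `τ : C → A` of degree 1 satisfying the
-- Maurer-Cartan equation `IsTwisting`, which expresses m₁(τ c) through δ₀(c)·1, τ(δ₁ c), the
-- convolution square τ ⋆ τ and the curvature term ε(c) m₀. The cobar construction carries a
-- universal one, `cobarTwist`, the projection of C to the generators C̄[-1]. The bar construction
-- carries `barTwist`, the projection of the tensor coalgebra to Ā[1] followed by Ā[1] → A. In both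
-- cases the Maurer-Cartan equation is a rearrangement of the definitions of the structure maps.
--
-- Applying m₁ once more to the Maurer-Cartan equation gives `IsTwisting.m₁_m₁`, which needs only
-- (co)associativity, (co)units and the (co)derivation property. It links the curvature and Bianchi
-- axioms of A with those of C. If they are known for C, they follow for Cobar C: the value at w is
-- the Bianchi identity, the values on C̄ are the curvature identity on generators, and the Leibniz
-- rule extends it. If they are known for A, they follow for Bar A: the component along v is δ₁δ₀ =
-- 0, the component in Ā[1] is the curvature identity projected to cogenerators, and recursion on
-- the first letter extends it.
--
-- Morphisms are treated in the same way. Homomorphisms of curved algebras push twisting cochains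
-- forward, and a morphism (g₁, g₀) of curved coalgebras pulls them back by τ ↦ g₁τ + g₀η
-- (`CACoalg.isTwisting_pull`). Conversely, a homomorphism from the tensor algebra is compatible
-- with m₁ and m₀ as soon as its composite with `cobarTwist` is twisting (`CACoalg.cobarDesc`). The
-- dual criterion is `UCCAlg.barDesc`. It relies on conilpotency, which makes the tensor coalgebra
-- cofree: `comap` gives existence and `eq_of_recursion` uniqueness. Scalars u of degree 1 are
-- absorbed by the automorphism (id, ε u) of a curved coalgebra, `CACoalg.scalarHom`, whose
-- existence uses u² = 0.
--
-- On the subcategories where the scalar components vanish, Hom(Cobar C, A) and Hom(C, Bar A) are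
-- both identified with the twisting cochains C → A that vanish at w, naturally in C and A. A
-- nonzero scalar would disturb this naturality by multiples of ε.

attribute [reducible] CACoalg.X CACoalg.cobarObj UCCAlg.X UCCAlg.barObj

open GrMod

/-! ### Calculus of homogeneous maps: Koszul signs, associativity and unit constraints. -/

section GradedCalculus

variable {𝕜 : Type u} [Ring 𝕜] {𝒦 : ℤ → AddSubgroup 𝕜}

namespace GrHom

variable {d e k l : ℤ} {M N P Q M' N' P' : GrMod 𝒦}

protected theorem map_zero (f : GrHom d M N) : f 0 = 0 := f.toLin.map_zero
protected theorem map_add (f : GrHom d M N) (x y : M) : f (x + y) = f x + f y := f.toLin.map_add x y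
protected theorem map_neg (f : GrHom d M N) (x : M) : f (-x) = -f x := f.toLin.map_neg x
protected theorem map_sub (f : GrHom d M N) (x y : M) : f (x - y) = f x - f y := f.toLin.map_sub x y
protected theorem map_smul (f : GrHom d M N) (c : 𝕜) (x : M) : f (c • x) = c • f x :=
  f.toLin.map_smul c x
protected theorem map_zsmul (f : GrHom d M N) (n : ℤ) (x : M) : f (n • x) = n • f x :=
  map_zsmul f.toLin n x

theorem map_deg' (f : GrHom d M N) {i j : ℤ} {x : M} (hx : x ∈ M.deg i) (h : i + d = j) :
    f x ∈ N.deg j := h ▸ f.map_deg hx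

theorem map_deg_zero (f : GrHom 0 M N) {i : ℤ} {x : M} (hx : x ∈ M.deg i) :
    f x ∈ N.deg i := f.map_deg' hx (add_zero i)

instance : Sub (GrHom d M N) :=
  ⟨fun f g => ⟨f.toLin - g.toLin, fun h => sub_mem (f.map_deg h) (g.map_deg h)⟩⟩

@[simp] theorem sub_apply (f g : GrHom d M N) (x : M) : (f - g) x = f x - g x := rfl

variable [GradedRing 𝒦] [IsGradedStronglyCommutative 𝒦]

@[simp] theorem ofElem_apply {m : M} (hm : m ∈ M.deg d) (c : 𝕜) : ofElem hm c = c • m := rfl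

/-- The Koszul sign (-1)^{|f||y|} is trivial for |f| = 0, so `y` need not be homogeneous, in
contrast to `tens_tmk`. -/
theorem tens_tmk_of_deg_zero (f : GrHom 0 M M') (g : GrHom e N N') (x : M) (y : N) :
    f.tens g (tmk x y) = tmk (f x) (g y) := by
  change tmk (f x) (g (N.sgn 0 y)) = _
  refine N.induction (p := fun y => tmk (f x) (g (N.sgn 0 y)) = tmk (f x) (g y)) ?_ ?_ ?_ y
  · rw [_root_.map_zero]
  · intro i y hy
    rw [N.sgn_apply 0 hy, zero_mul, koszulSign_zero, one_smul]
  · intro a b ha hb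
    rw [_root_.map_add, g.map_add, g.map_add, tmk_add, tmk_add, ha, hb]

/-- Two homogeneous maps out of `(M ⊗ N) ⊗ P` agree if they agree on homogeneous tensors. -/
theorem tensor_ext_left {f : GrHom d ((M.tensor N).tensor P) Q}
    {g : GrHom e ((M.tensor N).tensor P) Q}
    (h : ∀ i j k x y z, x ∈ M.deg i → y ∈ N.deg j → z ∈ P.deg k →
      f (tmk (tmk x y) z) = g (tmk (tmk x y) z))
    (z : (M.tensor N).tensor P) : f z = g z := by
  refine tensor_ext_apply (fun i k a c _ hc => ?_) z
  refine tensor_ind (p := fun a => f (tmk a c) = g (tmk a c)) ?_ ?_ ?_ a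
  · have h0 : tmk (0 : M.tensor N) c = 0 := by
      have := zsmul_tmk 0 (0 : M.tensor N) c
      simpa only [zero_smul] using this
    rw [h0, f.map_zero, g.map_zero]
  · intro i j x y hx hy
    exact h i j k x y c hx hy hc
  · intro a b ha hb
    rw [add_tmk, f.map_add, g.map_add, ha, hb]

theorem zero_tmk (y : N) : tmk (0 : M) y = 0 := by
  have := zsmul_tmk 0 (0 : M) y
  simpa only [zero_smul] using this

theorem tmk_zero (x : M) : tmk x (0 : N) = 0 := by
  have := tmk_zsmul 0 x (0 : N)
  simpa only [zero_smul] using this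

theorem neg_tmk (x : M) (y : N) : tmk (-x) y = -tmk x y := by
  have := zsmul_tmk (-1) x y
  simpa only [neg_smul, one_smul] using this

theorem tmk_neg (x : M) (y : N) : tmk x (-y) = -tmk x y := by
  have := tmk_zsmul (-1) x y
  simpa only [neg_smul, one_smul] using this

theorem sub_tmk (x x' : M) (y : N) : tmk (x - x') y = tmk x y - tmk x' y := by
  rw [sub_eq_add_neg, add_tmk, neg_tmk, sub_eq_add_neg]

theorem tmk_sub (x : M) (y y' : N) : tmk x (y - y') = tmk x y - tmk x y' := by
  rw [sub_eq_add_neg, tmk_add, tmk_neg, sub_eq_add_neg]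

/-- Two homogeneous maps out of `M ⊗ (N ⊗ P)` agree if they agree on homogeneous tensors. -/
theorem tensor_ext_right {f : GrHom d (M.tensor (N.tensor P)) Q}
    {g : GrHom e (M.tensor (N.tensor P)) Q}
    (h : ∀ i j k x y z, x ∈ M.deg i → y ∈ N.deg j → z ∈ P.deg k →
      f (tmk x (tmk y z)) = g (tmk x (tmk y z)))
    (z : M.tensor (N.tensor P)) : f z = g z := by
  refine tensor_ext_apply (fun i k a c ha _ => ?_) z
  refine tensor_ind (p := fun c => f (tmk a c) = g (tmk a c)) ?_ ?_ ?_ c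
  · rw [tmk_zero, f.map_zero, g.map_zero]
  · intro j k x y hx hy
    exact h i j k a x y ha hx hy
  · intro b c hb hc
    rw [tmk_add, f.map_add, g.map_add, hb, hc]

theorem tens_add_left (f f' : GrHom d M M') (g : GrHom e N N') (z : M.tensor N) :
    (f + f').tens g z = f.tens g z + f'.tens g z := by
  refine tensor_ext_apply (g := f.tens g + f'.tens g) (fun i j x y hx hy => ?_) z
  simp only [add_apply, tens_tmk _ _ _ hy, add_tmk, smul_add]

theorem tens_add_right (f : GrHom d M M') (g g' : GrHom e N N') (z : M.tensor N) :
    f.tens (g + g') z = f.tens g z + f.tens g' z := by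
  refine tensor_ext_apply (g := f.tens g + f.tens g') (fun i j x y hx hy => ?_) z
  simp only [add_apply, tens_tmk _ _ _ hy, tmk_add, smul_add]

theorem tens_sub_left (f f' : GrHom d M M') (g : GrHom e N N') (z : M.tensor N) :
    (f - f').tens g z = f.tens g z - f'.tens g z := by
  refine tensor_ext_apply (g := f.tens g - f'.tens g) (fun i j x y hx hy => ?_) z
  simp only [sub_apply, tens_tmk _ _ _ hy, sub_tmk, smul_sub]

theorem tens_sub_right (f : GrHom d M M') (g g' : GrHom e N N') (z : M.tensor N) :
    f.tens (g - g') z = f.tens g z - f.tens g' z := by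
  refine tensor_ext_apply (g := f.tens g - f.tens g') (fun i j x y hx hy => ?_) z
  simp only [sub_apply, tens_tmk _ _ _ hy, tmk_sub, smul_sub]

theorem tens_cast_left {d' : ℤ} (f : GrHom d M M') (h : d = d') (g : GrHom e N N')
    (z : M.tensor N) : (f.cast h).tens g z = f.tens g z := by
  subst h; rfl

theorem tens_cast_right {e' : ℤ} (f : GrHom d M M') (g : GrHom e N N') (h : e = e')
    (z : M.tensor N) : f.tens (g.cast h) z = f.tens g z := by
  subst h; rfl

/-- The degree is part of the type of a homogeneous map. This allows a factor to be replaced by one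
with the same values whose degree is only provably equal, such as `0 + d` for `d`. -/
theorem tens_congr {d' e' : ℤ} {f : GrHom d M M'} {f' : GrHom d' M M'} {g : GrHom e N N'}
    {g' : GrHom e' N N'} (hd : d = d') (he : e = e') (hf : ∀ x, f x = f' x) (hg : ∀ y, g y = g' y)
    (z : M.tensor N) : f.tens g z = f'.tens g' z := by
  subst hd he
  rw [GrHom.ext hf, GrHom.ext hg]

theorem tens_id (z : M.tensor N) : (GrHom.id M).tens (GrHom.id N) z = z :=
  tensor_ext_apply (f := (GrHom.id M).tens (GrHom.id N)) (g := GrHom.id (M.tensor N))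
    (fun i j x y hx hy => by rw [tens_tmk_of_deg_zero]; rfl) z

/-- The interchange law `(f ⊗ g)(f' ⊗ g') = (-1)^{|g||f'|} f f' ⊗ g g'`. -/
theorem tens_tens (f : GrHom d M M') (g : GrHom e N N') (f' : GrHom k M' P) (g' : GrHom l N' P')
    (z : M.tensor N) : f'.tens g' (f.tens g z) =
      koszulSign (e * k) • (f.comp f').tens (g.comp g') z := by
  refine tensor_ind (p := fun z => f'.tens g' (f.tens g z) =
      koszulSign (e * k) • (f.comp f').tens (g.comp g') z) ?_ ?_ ?_ z
  · simp only [GrHom.map_zero, smul_zero]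
  · intro i j x y hx hy
    rw [tens_tmk _ _ _ hy, GrHom.map_zsmul, tens_tmk _ _ _ (g.map_deg hy), tens_tmk _ _ _ hy,
      smul_smul, smul_smul, ← koszulSign_add, ← koszulSign_add]
    congr 2
    ring
  · intro a b ha hb
    simp only [GrHom.map_add, ha, hb, smul_add]

theorem id_tens_tens (f : GrHom d M M') (g : GrHom e N N') (g' : GrHom l N' P') (z : M.tensor N) :
    (GrHom.id M').tens g' (f.tens g z) = f.tens (g.comp g') z := by
  rw [tens_tens, mul_zero, koszulSign_zero, one_smul]
  exact tens_congr (add_zero d) rfl (fun _ => rfl) (fun _ => rfl) z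

theorem tens_id_tens (f : GrHom d M M') (g : GrHom e N N') (f' : GrHom k M' P) (z : M.tensor N) :
    f'.tens (GrHom.id N') (f.tens g z) = koszulSign (e * k) • (f.comp f').tens g z := by
  rw [tens_tens]
  exact congrArg _ (tens_congr rfl (add_zero e) (fun _ => rfl) (fun _ => rfl) z)

theorem assoc_tens (f : GrHom d M M') (g : GrHom e N N') (h : GrHom k P P')
    (z : (M.tensor N).tensor P) :
    GrHom.assoc M' N' P' ((f.tens g).tens h z) = f.tens (g.tens h) (GrHom.assoc M N P z) := by
  refine tensor_ext_left (f := ((f.tens g).tens h).comp (GrHom.assoc M' N' P'))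
    (g := (GrHom.assoc M N P).comp (f.tens (g.tens h))) ?_ z
  intro i j l x y z hx hy hz
  rw [comp_apply, comp_apply, tens_tmk _ _ _ hz, tens_tmk _ _ _ hy, assoc_tmk,
    tens_tmk _ _ _ (tmk_mem hy hz), tens_tmk _ _ _ hz, zsmul_tmk, GrHom.map_zsmul,
    GrHom.map_zsmul, assoc_tmk, tmk_zsmul, smul_smul, smul_smul, ← koszulSign_add,
    ← koszulSign_add]
  congr 2
  ring

theorem assocInv_assoc (z : (M.tensor N).tensor P) :
    GrHom.assocInv M N P (GrHom.assoc M N P z) = z :=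
  tensor_ext_left (f := (GrHom.assoc M N P).comp (GrHom.assocInv M N P))
    (g := GrHom.id ((M.tensor N).tensor P)) (fun _ _ _ _ _ _ _ _ _ => rfl) z

theorem assoc_assocInv (z : M.tensor (N.tensor P)) :
    GrHom.assoc M N P (GrHom.assocInv M N P z) = z :=
  tensor_ext_right (f := (GrHom.assocInv M N P).comp (GrHom.assoc M N P))
    (g := GrHom.id (M.tensor (N.tensor P))) (fun _ _ _ _ _ _ _ _ _ => rfl) z

theorem assocInv_tens (f : GrHom d M M') (g : GrHom e N N') (h : GrHom k P P')
    (z : M.tensor (N.tensor P)) :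
    GrHom.assocInv M' N' P' (f.tens (g.tens h) z) =
      (f.tens g).tens h (GrHom.assocInv M N P z) := by
  rw [← assocInv_assoc ((f.tens g).tens h (GrHom.assocInv M N P z)), assoc_tens, assoc_assocInv]

theorem lunit_id_tens (f : GrHom d M N) (z : (GrMod.unit 𝒦).tensor M) :
    lunit N ((GrHom.id (GrMod.unit 𝒦)).tens f z) = f (lunit M z) := by
  refine tensor_ext_apply (f := ((GrHom.id (GrMod.unit 𝒦)).tens f).comp (lunit N))
    (g := (lunit M).comp f) (fun i j c x _ hx => ?_) z
  rw [comp_apply, comp_apply, tens_tmk_of_deg_zero]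
  exact (f.map_smul c x).symm

/-- The sign created when `f` passes the scalar c turns the sign (-1)^{|xf||c|} of the right action
on xf into the sign (-1)^{|x||c|} of the right action on x. -/
theorem runit_tens_id (f : GrHom d M N) (z : M.tensor (GrMod.unit 𝒦)) :
    runit N (f.tens (GrHom.id (GrMod.unit 𝒦)) z) = f (runit M z) := by
  refine tensor_ext_apply (f := (f.tens (GrHom.id (GrMod.unit 𝒦))).comp (runit N))
    (g := (runit M).comp f) (fun i j x c hx hc => ?_) z
  rw [comp_apply, comp_apply, tens_tmk _ _ _ hc, GrHom.map_zsmul]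
  change koszulSign (d * j) • rsmul N (c : 𝕜) (f x) = f (rsmul M (c : 𝕜) x)
  rw [rsmul_apply N (f.map_deg hx) hc, rsmul_apply M hx hc, f.map_zsmul, f.map_smul,
    smul_smul, add_mul, koszulSign_add, mul_left_comm, koszulSign_mul_self, mul_one]

theorem lunit_assoc (z : ((GrMod.unit 𝒦).tensor M).tensor N) :
    lunit (M.tensor N) (GrHom.assoc _ M N z) = (lunit M).tens (GrHom.id N) z := by
  refine tensor_ext_left (f := (GrHom.assoc (GrMod.unit 𝒦) M N).comp (lunit (M.tensor N)))
    (g := (lunit M).tens (GrHom.id N)) (fun i j k c x y _ _ _ => ?_) z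
  rw [tens_tmk_of_deg_zero]
  exact (smul_tmk c x y).symm

theorem runit_assoc (z : (M.tensor N).tensor (GrMod.unit 𝒦)) :
    (GrHom.id M).tens (runit N) (GrHom.assoc M N _ z) = runit (M.tensor N) z := by
  refine tensor_ext_left (f := (GrHom.assoc M N (GrMod.unit 𝒦)).comp
    ((GrHom.id M).tens (runit N))) (g := runit (M.tensor N)) (fun i j k x y c hx hy hc => ?_) z
  rw [comp_apply, assoc_tmk, tens_tmk_of_deg_zero]
  change tmk x (rsmul N (c : 𝕜) y) = rsmul (M.tensor N) (c : 𝕜) (tmk x y)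
  rw [rsmul_apply N hy hc, rsmul_apply (M.tensor N) (tmk_mem hx hy) hc, tmk_zsmul,
    tmk_smul y hc hx, smul_smul, ← koszulSign_add]
  congr 2
  ring

theorem lunit_runit (z : (M.tensor (GrMod.unit 𝒦)).tensor N) :
    (GrHom.id M).tens (lunit N) (GrHom.assoc M _ N z) = (runit M).tens (GrHom.id N) z := by
  refine tensor_ext_left (f := (GrHom.assoc M (GrMod.unit 𝒦) N).comp
    ((GrHom.id M).tens (lunit N))) (g := (runit M).tens (GrHom.id N))
    (fun i j k x c y hx hc hy => ?_) z
  rw [comp_apply, assoc_tmk, tens_tmk_of_deg_zero, tens_tmk_of_deg_zero]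
  erw [lunit_tmk, runit_tmk]
  rw [id_apply, id_apply, rsmul_apply M hx hc, zsmul_tmk, smul_tmk, tmk_smul y hc hx, mul_comm]

/-- This is the graded commutativity of 𝕜. It lets a product of two functionals be read both as a
left and as a right action. -/
theorem lunit_unit_eq_runit (z : (GrMod.unit 𝒦).tensor (GrMod.unit 𝒦)) :
    lunit (GrMod.unit 𝒦) z = runit (GrMod.unit 𝒦) z := by
  refine tensor_ext_apply (f := lunit (GrMod.unit 𝒦)) (g := runit (GrMod.unit 𝒦))
    (fun i j a b ha hb => ?_) z
  rw [lunit_tmk]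
  erw [runit_tmk]
  rw [rsmul_apply (GrMod.unit 𝒦) ha hb]
  exact IsGradedStronglyCommutative.comm hb ha |>.trans (by rw [mul_comm j i]; rfl)

theorem lunitInv_lunit (z : (GrMod.unit 𝒦).tensor M) : lunitInv M (lunit M z) = z := by
  refine tensor_ext_apply (f := (lunit M).comp (lunitInv M))
    (g := GrHom.id ((GrMod.unit 𝒦).tensor M)) (fun i j c x hc hx => ?_) z
  rw [comp_apply, lunit_tmk, GrHom.map_smul]
  change c • tmk (M := GrMod.unit 𝒦) (1 : 𝕜) x = tmk (M := GrMod.unit 𝒦) c x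
  rw [← smul_tmk]
  congr 1
  exact mul_one c

theorem rsmul_one (x : M) : rsmul M (1 : 𝕜) x = x := by
  refine M.induction (p := fun x => rsmul M (1 : 𝕜) x = x) (_root_.map_zero _) ?_ ?_ x
  · intro i x hx
    rw [rsmul_apply M hx (SetLike.one_mem_graded 𝒦), mul_zero, koszulSign_zero, one_smul, one_smul]
  · intro a b ha hb
    rw [_root_.map_add, ha, hb]

/-- The right multiplication `x ↦ x·c` by a scalar of degree `d`, as a homogeneous map. -/
noncomputable def rmul (M : GrMod 𝒦) {c : 𝕜} (hc : c ∈ 𝒦 d) : GrHom d M M where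
  toLin :=
    { toFun := rsmul M c
      map_add' := _root_.map_add _
      map_smul' := fun a x => by
        refine scalar_induction (𝒦 := 𝒦) (p := fun a => rsmul M c (a • x) = a • rsmul M c x)
          ?_ ?_ ?_ a
        · simp only [zero_smul, _root_.map_zero]
        · intro i a ha
          refine M.induction (p := fun x => rsmul M c (a • x) = a • rsmul M c x) ?_ ?_ ?_ x
          · simp only [smul_zero, _root_.map_zero]
          · intro j x hx
            rw [rsmul_apply M hx hc, rsmul_apply M (M.smul_mem ha hx) hc, smul_smul_comm ha hc,
              smul_smul, smul_comm a (koszulSign (j * d)), add_mul, koszulSign_add, mul_right_comm,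
              koszulSign_mul_self, one_mul]
          · intro x y hx hy
            simp only [smul_add, _root_.map_add, hx, hy]
        · intro a b ha hb
          simp only [add_smul, _root_.map_add, ha, hb] }
  map_deg {i x} hx := by
    change rsmul M c x ∈ _
    rw [rsmul_apply M hx hc, add_comm]
    exact zsmul_mem (M.smul_mem hc hx) _

theorem rmul_apply (M : GrMod 𝒦) {c : 𝕜} (hc : c ∈ 𝒦 d) (x : M) : rmul M hc x = rsmul M c x := rfl

/-- The convolution `δ (f ⊗ g) : C → M ⊗ N`. -/
noncomputable def cv {C : GrMod 𝒦} (δ : GrHom 0 C (C.tensor C)) (f : GrHom d C M)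
    (g : GrHom e C N) : GrHom (d + e) C (M.tensor N) :=
  (δ.comp (f.tens g)).cast (zero_add _)

/-! ### Convolution of maps out of a coalgebra, and the action of functionals. -/

section Convolution

variable {C D : GrMod 𝒦} {δ : GrHom 0 C (C.tensor C)} {δ' : GrHom 0 D (D.tensor D)}

theorem cv_apply (f : GrHom d C M) (g : GrHom e C N) (c : C) : cv δ f g c = f.tens g (δ c) := rfl

theorem cv_add_left (f f' : GrHom d C M) (g : GrHom e C N) (c : C) :
    cv δ (f + f') g c = cv δ f g c + cv δ f' g c := tens_add_left _ _ _ _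

theorem cv_add_right (f : GrHom d C M) (g g' : GrHom e C N) (c : C) :
    cv δ f (g + g') c = cv δ f g c + cv δ f g' c := tens_add_right _ _ _ _

theorem cv_sub_left (f f' : GrHom d C M) (g : GrHom e C N) (c : C) :
    cv δ (f - f') g c = cv δ f g c - cv δ f' g c := tens_sub_left _ _ _ _

theorem cv_sub_right (f : GrHom d C M) (g g' : GrHom e C N) (c : C) :
    cv δ f (g - g') c = cv δ f g c - cv δ f g' c := tens_sub_right _ _ _ _

theorem cv_cast_left {d' : ℤ} (f : GrHom d C M) (h : d = d') (g : GrHom e C N) (c : C) :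
    cv δ (f.cast h) g c = cv δ f g c := tens_cast_left _ _ _ _

theorem cv_cast_right {e' : ℤ} (f : GrHom d C M) (g : GrHom e C N) (h : e = e') (c : C) :
    cv δ f (g.cast h) c = cv δ f g c := tens_cast_right _ _ _ _

theorem cv_congr {d' e' : ℤ} {f : GrHom d C M} {f' : GrHom d' C M} {g : GrHom e C N}
    {g' : GrHom e' C N} (hd : d = d') (he : e = e') (hf : ∀ x, f x = f' x) (hg : ∀ y, g y = g' y)
    (c : C) : cv δ f g c = cv δ f' g' c := tens_congr hd he hf hg _

theorem tens_cv (f : GrHom d C M) (g : GrHom e C N) (f' : GrHom k M P) (g' : GrHom l N Q) (c : C) :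
    f'.tens g' (cv δ f g c) = koszulSign (e * k) • cv δ (f.comp f') (g.comp g') c :=
  tens_tens _ _ _ _ _

theorem id_tens_cv (f : GrHom d C M) (g : GrHom e C N) (g' : GrHom l N Q) (c : C) :
    (GrHom.id M).tens g' (cv δ f g c) = cv δ f (g.comp g') c := id_tens_tens _ _ _ _

theorem tens_id_cv (f : GrHom d C M) (g : GrHom e C N) (f' : GrHom k M P) (c : C) :
    f'.tens (GrHom.id N) (cv δ f g c) = koszulSign (e * k) • cv δ (f.comp f') g c :=
  tens_id_tens _ _ _ _

/-- Both sides are f ⊗ g ⊗ h applied to the twofold coproduct, since δ has degree 0 and passes the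
factors without sign; coassociativity identifies the two bracketings. -/
theorem assoc_cv
    (hδ : ∀ x, (GrHom.id C).tens δ (δ x) = GrHom.assoc C C C (δ.tens (GrHom.id C) (δ x)))
    (f : GrHom d C M) (g : GrHom e C N) (h : GrHom k C P) (c : C) :
    GrHom.assoc M N P (cv δ (cv δ f g) h c) = cv δ f (cv δ g h) c := by
  have h1 : cv δ (cv δ f g) h c = (f.tens g).tens h (δ.tens (GrHom.id C) (δ c)) := by
    rw [tens_tens, zero_mul, koszulSign_zero, one_smul]
    exact tens_congr (zero_add _).symm (zero_add _).symm (fun _ => rfl) (fun _ => rfl) _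
  have h2 : cv δ f (cv δ g h) c = f.tens (g.tens h) ((GrHom.id C).tens δ (δ c)) := by
    rw [tens_tens, zero_mul, koszulSign_zero, one_smul]
    exact tens_congr (zero_add _).symm (zero_add _).symm (fun _ => rfl) (fun _ => rfl) _
  rw [h1, assoc_tens, h2, hδ]

/-- With maps on the right, (1 ⊗ D)(f ⊗ g) = (-1)^{|D||f|} f ⊗ Dg, while (D ⊗ 1)(f ⊗ g) = Df ⊗ g
carries no sign. -/
theorem cv_coderivation {D : GrHom k C C}
    (hD : ∀ x, δ (D x) = (GrHom.id C).tens D (δ x) + D.tens (GrHom.id C) (δ x))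
    (f : GrHom d C M) (g : GrHom e C N) (c : C) :
    cv δ f g (D c) = koszulSign (k * d) • cv δ f (D.comp g) c + cv δ (D.comp f) g c := by
  rw [cv_apply, hD, GrHom.map_add, tens_tens, tens_tens, zero_mul, koszulSign_zero, one_smul,
    cv_apply, cv_apply]
  exact congrArg₂ (· + ·)
    (congrArg _ (tens_congr (zero_add d) rfl (fun _ => rfl) (fun _ => rfl) _))
    (tens_congr rfl (zero_add e) (fun _ => rfl) (fun _ => rfl) _)

theorem cv_map {G : GrHom 0 C D} (hG : ∀ x, G.tens G (δ x) = δ' (G x))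
    (f : GrHom d D M) (g : GrHom e D N) (c : C) :
    cv δ' f g (G c) = cv δ (G.comp f) (G.comp g) c := by
  rw [cv_apply, ← hG, tens_tens, zero_mul, koszulSign_zero, one_smul, cv_apply]

/-- The left convolution action `δ (s ⊗ f)` of a functional `s` on a map `f`. -/
noncomputable def sl (δ : GrHom 0 C (C.tensor C)) (s : GrHom d C (GrMod.unit 𝒦))
    (f : GrHom e C M) : GrHom (d + e) C M := ((cv δ s f).comp (lunit M)).cast (add_zero _)

/-- The right convolution action `δ (f ⊗ s)` of a functional `s` on a map `f`. -/
noncomputable def sr (δ : GrHom 0 C (C.tensor C)) (f : GrHom e C M)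
    (s : GrHom d C (GrMod.unit 𝒦)) : GrHom (e + d) C M :=
  ((cv δ f s).comp (runit M)).cast (add_zero _)

theorem sl_apply (s : GrHom d C (GrMod.unit 𝒦)) (f : GrHom e C M) (c : C) :
    sl δ s f c = lunit M (cv δ s f c) := rfl

theorem sr_apply (f : GrHom e C M) (s : GrHom d C (GrMod.unit 𝒦)) (c : C) :
    sr δ f s c = runit M (cv δ f s c) := rfl

theorem map_sl (s : GrHom d C (GrMod.unit 𝒦)) (f : GrHom e C M) (g : GrHom k M N) (c : C) :
    g (sl δ s f c) = sl δ s (f.comp g) c := by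
  rw [sl_apply, ← lunit_id_tens, id_tens_cv, sl_apply]

/-- To reach `f` from the right, `g` has to pass the functional `s`, whence the sign; in `map_sl`
there is nothing to pass. -/
theorem map_sr (f : GrHom e C M) (s : GrHom d C (GrMod.unit 𝒦)) (g : GrHom k M N) (c : C) :
    g (sr δ f s c) = koszulSign (d * k) • sr δ (f.comp g) s c := by
  rw [sr_apply, ← runit_tens_id, tens_id_cv, GrHom.map_zsmul, sr_apply]

section Coassoc

variable (hδ : ∀ x, (GrHom.id C).tens δ (δ x) = GrHom.assoc C C C (δ.tens (GrHom.id C) (δ x)))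
include hδ

theorem cv_sr_right (f : GrHom d C M) (g : GrHom e C N) (s : GrHom k C (GrMod.unit 𝒦)) (c : C) :
    cv δ f (sr δ g s) c = sr δ (cv δ f g) s c := by
  rw [sr_apply, ← runit_assoc, assoc_cv hδ, id_tens_cv]
  exact cv_congr rfl (add_zero _).symm (fun _ => rfl) (fun _ => rfl) c

theorem cv_sl_left (s : GrHom k C (GrMod.unit 𝒦)) (f : GrHom d C M) (g : GrHom e C N) (c : C) :
    cv δ (sl δ s f) g c = sl δ s (cv δ f g) c := by
  rw [sl_apply, ← assoc_cv hδ, lunit_assoc, tens_id_cv, mul_zero, koszulSign_zero, one_smul]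
  exact cv_congr (add_zero _).symm rfl (fun _ => rfl) (fun _ => rfl) c

/-- A functional in the middle of a triple convolution can be absorbed on either side. The mixed
terms in the curvature computations cancel for this reason. -/
theorem cv_sl_right (f : GrHom d C M) (s : GrHom k C (GrMod.unit 𝒦)) (g : GrHom e C N) (c : C) :
    cv δ f (sl δ s g) c = cv δ (sr δ f s) g c := by
  have h1 : cv δ f (sl δ s g) c = (GrHom.id M).tens (lunit N) (cv δ f (cv δ s g) c) := by
    rw [id_tens_cv]
    exact cv_congr rfl (add_zero _).symm (fun _ => rfl) (fun _ => rfl) c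
  rw [h1, ← assoc_cv hδ, lunit_runit, tens_id_cv, mul_zero, koszulSign_zero, one_smul]
  exact cv_congr (add_zero _) rfl (fun _ => rfl) (fun _ => rfl) c

end Coassoc

end Convolution

end GrHom

end GradedCalculus

/-! ### The tensor algebra: induction on words, multiplication, derivations. -/

section TensorAlgebraStructure

variable {𝕜 : Type u} [Ring 𝕜] {𝒦 : ℤ → AddSubgroup 𝕜} [GradedRing 𝒦]
  [IsGradedStronglyCommutative 𝒦]

namespace TensorConstr

open GrHom

variable {X Y M N : GrMod 𝒦} {d e : ℤ}

theorem inj_ind {p : X.T → Prop} (h : ∀ n w, p (inj X n w))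
    (hadd : ∀ a b, p a → p b → p (a + b)) (z : X.T) : p z := by
  refine DirectSum.induction_on (motive := p) z ?_ (fun n w => h n w) hadd
  have := h 0 0
  rwa [GrHom.map_zero] at this

theorem inj_zero_apply (c : 𝕜) : inj X 0 c = c • tone X :=
  (congrArg (inj X 0) (mul_one c).symm : _).trans ((inj X 0).toLin.map_smul c (1 : 𝕜))

variable (X) in
/-- The inclusion `X ⊗ X^{⊗n} → X T^≥`. -/
def injS (n : ℕ) : GrHom 0 (X.tensor (X.tpow n)) X.T := inj X (n + 1)

theorem cons_tmk_inj (x : X) (n : ℕ) (w : X.tpow n) :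
    cons X (tmk x (inj X n w)) = injS X n (tmk x w) :=
  tensorDsumLift_tmk (fun n => inj X (n + 1)) n w x

theorem cons_id_tens_inj (n : ℕ) (u : X.tensor (X.tpow n)) :
    cons X ((GrHom.id X).tens (inj X n) u) = injS X n u := by
  refine tensor_ext_apply (f := ((GrHom.id X).tens (inj X n)).comp (cons X))
    (g := injS X n) (fun i j x w _ _ => ?_) u
  rw [GrHom.comp_apply, tens_tmk_of_deg_zero]
  exact cons_tmk_inj x n w

theorem inj_cases {p : X.T → Prop} (hone : ∀ c : 𝕜, p (c • tone X))
    (hsucc : ∀ n u, p (injS X n u)) (hadd : ∀ a b, p a → p b → p (a + b)) (z : X.T) : p z := by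
  refine inj_ind ?_ hadd z
  rintro (_ | n) w
  · exact (congrArg p (inj_zero_apply (𝕜 := 𝕜) (X := X) w)).mpr (hone w)
  · exact hsucc n w

/-- Induction on the elements of the tensor algebra. -/
theorem T_ind {p : X.T → Prop} (hone : ∀ c : 𝕜, p (c • tone X))
    (hcons : ∀ i j x w, x ∈ X.deg i → w ∈ X.T.deg j → p w → p (cons X (tmk x w)))
    (hadd : ∀ a b, p a → p b → p (a + b)) (z : X.T) : p z := by
  have hzero : p 0 := by simpa only [zero_smul] using hone 0
  refine inj_ind (fun n => ?_) hadd z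
  induction n with
  | zero => exact fun c => (congrArg p (inj_zero_apply (𝕜 := 𝕜) (X := X) c)).mpr (hone c)
  | succ n ih =>
    intro w
    refine tensor_ind (p := fun w => p (injS X n w)) ?_ ?_ ?_ w
    · rw [GrHom.map_zero]; exact hzero
    · intro i j x v hx hv
      rw [← cons_tmk_inj]
      exact hcons i j x _ hx ((inj X n).map_deg_zero hv) (ih v)
    · intro a b ha hb
      rw [GrHom.map_add]; exact hadd _ _ ha hb

/-- Homogeneous maps out of the tensor algebra agree if they agree on the unit and agreement at `w`
implies agreement at `x w`. -/
theorem T_ext {f : GrHom d X.T M} {g : GrHom e X.T M} (hone : f (tone X) = g (tone X))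
    (hcons : ∀ i j x w, x ∈ X.deg i → w ∈ X.T.deg j → f w = g w →
      f (cons X (tmk x w)) = g (cons X (tmk x w))) (z : X.T) : f z = g z := by
  refine T_ind (p := fun z => f z = g z) ?_ hcons ?_ z
  · intro c; rw [GrHom.map_smul, GrHom.map_smul, hone]
  · intro a b ha hb; rw [GrHom.map_add, GrHom.map_add, ha, hb]

/-- Homogeneous maps out of `M ⊗ X T^≥` agree if they agree on the tensors with powers of `X`. -/
theorem tensor_T_ext {f : GrHom d (M.tensor X.T) N} {g : GrHom e (M.tensor X.T) N}
    (h : ∀ i j n m w, m ∈ M.deg i → w ∈ (X.tpow n).deg j →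
      f (tmk m (inj X n w)) = g (tmk m (inj X n w))) (z : M.tensor X.T) : f z = g z := by
  refine tensor_ext_apply (fun i j m w hm _ => ?_) z
  refine inj_ind (p := fun w => f (tmk m w) = g (tmk m w)) ?_ ?_ w
  · intro n w
    refine (X.tpow n).induction (p := fun w => f (tmk m (inj X n w)) = g (tmk m (inj X n w)))
      ?_ ?_ ?_ w
    · rw [GrHom.map_zero, tmk_zero, GrHom.map_zero, GrHom.map_zero]
    · intro k w hw; exact h i k n m w hm hw
    · intro a b ha hb
      rw [GrHom.map_add, tmk_add, GrHom.map_add, GrHom.map_add, ha, hb]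
  · intro a b ha hb
    rw [tmk_add, GrHom.map_add, GrHom.map_add, ha, hb]

variable (X) in
/-- The projection `X T^≥ → X^{⊗n}`. -/
def projT (n : ℕ) : GrHom 0 X.T (X.tpow n) where
  toLin := DirectSum.component 𝕜 ℕ (fun n => (X.tpow n : Type u)) n
  map_deg {i x} hx := by rw [add_zero]; exact hx n

theorem projT_inj_same (n : ℕ) (w : X.tpow n) : projT X n (inj X n w) = w :=
  DirectSum.of_eq_same (β := fun n => (X.tpow n : Type u)) n w

theorem projT_inj_ne {m n : ℕ} (h : m ≠ n) (w : X.tpow n) : projT X m (inj X n w) = 0 :=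
  DirectSum.of_eq_of_ne (β := fun n => (X.tpow n : Type u)) n m w h

theorem projT_ext {z z' : X.T} (h : ∀ n, projT X n z = projT X n z') : z = z' :=
  DFinsupp.ext h

theorem proj₀_injS (n : ℕ) (w : X.tensor (X.tpow n)) : proj₀ X (injS X n w) = 0 :=
  GrHom.dsumLift_inj _ (n + 1) _

variable (X) in
/-- The projection `X T^≥ → X ⊗ X^{⊗n}`. -/
def projS (n : ℕ) : GrHom 0 X.T (X.tensor (X.tpow n)) := projT X (n + 1)

theorem projS_injS_same (n : ℕ) (w : X.tensor (X.tpow n)) : projS X n (injS X n w) = w :=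
  projT_inj_same (n + 1) w

theorem projS_injS_ne {m n : ℕ} (h : m ≠ n) (w : X.tensor (X.tpow n)) :
    projS X m (injS X n w) = 0 :=
  projT_inj_ne (X := X) (m := m + 1) (n := n + 1) (by omega) w

theorem projS_tone (n : ℕ) : projS X n (tone X) = 0 := projT_inj_ne (by omega) _

theorem projT_zero (z : X.T) : projT X 0 z = proj₀ X z := by
  refine inj_cases (p := fun z => projT X 0 z = proj₀ X z) ?_ ?_ ?_ z
  · intro c
    rw [GrHom.map_smul]
    exact (congrArg (c • ·) (projT_inj_same 0 (1 : 𝕜))).trans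
      ((congrArg (c • ·) (proj₀_tone X).symm).trans ((proj₀ X).toLin.map_smul c _).symm)
  · intro n u
    exact (projT_inj_ne (by omega) _).trans (proj₀_injS n u).symm
  · intro a b ha hb
    rw [GrHom.map_add, GrHom.map_add, ha, hb]; rfl

/-- Elements of the tensor algebra agree if all their components do. -/
theorem T_ext_components {z z' : X.T} (h₀ : proj₀ X z = proj₀ X z')
    (h : ∀ n, projS X n z = projS X n z') : z = z' := by
  refine projT_ext ?_
  rintro (_ | n)
  · exact (projT_zero z).trans (h₀.trans (projT_zero z').symm)
  · exact h n

theorem proj₀_cons (u : X.tensor X.T) : proj₀ X (cons X u) = 0 := by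
  refine tensor_T_ext (f := (cons X).comp (proj₀ X)) (g := (0 : GrHom 0 _ _)) ?_ u
  intro i j n x w _ _
  rw [GrHom.comp_apply, cons_tmk_inj, proj₀_injS]; rfl

theorem projS_cons (n : ℕ) (u : X.tensor X.T) :
    projS X n (cons X u) = (GrHom.id X).tens (projT X n) u := by
  refine tensor_T_ext (f := (cons X).comp (projS X n))
    (g := (GrHom.id X).tens (projT X n)) ?_ u
  intro i j m x w _ _
  rw [GrHom.comp_apply, cons_tmk_inj, tens_tmk_of_deg_zero]
  by_cases h : n = m
  · subst h; rw [projS_injS_same, projT_inj_same]; rfl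
  · rw [projT_inj_ne h, projS_injS_ne h, tmk_zero]

variable (X) in
/-- The map `X T^≥ → X ⊗ X T^≥` splitting off the first factor. -/
noncomputable def uncons : GrHom 0 X.T (X.tensor X.T) :=
  GrHom.dsumLift fun
    | 0 => 0
    | n + 1 => ((GrHom.id X).tens (inj X n)).cast (by norm_num)

theorem uncons_injS (n : ℕ) (w : X.tensor (X.tpow n)) :
    uncons X (injS X n w) = (GrHom.id X).tens (inj X n) w := GrHom.dsumLift_inj _ (n + 1) _

theorem uncons_tone : uncons X (tone X) = 0 := GrHom.dsumLift_inj _ 0 _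

theorem uncons_cons (u : X.tensor X.T) : uncons X (cons X u) = u := by
  refine tensor_T_ext (f := (cons X).comp (uncons X)) (g := GrHom.id _) ?_ u
  intro i j n x w _ _
  rw [GrHom.comp_apply, cons_tmk_inj, uncons_injS, tens_tmk_of_deg_zero]; rfl

/-- The unit and `cons` decompose X T^≥ as 𝕜 ⊕ X ⊗ X T^≥, and `proj₀` and `uncons` are the two
projections. Recursions for maps into the tensor coalgebra rest on this. -/
theorem eq_tone_add_cons (z : X.T) :
    z = (proj₀ X z : 𝕜) • tone X + cons X (uncons X z) := by
  refine inj_cases (p := fun z => z = (proj₀ X z : 𝕜) • tone X + cons X (uncons X z)) ?_ ?_ ?_ z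
  · intro c
    rw [GrHom.map_smul, GrHom.map_smul, uncons_tone, smul_zero, GrHom.map_zero, add_zero,
      proj₀_tone]
    exact congrArg (· • tone X) (mul_one c).symm
  · intro n w
    rw [uncons_injS, cons_id_tens_inj, proj₀_injS]
    exact ((congrArg (· + _) (zero_smul 𝕜 (tone X))).trans (zero_add _)).symm
  · intro a b ha hb
    have h : ∀ r s : 𝕜, (r + s) • tone X + (cons X (uncons X a) + cons X (uncons X b)) =
        (r • tone X + cons X (uncons X a)) + (s • tone X + cons X (uncons X b)) := fun r s => by
      rw [add_smul]; abel
    rw [GrHom.map_add, GrHom.map_add, GrHom.map_add]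
    refine Eq.trans ?_ (h _ _).symm
    rw [← ha, ← hb]

variable (X) in
/-- The projection `X T^≥ → X` onto the generators. -/
noncomputable def p₁ : GrHom 0 X.T X := ((projS X 0).comp (GrHom.runit X)).cast (by norm_num)

theorem p₁_apply (z : X.T) : p₁ X z = GrHom.runit X (projS X 0 z) := rfl

theorem p₁_injS_zero (w : X.tensor (GrMod.unit 𝒦)) : p₁ X (injS X 0 w) = GrHom.runit X w := by
  rw [p₁_apply]
  exact congrArg (GrHom.runit X) (projS_injS_same 0 w)

theorem p₁_injS_succ {n : ℕ} (w : X.tensor (X.tpow (n + 1))) : p₁ X (injS X (n + 1) w) = 0 := by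
  rw [p₁_apply]
  exact (congrArg (GrHom.runit X) (projS_injS_ne (by omega) w)).trans (GrHom.runit X).map_zero

theorem p₁_tone : p₁ X (tone X) = 0 :=
  (congrArg (GrHom.runit X) (projS_tone 0)).trans (GrHom.runit X).map_zero

theorem p₁_cons (u : X.tensor X.T) :
    p₁ X (cons X u) = GrHom.runit X ((GrHom.id X).tens (proj₀ X) u) := by
  rw [p₁_apply, projS_cons]
  refine congrArg (GrHom.runit X) (tens_congr (g := projT X 0) rfl rfl (fun _ => rfl) ?_ u)
  exact projT_zero

theorem p₁_cons_tmk (x : X) (w : X.T) :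
    p₁ X (cons X (tmk x w)) = rsmul X (proj₀ X w : 𝕜) x := by
  rw [p₁_cons, tens_tmk_of_deg_zero]; rfl

theorem gen_eq_cons (x : X) : gen X x = cons X (tmk x (tone X)) := (cons_tmk_inj x 0 _).symm

theorem mul_tone_left (z : X.T) : mul X (tmk (tone X) z) = z :=
  (dsumTensorLift_tmk (mulAux X) 0 _ z).trans (one_smul 𝕜 z)

theorem mul_inj (n : ℕ) (w : X.tpow n) (z : X.T) :
    mul X (tmk (inj X n w) z) = mulAux X n (tmk w z) := dsumTensorLift_tmk (mulAux X) n w z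

theorem mul_injS (n : ℕ) (u : X.tensor (X.tpow n)) (z : X.T) :
    mul X (tmk (injS X n u) z) =
      cons X ((GrHom.id X).tens (mulAux X n) (GrHom.assoc X (X.tpow n) X.T (tmk u z))) :=
  dsumTensorLift_tmk (mulAux X) (n + 1) u z

theorem mul_cons (x : X) (w z : X.T) :
    mul X (tmk (cons X (tmk x w)) z) = cons X (tmk x (mul X (tmk w z))) := by
  refine inj_ind (p := fun w => mul X (tmk (cons X (tmk x w)) z) =
    cons X (tmk x (mul X (tmk w z)))) ?_ ?_ w
  · intro n w
    rw [cons_tmk_inj, mul_injS, mul_inj, assoc_tmk, tens_tmk_of_deg_zero]; rfl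
  · intro a b ha hb
    simp only [tmk_add, GrHom.map_add, add_tmk, ha, hb]

theorem mul_smul_tone_left (c : 𝕜) (z : X.T) : mul X (tmk (c • tone X) z) = c • z := by
  rw [smul_tmk, GrHom.map_smul, mul_tone_left]

theorem mul_assoc (a b c : X.T) :
    mul X (tmk a (mul X (tmk b c))) = mul X (tmk (mul X (tmk a b)) c) := by
  refine T_ind (p := fun a => mul X (tmk a (mul X (tmk b c))) = mul X (tmk (mul X (tmk a b)) c))
    ?_ ?_ ?_ a
  · intro r
    rw [mul_smul_tone_left, mul_smul_tone_left, smul_tmk, GrHom.map_smul]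
  · intro i j x w _ _ hw
    rw [mul_cons, mul_cons, mul_cons, hw]
  · intro a b ha hb
    simp only [add_tmk, GrHom.map_add, ha, hb]

theorem mul_tone_right (a : X.T) : mul X (tmk a (tone X)) = a := by
  refine T_ind (p := fun a => mul X (tmk a (tone X)) = a) ?_ ?_ ?_ a
  · intro r
    rw [mul_smul_tone_left]
  · intro i j x w _ _ hw
    rw [mul_cons, hw]
  · intro a b ha hb
    rw [add_tmk, GrHom.map_add, ha, hb]

theorem mul_gen (x : X) (w : X.T) : mul X (tmk (gen X x) w) = cons X (tmk x w) := by
  rw [gen_eq_cons, mul_cons, mul_tone_left]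

theorem der_inj (ξ : GrHom 1 X X.T) (n : ℕ) (w : X.tpow n) :
    der ξ (inj X n w) = derAux ξ n w := GrHom.dsumLift_inj _ _ _

theorem der_injS (ξ : GrHom 1 X X.T) (n : ℕ) (u : X.tensor (X.tpow n)) :
    der ξ (injS X n u) = cons X ((GrHom.id X).tens (derAux ξ n) u) + mul X (ξ.tens (inj X n) u) :=
  GrHom.dsumLift_inj _ (n + 1) _

theorem der_tone (ξ : GrHom 1 X X.T) : der ξ (tone X) = 0 := der_inj ξ 0 _

theorem der_cons_eq (ξ : GrHom 1 X X.T) (u : X.tensor X.T) :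
    der ξ (cons X u) = cons X ((GrHom.id X).tens (der ξ) u) +
      mul X (ξ.tens (GrHom.id X.T) u) := by
  refine tensor_T_ext (f := (cons X).comp (der ξ))
    (g := (((GrHom.id X).tens (der ξ)).comp (cons X)).cast (by norm_num : (0 : ℤ) + 1 + 0 = 1) +
      ((ξ.tens (GrHom.id X.T)).comp (mul X)).cast (by norm_num)) ?_ u
  intro i j n x w hx hw
  rw [GrHom.add_apply, GrHom.cast_apply, GrHom.cast_apply, GrHom.comp_apply, GrHom.comp_apply, GrHom.comp_apply, cons_tmk_inj,
    der_injS, tens_tmk_of_deg_zero, tens_tmk_of_deg_zero, der_inj, tens_tmk _ _ _ hw,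
    tens_tmk _ _ _ ((inj X n).map_deg_zero hw)]; rfl

theorem der_cons (ξ : GrHom 1 X X.T) (x : X) {j : ℤ} {w : X.T} (hw : w ∈ X.T.deg j) :
    der ξ (cons X (tmk x w)) = cons X (tmk x (der ξ w)) +
      koszulSign (1 * j) • mul X (tmk (ξ x) w) := by
  rw [der_cons_eq, tens_tmk_of_deg_zero, tens_tmk _ _ _ hw, GrHom.map_zsmul]; rfl

theorem der_gen (ξ : GrHom 1 X X.T) (x : X) : der ξ (gen X x) = ξ x := by
  rw [gen_eq_cons, der_cons ξ x (tone_mem X), der_tone, tmk_zero, GrHom.map_zero, zero_add,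
    mul_zero, koszulSign_zero, one_smul, mul_tone_right]

/-- Induction on the first letter of `a` with `b` fixed. For a = x w the sign (-1)^{|w|+|b|}
attached to differentiating x is the product of the two signs on the right. -/
theorem der_mul (ξ : GrHom 1 X X.T) (a : X.T) {j : ℤ} {b : X.T} (hb : b ∈ X.T.deg j) :
    der ξ (mul X (tmk a b)) = mul X (tmk a (der ξ b)) +
      koszulSign (1 * j) • mul X (tmk (der ξ a) b) := by
  refine T_ind (p := fun a => der ξ (mul X (tmk a b)) = mul X (tmk a (der ξ b)) +
      koszulSign (1 * j) • mul X (tmk (der ξ a) b)) ?_ ?_ ?_ a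
  · intro r
    rw [mul_smul_tone_left, mul_smul_tone_left, GrHom.map_smul, GrHom.map_smul, der_tone,
      smul_zero, zero_tmk, GrHom.map_zero, smul_zero, add_zero]
  · intro i k x w hx hw ih
    have hwb : mul X (tmk w b) ∈ X.T.deg (k + j) := (mul X).map_deg_zero (tmk_mem hw hb)
    rw [mul_cons, mul_cons, der_cons ξ x hwb, der_cons ξ x hw, ih, tmk_add, GrHom.map_add,
      add_tmk, GrHom.map_add, mul_cons, zsmul_tmk, GrHom.map_zsmul, tmk_zsmul, GrHom.map_zsmul,
      mul_assoc, smul_add, smul_smul, ← koszulSign_add, add_assoc, ← mul_add, add_comm j k]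
  · intro a b ha hb
    simp only [add_tmk, GrHom.map_add, ha, hb, smul_add]
    abel

theorem der_leibniz (ξ : GrHom 1 X X.T) (z : X.T.tensor X.T) :
    der ξ (mul X z) = mul X ((GrHom.id X.T).tens (der ξ) z) +
      mul X ((der ξ).tens (GrHom.id X.T) z) := by
  refine tensor_ind (p := fun z => der ξ (mul X z) = mul X ((GrHom.id X.T).tens (der ξ) z) +
      mul X ((der ξ).tens (GrHom.id X.T) z)) ?_ ?_ ?_ z
  · simp only [GrHom.map_zero, add_zero]
  · intro i j a b _ hb
    rw [der_mul ξ a hb, tens_tmk_of_deg_zero, tens_tmk _ _ _ hb, GrHom.map_zsmul]; rfl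
  · intro a b ha hb
    simp only [GrHom.map_add, ha, hb]; abel

/-! ### Extension of a map on generators to an algebra homomorphism. -/

section AlgLift

/-- The extension of `φ : X → A` to tensor powers, `x ⊗ w ↦ φ(x) · f(w)`. -/
noncomputable def algLiftAux (A : AlgData 𝒦) (φ : GrHom 0 X A.A) :
    (n : ℕ) → GrHom 0 (X.tpow n) A.A
  | 0 => GrHom.ofElem A.one_mem
  | n + 1 => ((φ.tens (algLiftAux A φ n)).comp A.m₂).cast (by norm_num)

/-- The algebra homomorphism `X T^≥ → A` with restriction `φ` to the generators. -/
noncomputable def algLift (A : AlgData 𝒦) (φ : GrHom 0 X A.A) : GrHom 0 X.T A.A :=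
  GrHom.dsumLift (algLiftAux A φ)

variable {A : AlgData 𝒦} (φ : GrHom 0 X A.A)

theorem algLift_inj (n : ℕ) (w : X.tpow n) : algLift A φ (inj X n w) = algLiftAux A φ n w :=
  GrHom.dsumLift_inj _ _ _

theorem algLift_injS (n : ℕ) (u : X.tensor (X.tpow n)) :
    algLift A φ (injS X n u) = A.m₂ (φ.tens (algLiftAux A φ n) u) := GrHom.dsumLift_inj _ (n + 1) _

theorem algLift_tone : algLift A φ (tone X) = A.one := (algLift_inj φ 0 _).trans (one_smul 𝕜 A.one)

theorem algLift_cons (x : X) (w : X.T) :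
    algLift A φ (cons X (tmk x w)) = A.m₂ (tmk (φ x) (algLift A φ w)) := by
  refine inj_ind (p := fun w => algLift A φ (cons X (tmk x w)) =
    A.m₂ (tmk (φ x) (algLift A φ w))) ?_ ?_ w
  · intro n w
    rw [cons_tmk_inj, algLift_injS, algLift_inj, tens_tmk_of_deg_zero]
  · intro a b ha hb
    simp only [tmk_add, GrHom.map_add, ha, hb]

theorem algHom_inj (ψ : GrHom 0 X Y.T) (n : ℕ) (w : X.tpow n) :
    algHom ψ (inj X n w) = algHomAux ψ n w := GrHom.dsumLift_inj _ _ _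

theorem algHom_injS (ψ : GrHom 0 X Y.T) (n : ℕ) (u : X.tensor (X.tpow n)) :
    algHom ψ (injS X n u) = mul Y (ψ.tens (algHomAux ψ n) u) := GrHom.dsumLift_inj _ (n + 1) _

theorem algHom_tone (ψ : GrHom 0 X Y.T) : algHom ψ (tone X) = tone Y := algHom_inj ψ 0 _

theorem algHom_cons (ψ : GrHom 0 X Y.T) (x : X) (w : X.T) :
    algHom ψ (cons X (tmk x w)) = mul Y (tmk (ψ x) (algHom ψ w)) := by
  refine inj_ind (p := fun w => algHom ψ (cons X (tmk x w)) =
    mul Y (tmk (ψ x) (algHom ψ w))) ?_ ?_ w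
  · intro n w
    rw [cons_tmk_inj, algHom_injS, algHom_inj, tens_tmk_of_deg_zero]
  · intro a b ha hb
    simp only [tmk_add, GrHom.map_add, ha, hb]

end AlgLift

theorem map_inj (f : GrHom 0 X Y) (n : ℕ) (w : X.tpow n) :
    map f (inj X n w) = inj Y n (powMap f n w) := GrHom.dsumLift_inj _ _ _

theorem map_injS (f : GrHom 0 X Y) (n : ℕ) (u : X.tensor (X.tpow n)) :
    map f (injS X n u) = injS Y n (f.tens (powMap f n) u) := GrHom.dsumLift_inj _ (n + 1) _

theorem map_tone (f : GrHom 0 X Y) : map f (tone X) = tone Y := map_inj f 0 _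

theorem map_cons (f : GrHom 0 X Y) (x : X) (w : X.T) :
    map f (cons X (tmk x w)) = cons Y (tmk (f x) (map f w)) := by
  refine inj_ind (p := fun w => map f (cons X (tmk x w)) = cons Y (tmk (f x) (map f w))) ?_ ?_ w
  · intro n w
    rw [cons_tmk_inj, map_injS, map_inj, cons_tmk_inj, tens_tmk_of_deg_zero]
  · intro a b ha hb
    simp only [tmk_add, GrHom.map_add, ha, hb]

theorem map_id (f : GrHom 0 X X) (hf : ∀ x, f x = x) (z : X.T) : map f z = z := by
  refine T_ext (f := map f) (g := GrHom.id X.T) (map_tone _) (fun i j x w _ _ hw => ?_) z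
  rw [map_cons, hf, hw]; rfl

theorem map_comp {Z : GrMod 𝒦} (f : GrHom 0 X Y) (g : GrHom 0 Y Z) (h : GrHom 0 X Z)
    (hfg : ∀ x, h x = g (f x)) (z : X.T) : map h z = map g (map f z) := by
  refine T_ext (f := map h) (g := (map f).comp (map g)) ?_ (fun i j x w _ _ hw => ?_) z
  · rw [GrHom.comp_apply, map_tone, map_tone, map_tone]
  · rw [map_cons, GrHom.comp_apply, map_cons, map_cons, hw, hfg]; rfl

theorem proj₀_map (f : GrHom 0 X Y) (z : X.T) : proj₀ Y (map f z) = proj₀ X z := by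
  refine T_ext (f := (map f).comp (proj₀ Y)) (g := proj₀ X) ?_ (fun i j x w _ _ hw => ?_) z
  · rw [GrHom.comp_apply, map_tone, proj₀_tone, proj₀_tone]
  · rw [GrHom.comp_apply, map_cons, proj₀_cons, proj₀_cons]

theorem p₁_map (f : GrHom 0 X Y) (z : X.T) : p₁ Y (map f z) = f (p₁ X z) := by
  refine T_ext (f := (map f).comp (p₁ Y)) (g := (p₁ X).comp f) ?_ (fun i j x w hx hw _ => ?_) z
  · rw [GrHom.comp_apply, map_tone, p₁_tone, GrHom.comp_apply, p₁_tone, GrHom.map_zero]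
  · have hw' : (proj₀ X w : 𝕜) ∈ 𝒦 j := (proj₀ X).map_deg_zero hw
    rw [GrHom.comp_apply, map_cons, p₁_cons_tmk, GrHom.comp_apply, p₁_cons_tmk, proj₀_map, map_rsmul f hw']

end TensorConstr

end TensorAlgebraStructure

/-! ### The tensor coalgebra: cut comultiplication and coderivations. -/

section TensorCoalgebraStructure

variable {𝕜 : Type u} [Ring 𝕜] {𝒦 : ℤ → AddSubgroup 𝕜} [GradedRing 𝒦]
  [IsGradedStronglyCommutative 𝒦]

namespace GrHom

variable {d e k l : ℤ} {M N P Q M' N' P' : GrMod 𝒦}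

theorem rsmul_tmk (x : M) (y : N) (c : 𝕜) :
    rsmul (M.tensor N) c (tmk x y) = tmk x (rsmul N c y) := by
  have := runit_assoc (tmk (N := GrMod.unit 𝒦) (tmk x y) c)
  rw [assoc_tmk, tens_tmk_of_deg_zero] at this
  exact this.symm

theorem tmk_rsmul (x : M) (y : N) (c : 𝕜) : tmk (rsmul M c x) y = tmk x (c • y) := by
  have := lunit_runit (tmk (tmk (N := GrMod.unit 𝒦) x c) y)
  rw [assoc_tmk, tens_tmk_of_deg_zero, tens_tmk_of_deg_zero] at this
  exact this.symm

theorem tens_id_id_tens (f : GrHom d M M') (g : GrHom 0 N N') (z : M.tensor N) :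
    f.tens (GrHom.id N') ((GrHom.id M).tens g z) = f.tens g z := by
  rw [tens_id_tens, zero_mul, koszulSign_zero, one_smul]
  exact tens_congr (zero_add d) rfl (fun _ => rfl) (fun _ => rfl) z

theorem tens_zero_right (f : GrHom d M M') (z : M.tensor N) :
    f.tens (0 : GrHom e N N') z = 0 := by
  refine tensor_ext_apply (f := f.tens (0 : GrHom e N N')) (g := (0 : GrHom 0 _ _))
    (fun i j x y _ hy => ?_) z
  rw [tens_tmk _ _ _ hy, GrHom.zero_apply, tmk_zero, smul_zero]; rfl

theorem tens_zero_left (f : GrHom d N N') (z : M.tensor N) :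
    (0 : GrHom e M M').tens f z = 0 := by
  refine tensor_ext_apply (f := (0 : GrHom e M M').tens f) (g := (0 : GrHom 0 _ _))
    (fun i j x y _ hy => ?_) z
  rw [tens_tmk _ _ _ hy, GrHom.zero_apply, zero_tmk, smul_zero]; rfl

end GrHom

namespace TensorConstr

open GrHom

variable {X Y M N : GrMod 𝒦} {d e : ℤ}

theorem inj_ext {f : GrHom d X.T M} {g : GrHom e X.T M} (hone : f (tone X) = g (tone X))
    (hsucc : ∀ n u, f (injS X n u) = g (injS X n u)) (z : X.T) : f z = g z := by
  refine inj_cases (p := fun z => f z = g z) ?_ hsucc ?_ z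
  · intro c; rw [GrHom.map_smul, GrHom.map_smul, hone]
  · intro a b ha hb; rw [GrHom.map_add, GrHom.map_add, ha, hb]

variable (X M) in
/-- The map `X ⊗ (X T^≥ ⊗ M) → X T^≥ ⊗ M`, `x ⊗ (z ⊗ m) ↦ x z ⊗ m`. -/
noncomputable def consT : GrHom 0 (X.tensor (X.T.tensor M)) (X.T.tensor M) :=
  ((GrHom.assocInv X X.T M).comp ((cons X).tens (GrHom.id M))).cast (by norm_num)

theorem consT_apply (u : X.tensor (X.T.tensor M)) :
    consT X M u = (cons X).tens (GrHom.id M) (GrHom.assocInv X X.T M u) := rfl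

theorem consT_tmk (x : X) (z : X.T) (m : M) :
    consT X M (tmk x (tmk z m)) = tmk (cons X (tmk x z)) m := by
  rw [consT_apply, assocInv_tmk, tens_tmk_of_deg_zero]; rfl

theorem tens_consT (g : GrHom d M N) (x : X) (u : X.T.tensor M) :
    (GrHom.id X.T).tens g (consT X M (tmk x u)) = consT X N (tmk x ((GrHom.id X.T).tens g u)) := by
  refine tensor_ind (p := fun u => (GrHom.id X.T).tens g (consT X M (tmk x u)) =
    consT X N (tmk x ((GrHom.id X.T).tens g u))) ?_ ?_ ?_ u
  · simp only [GrHom.map_zero, tmk_zero]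
  · intro i j z m _ _
    rw [consT_tmk, tens_tmk_of_deg_zero, tens_tmk_of_deg_zero, consT_tmk]; rfl
  · intro a b ha hb
    simp only [tmk_add, GrHom.map_add, ha, hb]

theorem comul_inj (n : ℕ) (w : X.tpow n) : comul X (inj X n w) = comulAux X n w :=
  GrHom.dsumLift_inj _ _ _

theorem comul_tone : comul X (tone X) = tmk (tone X) (tone X) :=
  (comul_inj 0 _).trans (one_smul 𝕜 _)

theorem oneTensor_apply (z : X.T) : oneTensor X z = tmk (tone X) z :=
  tens_tmk_of_deg_zero (inj X 0) (GrHom.id X.T) (show X.tpow 0 from (1 : 𝕜)) z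

theorem comul_injS (n : ℕ) (u : X.tensor (X.tpow n)) :
    comul X (injS X n u) = oneTensor X (injS X n u) +
      consTensor X ((GrHom.id X).tens (comulAux X n) u) := GrHom.dsumLift_inj _ (n + 1) _

theorem comul_cons (x : X) (w : X.T) :
    comul X (cons X (tmk x w)) = tmk (tone X) (cons X (tmk x w)) +
      consT X X.T (tmk x (comul X w)) := by
  refine inj_ind (p := fun w => comul X (cons X (tmk x w)) = tmk (tone X) (cons X (tmk x w)) +
      consT X X.T (tmk x (comul X w))) ?_ ?_ w
  · intro n w
    rw [cons_tmk_inj, comul_injS, comul_inj, oneTensor_apply, tens_tmk_of_deg_zero]; rfl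
  · intro a b ha hb
    simp only [tmk_add, GrHom.map_add, ha, hb]; abel

/-- Induction on words: since Δ(xw) = 1 ⊗ xw + x·Δ(w), each side at xw equals 1 ⊗ Δ(xw) plus x
prepended to the same side at w. -/
theorem comul_coassoc (z : X.T) : (GrHom.id X.T).tens (comul X) (comul X z) =
    GrHom.assoc X.T X.T X.T ((comul X).tens (GrHom.id X.T) (comul X z)) := by
  refine T_ext (f := (comul X).comp ((GrHom.id X.T).tens (comul X)))
    (g := ((comul X).comp ((comul X).tens (GrHom.id X.T))).comp (GrHom.assoc X.T X.T X.T))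
    ?_ ?_ z
  · simp only [GrHom.comp_apply, comul_tone, tens_tmk_of_deg_zero]; rfl
  · intro i j x w _ _ hw
    simp only [GrHom.comp_apply] at hw ⊢
    have h1 : ∀ (v : X.T.tensor X.T) (z : X.T), GrHom.assoc X.T X.T X.T
        (tmk (consT X X.T (tmk x v)) z) = consT X _ (tmk x (GrHom.assoc X.T X.T X.T (tmk v z))) := by
      intro v z
      refine tensor_ind (p := fun v => GrHom.assoc X.T X.T X.T (tmk (consT X X.T (tmk x v)) z) =
        consT X _ (tmk x (GrHom.assoc X.T X.T X.T (tmk v z)))) ?_ ?_ ?_ v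
      · simp only [tmk_zero, zero_tmk, GrHom.map_zero]
      · intro i j a b _ _
        rw [consT_tmk, assoc_tmk, assoc_tmk, consT_tmk]
      · intro a b ha hb
        simp only [tmk_add, add_tmk, GrHom.map_add, ha, hb]
    have h2 : ∀ u : X.T.tensor X.T, GrHom.assoc X.T X.T X.T
        ((comul X).tens (GrHom.id X.T) (consT X X.T (tmk x u))) =
        tmk (tone X) (consT X X.T (tmk x u)) +
          consT X _ (tmk x (GrHom.assoc X.T X.T X.T ((comul X).tens (GrHom.id X.T) u))) := by
      refine tensor_ind ?_ ?_ ?_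
      · simp only [tmk_zero, GrHom.map_zero, add_zero]
      · intro i j a b _ _
        rw [consT_tmk, tens_tmk_of_deg_zero, tens_tmk_of_deg_zero, comul_cons, add_tmk,
          GrHom.map_add, assoc_tmk, h1]; rfl
      · intro a b ha hb
        simp only [tmk_add, GrHom.map_add, ha, hb]; abel
    rw [comul_cons, GrHom.map_add, GrHom.map_add, GrHom.map_add, tens_consT, hw, h2,
      tens_tmk_of_deg_zero, tens_tmk_of_deg_zero, comul_tone, assoc_tmk, comul_cons, tmk_add,
      add_assoc]
    rfl

theorem comul_counit_left (z : X.T) :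
    GrHom.lunit X.T ((proj₀ X).tens (GrHom.id X.T) (comul X z)) = z := by
  refine T_ext (f := ((comul X).comp ((proj₀ X).tens (GrHom.id X.T))).comp (GrHom.lunit X.T))
    (g := GrHom.id X.T) ?_ ?_ z
  · simp only [GrHom.comp_apply, comul_tone, tens_tmk_of_deg_zero]
    exact (congrArg (fun c : 𝕜 => c • tone X) (proj₀_tone X)).trans (one_smul _ _)
  · intro i j x w _ _ hw
    have h : ∀ u : X.T.tensor X.T,
        (proj₀ X).tens (GrHom.id X.T) (consT X X.T (tmk x u)) = 0 := by
      refine tensor_ind ?_ ?_ ?_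
      · simp only [tmk_zero, GrHom.map_zero]
      · intro i j a b _ _
        rw [consT_tmk, tens_tmk_of_deg_zero, proj₀_cons, zero_tmk]
      · intro a b ha hb
        simp only [tmk_add, GrHom.map_add, ha, hb, add_zero]
    simp only [GrHom.comp_apply, comul_cons, GrHom.map_add, h, tens_tmk_of_deg_zero, add_zero]
    exact (congrArg (fun c : 𝕜 => c • cons X (tmk x w)) (proj₀_tone X)).trans (one_smul _ _)

theorem comul_counit_right (z : X.T) :
    GrHom.runit X.T ((GrHom.id X.T).tens (proj₀ X) (comul X z)) = z := by
  refine T_ext (f := ((comul X).comp ((GrHom.id X.T).tens (proj₀ X))).comp (GrHom.runit X.T))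
    (g := GrHom.id X.T) ?_ ?_ z
  · simp only [GrHom.comp_apply, comul_tone, tens_tmk_of_deg_zero]
    exact (congrArg (fun c : 𝕜 => rsmul X.T c (tone X)) (proj₀_tone X)).trans (rsmul_one _)
  · intro i j x w _ _ hw
    have h : ∀ u : X.T.tensor X.T,
        GrHom.runit X.T ((GrHom.id X.T).tens (proj₀ X) (consT X X.T (tmk x u))) =
          cons X (tmk x (GrHom.runit X.T ((GrHom.id X.T).tens (proj₀ X) u))) := by
      refine tensor_ind ?_ ?_ ?_
      · simp only [tmk_zero, GrHom.map_zero]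
      · intro i j a b _ hb
        have hb' : (proj₀ X b : 𝕜) ∈ 𝒦 j := (proj₀ X).map_deg_zero hb
        rw [consT_tmk, tens_tmk_of_deg_zero, tens_tmk_of_deg_zero]
        change rsmul X.T (proj₀ X b : 𝕜) (cons X (tmk x a)) =
          cons X (tmk x (rsmul X.T (proj₀ X b : 𝕜) a))
        rw [← map_rsmul _ hb', rsmul_tmk]
      · intro a b ha hb
        simp only [tmk_add, GrHom.map_add, ha, hb]
    simp only [GrHom.comp_apply] at hw ⊢
    rw [comul_cons, GrHom.map_add, GrHom.map_add, h, hw, tens_tmk_of_deg_zero, proj₀_cons, tmk_zero,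
      GrHom.map_zero, zero_add]; rfl

/-- Among all cuts of a word, applying `p₁` to the left part keeps only the cut after the first
letter. Splitting off a letter is thus expressed through the coproduct, and so can be computed after
any coalgebra map or coderivation. -/
theorem uncons_eq_cv (z : X.T) : uncons X z = cv (comul X) (p₁ X) (GrHom.id X.T) z := by
  refine T_ext (f := uncons X) (g := cv (comul X) (p₁ X) (GrHom.id X.T)) ?_ ?_ z
  · rw [uncons_tone, cv_apply, comul_tone, tens_tmk_of_deg_zero, p₁_tone, zero_tmk]
  · intro i j x w _ _ _
    have h : ∀ u : X.T.tensor X.T, (p₁ X).tens (GrHom.id X.T) (consT X X.T (tmk x u)) =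
        tmk x (GrHom.lunit X.T ((proj₀ X).tens (GrHom.id X.T) u)) := by
      refine tensor_ind ?_ ?_ ?_
      · simp only [tmk_zero, GrHom.map_zero]
      · intro i j a b _ _
        rw [consT_tmk, tens_tmk_of_deg_zero, tens_tmk_of_deg_zero, p₁_cons_tmk, tmk_rsmul]; rfl
      · intro a b ha hb
        simp only [tmk_add, GrHom.map_add, ha, hb]
    rw [uncons_cons, cv_apply, comul_cons, GrHom.map_add, h, comul_counit_left,
      tens_tmk_of_deg_zero, p₁_tone, zero_tmk, zero_add]

theorem lunitInv_eq_cv (z : X.T) :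
    GrHom.lunitInv X.T z = cv (comul X) (proj₀ X) (GrHom.id X.T) z := by
  rw [← lunitInv_lunit (cv (comul X) (proj₀ X) (GrHom.id X.T) z), cv_apply, comul_counit_left]

theorem comul_map (f : GrHom 0 X Y) (z : X.T) :
    (map f).tens (map f) (comul X z) = comul Y (map f z) := by
  refine T_ext (f := (comul X).comp ((map f).tens (map f))) (g := (map f).comp (comul Y)) ?_ ?_ z
  · simp only [GrHom.comp_apply, comul_tone, tens_tmk_of_deg_zero, map_tone]
  · intro i j x w _ _ hw
    have h : ∀ u : X.T.tensor X.T, (map f).tens (map f) (consT X X.T (tmk x u)) =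
        consT Y Y.T (tmk (f x) ((map f).tens (map f) u)) := by
      refine tensor_ind ?_ ?_ ?_
      · simp only [tmk_zero, GrHom.map_zero]
      · intro i j a b _ _
        rw [consT_tmk, tens_tmk_of_deg_zero, tens_tmk_of_deg_zero, consT_tmk, map_cons]
      · intro a b ha hb
        simp only [tmk_add, GrHom.map_add, ha, hb]
    simp only [GrHom.comp_apply] at hw ⊢
    rw [comul_cons, GrHom.map_add, h, hw, map_cons, comul_cons, tens_tmk_of_deg_zero, map_tone,
      map_cons]

/-- Replaces the definition by cases on the length of the word by one formula, each summand of which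
sees words of a single length. By `id_tens_p₁_uncons` the last summand is φ₂ applied to p₁ ⋆ p₁. -/
theorem ofLow_apply (φ₀ : GrHom d (GrMod.unit 𝒦) N) (φ₁ : GrHom d X N)
    (φ₂ : GrHom d (X.tensor X) N) (z : X.T) :
    ofLow φ₀ φ₁ φ₂ z = φ₀ (proj₀ X z) + φ₁ (p₁ X z) +
      φ₂ ((GrHom.id X).tens (p₁ X) (uncons X z)) := by
  refine inj_ext (f := ofLow φ₀ φ₁ φ₂)
    (g := ((proj₀ X).comp φ₀).cast (by ring : (0 : ℤ) + d = d) +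
      ((p₁ X).comp φ₁).cast (by ring) +
      ((uncons X).comp (((GrHom.id X).tens (p₁ X)).comp φ₂)).cast (by ring)) ?_ ?_ z
  · simp only [GrHom.add_apply, GrHom.cast_apply, GrHom.comp_apply, uncons_tone, p₁_tone,
      GrHom.map_zero, add_zero]
    exact (GrHom.dsumLift_inj _ 0 _).trans (congrArg φ₀ (proj₀_tone X).symm)
  · intro n u
    have h₀ : φ₀ (proj₀ X (injS X n u)) = 0 :=
      (congrArg φ₀ (proj₀_injS n u)).trans φ₀.map_zero
    simp only [GrHom.add_apply, GrHom.cast_apply, GrHom.comp_apply, h₀, uncons_injS, zero_add,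
      id_tens_tens]
    refine (GrHom.dsumLift_inj _ (n + 1) _).trans ?_
    -- The word has length `n + 1`; the cases are length one, two and at least three.
    rcases n with _ | _ | n
    · have h₂ : (GrHom.id X).tens ((inj X 0).comp (p₁ X)) u = 0 :=
        (tens_congr (g' := (0 : GrHom (0 + 0) _ _)) rfl rfl (fun _ => rfl)
          (fun w => (congrArg (p₁ X) (inj_zero_apply (𝕜 := 𝕜) (X := X) w)).trans
            ((GrHom.map_smul _ _ _).trans ((congrArg _ p₁_tone).trans (smul_zero _)))) u).trans
          (tens_zero_right _ u)
      refine Eq.trans ?_ ((congrArg (fun t => φ₁ (p₁ X (injS X 0 u)) + φ₂ t) h₂).symm)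
      exact (congrArg φ₁ (p₁_injS_zero u)).symm.trans
        ((congrArg _ φ₂.map_zero).trans (add_zero _)).symm
    · refine Eq.trans ?_ (congrArg (fun t => φ₁ t + _) (p₁_injS_succ u).symm)
      refine Eq.trans ?_ ((congrArg (· + _) φ₁.map_zero).trans (zero_add _)).symm
      exact congrArg φ₂ (tens_congr rfl (zero_add _).symm (fun _ => rfl)
        (fun w => (p₁_injS_zero w).symm) u)
    · have h₂ : (GrHom.id X).tens ((inj X (n + 1 + 1)).comp (p₁ X)) u = 0 :=
        (tens_congr (g' := (0 : GrHom (0 + 0) _ _)) rfl rfl (fun _ => rfl)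
          (fun w => p₁_injS_succ w) u).trans (tens_zero_right _ u)
      refine Eq.trans ?_ (congrArg₂ (fun s t => φ₁ s + φ₂ t) (p₁_injS_succ u) h₂).symm
      exact ((congrArg₂ (· + ·) φ₁.map_zero φ₂.map_zero).trans (add_zero 0)).symm

theorem id_tens_p₁_uncons (z : X.T) :
    (GrHom.id X).tens (p₁ X) (uncons X z) = cv (comul X) (p₁ X) (p₁ X) z := by
  rw [uncons_eq_cv, id_tens_cv]
  exact cv_congr rfl (zero_add _) (fun _ => rfl) (fun _ => rfl) z

/-! ### Coderivations of the tensor coalgebra. -/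

section Coder

variable (b₀ : GrHom 1 (GrMod.unit 𝒦) X) (b₁ : GrHom 1 X X) (b₂ : GrHom 1 (X.tensor X) X)

theorem coder_inj (n : ℕ) (w : X.tpow n) :
    coder b₀ b₁ b₂ (inj X n w) = coderAux b₀ b₁ b₂ n w := GrHom.dsumLift_inj _ _ _

theorem head₀_apply (n : ℕ) (w : X.tpow n) :
    head₀ b₀ n w = cons X (b₀.tens (GrHom.id X.T) (GrHom.lunitInv X.T (inj X n w))) := by
  change injS X n (b₀.tens (GrHom.id (X.tpow n)) (GrHom.lunitInv (X.tpow n) w)) = _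
  have h : GrHom.lunitInv X.T (inj X n w) =
      (GrHom.id (GrMod.unit 𝒦)).tens (inj X n) (GrHom.lunitInv (X.tpow n) w) :=
    (tens_tmk_of_deg_zero (GrHom.id (GrMod.unit 𝒦)) (inj X n) (show (GrMod.unit 𝒦) from (1 : 𝕜))
      w).symm
  rw [← cons_id_tens_inj, id_tens_tens, h, tens_id_id_tens]
  exact congrArg _ (tens_congr rfl (zero_add _) (fun _ => rfl) (fun _ => rfl) _)

theorem head₂_succ (n : ℕ) (u : X.tensor (X.tensor (X.tpow n))) :
    head₂ b₂ (n + 2) u = cons X (b₂.tens (GrHom.id X.T)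
      (GrHom.assocInv X X X.T ((GrHom.id X).tens ((GrHom.id X).tens (inj X n)) u))) := by
  change injS X n (b₂.tens (GrHom.id (X.tpow n)) (GrHom.assocInv X X (X.tpow n) u)) = _
  rw [assocInv_tens, tens_congr (f := (GrHom.id X).tens (GrHom.id X)) (f' := GrHom.id _)
    (g' := inj X n) (zero_add _) rfl tens_id (fun _ => rfl), tens_id_id_tens, ← cons_id_tens_inj,
    id_tens_tens]
  exact congrArg _ (tens_congr rfl (zero_add _) (fun _ => rfl) (fun _ => rfl) _)

theorem coder_injS (n : ℕ) (u : X.tensor (X.tpow n)) : coder b₀ b₁ b₂ (injS X n u) =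
    cons X ((GrHom.id X).tens (coderAux b₀ b₁ b₂ n) u) +
      (head₀ b₀ (n + 1) u + head₁ b₁ (n + 1) u + head₂ b₂ (n + 1) u) :=
  GrHom.dsumLift_inj _ (n + 1) _

/-- Passes from the separate tensor powers to all of X T^≥. The terms 1^{⊗r} ⊗ b_k ⊗ 1^{⊗t} with r >
0 form the first summand, and those with r = 0 the other three. -/
theorem coder_eq (z : X.T) : coder b₀ b₁ b₂ z =
    cons X ((GrHom.id X).tens (coder b₀ b₁ b₂) (uncons X z)) +
      (cons X (b₀.tens (GrHom.id X.T) (GrHom.lunitInv X.T z)) +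
      cons X (b₁.tens (GrHom.id X.T) (uncons X z)) +
      cons X (b₂.tens (GrHom.id X.T)
        (GrHom.assocInv X X X.T ((GrHom.id X).tens (uncons X) (uncons X z))))) := by
  refine inj_ext (f := coder b₀ b₁ b₂)
    (g := ((uncons X).comp (((GrHom.id X).tens (coder b₀ b₁ b₂)).comp (cons X))).cast
        (by norm_num : (0 : ℤ) + (0 + 1 + 0) = 1) +
      (((GrHom.lunitInv X.T).comp ((b₀.tens (GrHom.id X.T)).comp (cons X))).cast (by norm_num) +
      ((uncons X).comp ((b₁.tens (GrHom.id X.T)).comp (cons X))).cast (by norm_num) +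
      ((uncons X).comp (((GrHom.id X).tens (uncons X)).comp ((GrHom.assocInv X X X.T).comp
        ((b₂.tens (GrHom.id X.T)).comp (cons X))))).cast (by norm_num))) ?_ ?_ z
  · simp only [GrHom.add_apply, GrHom.cast_apply, GrHom.comp_apply, uncons_tone, GrHom.map_zero,
      add_zero, zero_add]
    exact (coder_inj b₀ b₁ b₂ 0 _).trans (head₀_apply b₀ 0 _)
  · intro n u
    simp only [GrHom.add_apply, GrHom.cast_apply, GrHom.comp_apply, uncons_injS]
    have hr : cons X ((GrHom.id X).tens (coderAux b₀ b₁ b₂ n) u) =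
        cons X ((GrHom.id X).tens (coder b₀ b₁ b₂) ((GrHom.id X).tens (inj X n) u)) := by
      rw [id_tens_tens]
      refine congrArg (cons X) (tens_congr rfl (zero_add _).symm (fun _ => rfl) (fun w => ?_) u)
      exact (coder_inj b₀ b₁ b₂ n w).symm
    have h₁ : head₁ b₁ (n + 1) u =
        cons X (b₁.tens (GrHom.id X.T) ((GrHom.id X).tens (inj X n) u)) := by
      change injS X n (b₁.tens (GrHom.id (X.tpow n)) u) = _
      rw [← cons_id_tens_inj, id_tens_tens, tens_id_id_tens]
      exact congrArg _ (tens_congr rfl (zero_add _) (fun _ => rfl) (fun _ => rfl) _)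
    have h₂ : head₂ b₂ (n + 1) u = cons X (b₂.tens (GrHom.id X.T) (GrHom.assocInv X X X.T
        ((GrHom.id X).tens (uncons X) ((GrHom.id X).tens (inj X n) u)))) := by
      rw [id_tens_tens]
      -- A word of length one has no second letter to split off, so both sides vanish there.
      rcases n with _ | n
      · have h : (GrHom.id X).tens ((inj X 0).comp (uncons X)) u = 0 :=
          (tens_congr (g' := (0 : GrHom (0 + 0) _ _)) rfl rfl (fun _ => rfl)
            (fun w => (congrArg (uncons X) (inj_zero_apply (𝕜 := 𝕜) (X := X) w)).trans
              ((GrHom.map_smul _ _ _).trans ((congrArg _ uncons_tone).trans (smul_zero _)))) u).trans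
            (tens_zero_right _ u)
        rw [h, GrHom.map_zero, GrHom.map_zero, GrHom.map_zero]
        rfl
      · exact (head₂_succ b₂ n u).trans (congrArg (fun t => cons X (b₂.tens (GrHom.id X.T)
          (GrHom.assocInv X X X.T t))) (tens_congr (f := GrHom.id X)
            (g := (GrHom.id X).tens (inj X n)) rfl (by norm_num) (fun _ => rfl)
            (fun w => (uncons_injS n w).symm) u))
    have h₀ : head₀ b₀ (n + 1) u =
        cons X (b₀.tens (GrHom.id X.T) (GrHom.lunitInv X.T (injS X n u))) :=
      head₀_apply b₀ (n + 1) u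
    rw [coder_injS, hr, h₁, h₂, h₀]

/-- The terms with r = 0 arise by cutting the word and applying the component β = (b₀, b₁, b₂) to
the left part; b₀, b₁, b₂ see the prefixes of length 0, 1, 2. -/
theorem cv_ofLow_id (z : X.T) : cv (comul X) (ofLow b₀ b₁ b₂) (GrHom.id X.T) z =
    b₀.tens (GrHom.id X.T) (GrHom.lunitInv X.T z) + b₁.tens (GrHom.id X.T) (uncons X z) +
      b₂.tens (GrHom.id X.T)
        (GrHom.assocInv X X X.T ((GrHom.id X).tens (uncons X) (uncons X z))) := by
  have h : (GrHom.id X).tens (uncons X) (uncons X z) =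
      cv (comul X) (p₁ X) (cv (comul X) (p₁ X) (GrHom.id X.T)) z := by
    rw [uncons_eq_cv, id_tens_cv]
    exact cv_congr rfl (zero_add _) (fun _ => rfl) uncons_eq_cv z
  have h₀ : cv (comul X) ((proj₀ X).comp b₀) (GrHom.id X.T) z =
      cv (comul X) (((proj₀ X).comp b₀).cast (zero_add 1)) (GrHom.id X.T) z :=
    (cv_cast_left _ _ _ _).symm
  have h₁ : cv (comul X) ((p₁ X).comp b₁) (GrHom.id X.T) z =
      cv (comul X) (((p₁ X).comp b₁).cast (zero_add 1)) (GrHom.id X.T) z :=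
    (cv_cast_left _ _ _ _).symm
  rw [h, ← assoc_cv comul_coassoc, assocInv_assoc, lunitInv_eq_cv, uncons_eq_cv, tens_id_cv,
    tens_id_cv, tens_id_cv, zero_mul, koszulSign_zero, one_smul, one_smul, one_smul,
    cv_congr (f := (cv (comul X) (p₁ X) (p₁ X)).comp b₂)
      (f' := ((cv (comul X) (p₁ X) (p₁ X)).comp b₂).cast (by norm_num : (0 : ℤ) + 0 + 1 = 1))
      (by norm_num) rfl (fun _ => rfl) (fun _ => rfl), h₀, h₁, ← cv_add_left, ← cv_add_left]
  refine cv_congr rfl rfl (fun z => ?_) (fun _ => rfl) z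
  rw [ofLow_apply, id_tens_p₁_uncons]; rfl

/-- The recursion of a coderivation of the tensor coalgebra with component `β`. -/
theorem coder_recursion (z : X.T) : coder b₀ b₁ b₂ z =
    cons X ((GrHom.id X).tens (coder b₀ b₁ b₂) (uncons X z)) +
      cons X (cv (comul X) (ofLow b₀ b₁ b₂) (GrHom.id X.T) z) := by
  rw [coder_eq, cv_ofLow_id, GrHom.map_add, GrHom.map_add]

end Coder

/-- `D` is the sum of a part keeping the first letter and of `H`, which replaces a prefix by the
letter β of it. Coassociativity handles `H`; the part keeping the first letter is handled by
induction on words. -/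
theorem coleibniz_of_recursion {D : GrHom 1 X.T X.T} {β : GrHom 1 X.T X}
    (hD : ∀ z, D z = cons X ((GrHom.id X).tens D (uncons X z)) +
      cons X (cv (comul X) β (GrHom.id X.T) z)) (z : X.T) :
    comul X (D z) = (GrHom.id X.T).tens D (comul X z) + D.tens (GrHom.id X.T) (comul X z) := by
  let H : GrHom 1 X.T X.T := ((cv (comul X) β (GrHom.id X.T)).comp (cons X)).cast (by norm_num)
  have hH : ∀ z, H z = cons X (cv (comul X) β (GrHom.id X.T) z) := fun _ => rfl
  have hone : D (tone X) = H (tone X) := by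
    rw [hD, uncons_tone, GrHom.map_zero, GrHom.map_zero, zero_add]; rfl
  have hDc : ∀ x w, D (cons X (tmk x w)) = cons X (tmk x (D w)) + H (cons X (tmk x w)) := by
    intro x w
    rw [hD, uncons_cons, tens_tmk_of_deg_zero]; rfl
  have hcons : ∀ u : X.tensor X.T, comul X (cons X u) = tmk (tone X) (cons X u) +
      consT X X.T ((GrHom.id X).tens (comul X) u) := by
    refine tensor_ind ?_ ?_ ?_
    · simp only [GrHom.map_zero, tmk_zero, add_zero]
    · intro i j x w _ _
      rw [comul_cons, tens_tmk_of_deg_zero]; rfl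
    · intro a b ha hb
      simp only [GrHom.map_add, tmk_add, ha, hb]; abel
  -- A cut of `H y` either precedes the new first letter or follows it; in the second case `H` has
  -- acted on the left part alone.
  have hHc : ∀ y, comul X (H y) = tmk (tone X) (H y) + H.tens (GrHom.id X.T) (comul X y) := by
    intro y
    have h1 : cv (comul X) β ((GrHom.id X.T).comp (comul X)) y =
        GrHom.assoc _ _ _ (cv (comul X) (cv (comul X) β (GrHom.id X.T)) (GrHom.id X.T) y) := by
      rw [assoc_cv comul_coassoc]
      exact cv_congr rfl (by norm_num) (fun _ => rfl) (fun z => (tens_id _).symm) y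
    rw [hH, hcons, id_tens_cv, h1, consT_apply, assocInv_assoc, tens_id_cv, zero_mul,
      koszulSign_zero, one_smul, ← cv_apply]
    exact congrArg _ (cv_congr (by norm_num) rfl (fun _ => rfl) (fun _ => rfl) y)
  refine T_ext (f := D.comp (comul X)) (g := ((comul X).comp ((GrHom.id X.T).tens D)).cast
    (by norm_num : (0 : ℤ) + (0 + 1) = 1) +
    ((comul X).comp (D.tens (GrHom.id X.T))).cast (by norm_num)) ?_ ?_ z
  · simp only [GrHom.add_apply, GrHom.cast_apply, GrHom.comp_apply]
    rw [hone, hHc, comul_tone, tens_tmk_of_deg_zero, tens_tmk _ _ _ (tone_mem X),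
      tens_tmk _ _ _ (tone_mem X), hone]; rfl
  · intro i j x w hx hw ih
    simp only [GrHom.add_apply, GrHom.cast_apply, GrHom.comp_apply] at ih ⊢
    have h3 : ∀ u : X.T.tensor X.T, D.tens (GrHom.id X.T) (consT X X.T (tmk x u)) =
        consT X X.T (tmk x (D.tens (GrHom.id X.T) u)) +
          H.tens (GrHom.id X.T) (consT X X.T (tmk x u)) := by
      refine tensor_ind ?_ ?_ ?_
      · simp only [GrHom.map_zero, tmk_zero, add_zero]
      · intro i j a b ha hb
        rw [consT_tmk, tens_tmk _ _ _ hb, tens_tmk _ _ _ hb, tens_tmk _ _ _ hb, hDc, add_tmk,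
          tmk_zsmul, GrHom.map_zsmul, consT_tmk, smul_add]
      · intro a b ha hb
        simp only [GrHom.map_add, tmk_add, ha, hb]; abel
    have h4 : ∀ y, y ∈ X.T.deg (i + j) → D.tens (GrHom.id X.T) (tmk (tone X) y) =
        H.tens (GrHom.id X.T) (tmk (tone X) y) := by
      intro y hy
      rw [tens_tmk _ _ _ hy, tens_tmk _ _ _ hy, hone]
    rw [hDc, GrHom.map_add, hHc, comul_cons, comul_cons, ih]
    simp only [GrHom.map_add, tmk_add]
    rw [tens_tmk_of_deg_zero, tens_consT, h3, h4 _ ((cons X).map_deg_zero (tmk_mem hx hw)), hDc,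
      tmk_add]
    change _ = tmk (tone X) _ + tmk (tone X) _ + _ + _
    abel

theorem coder_coleibniz (b₀ : GrHom 1 (GrMod.unit 𝒦) X) (b₁ : GrHom 1 X X)
    (b₂ : GrHom 1 (X.tensor X) X) (z : X.T) :
    comul X (coder b₀ b₁ b₂ z) = (GrHom.id X.T).tens (coder b₀ b₁ b₂) (comul X z) +
      (coder b₀ b₁ b₂).tens (GrHom.id X.T) (comul X z) :=
  coleibniz_of_recursion (coder_recursion b₀ b₁ b₂) z

theorem proj₀_coder (b₀ : GrHom 1 (GrMod.unit 𝒦) X) (b₁ : GrHom 1 X X)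
    (b₂ : GrHom 1 (X.tensor X) X) (z : X.T) : proj₀ X (coder b₀ b₁ b₂ z) = 0 := by
  rw [coder_recursion, ← GrHom.map_add, proj₀_cons]

/-- The recursive summand keeps a letter in front of a value of the coderivation, which has no
component in 𝕜, so it does not meet the generators. In the other summand the counit reduces β ⋆ 1 to
β. -/
theorem p₁_coder (b₀ : GrHom 1 (GrMod.unit 𝒦) X) (b₁ : GrHom 1 X X)
    (b₂ : GrHom 1 (X.tensor X) X) (z : X.T) :
    p₁ X (coder b₀ b₁ b₂ z) = ofLow b₀ b₁ b₂ z := by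
  have h1 : cv (comul X) (ofLow b₀ b₁ b₂) ((GrHom.id X.T).comp (proj₀ X)) z =
      cv (comul X) ((GrHom.id X.T).comp (ofLow b₀ b₁ b₂)) (proj₀ X) z :=
    cv_congr (by norm_num) (by norm_num) (fun _ => rfl) (fun _ => rfl) z
  have h2 : ofLow b₀ b₁ b₂ z = ofLow b₀ b₁ b₂ (sr (comul X) (GrHom.id X.T) (proj₀ X) z) :=
    congrArg _ (comul_counit_right z).symm
  rw [coder_recursion, ← GrHom.map_add, p₁_cons, GrHom.map_add, id_tens_tens,
    tens_congr (g := (coder b₀ b₁ b₂).comp (proj₀ X)) (g' := (0 : GrHom (1 + 0) _ _)) rfl rfl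
      (fun _ => rfl) (proj₀_coder b₀ b₁ b₂), id_tens_cv, h1, h2, map_sr, zero_mul, koszulSign_zero, one_smul,
    sr_apply]
  rw [tens_zero_right, zero_add]

end TensorConstr

end TensorCoalgebraStructure

/-! ### Conilpotent induction. -/

section Conilpotency

variable {𝕜 : Type u} [Ring 𝕜] {𝒦 : ℤ → AddSubgroup 𝕜} [GradedRing 𝒦]
  [IsGradedStronglyCommutative 𝒦]

open GrHom

/-- The iterated reduced convolution power of `pr : C → I`. -/
noncomputable def cvIter {C I : GrMod 𝒦} (δ : GrHom 0 C (C.tensor C)) (pr : GrHom 0 C I) :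
    (n : ℕ) → GrHom 0 C (I.tpow (n + 1))
  | 0 => (pr.comp (TensorConstr.toPowOne I)).cast (by norm_num)
  | n + 1 => (cv δ pr (cvIter δ pr n)).cast (by norm_num)

/-- The counit is neutral for convolution, so convolving with the constant ε·m amounts to tensoring
with m; there is no sign because |m| = 0. -/
theorem cv_ofElem_left {C M N : GrMod 𝒦} {δ : GrHom 0 C (C.tensor C)}
    {ε : GrHom 0 C (GrMod.unit 𝒦)}
    (hε : ∀ x, GrHom.lunit C (ε.tens (GrHom.id C) (δ x)) = x) {m : M} (hm : m ∈ M.deg 0) {d : ℤ}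
    (f : GrHom d C N) (c : C) : cv δ (ε.comp (ofElem hm)) f c = tmk m (f c) := by
  have h : ∀ u : (GrMod.unit 𝒦).tensor N,
      (ofElem hm).tens (GrHom.id N) u = tmk m (lunit N u) := by
    refine tensor_ind ?_ ?_ ?_
    · simp only [GrHom.map_zero, tmk_zero]
    · intro i j a x ha _
      rw [tens_tmk_of_deg_zero, lunit_tmk, tmk_smul _ ha hm, mul_zero, koszulSign_zero, one_smul,
        ofElem_apply, smul_tmk]; rfl
    · intro a b ha hb
      simp only [GrHom.map_add, tmk_add, ha, hb]
  have h1 : lunit N (cv δ ε f c) = f c := by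
    rw [← sl_apply]
    have := map_sl (δ := δ) ε (GrHom.id C) f c
    rw [sl_apply, cv_apply, hε] at this
    rw [this]
    exact congrArg (lunit N) (cv_congr rfl (by simp) (fun _ => rfl) (fun _ => rfl) c)
  have h2 := tens_id_cv (δ := δ) ε f (ofElem hm) c
  rw [mul_zero, koszulSign_zero, one_smul] at h2
  rw [← h2, h, h1]

namespace CoalgData

variable (C : CoalgData 𝒦)

theorem pr_w : C.pr C.w = 0 := by
  refine Subtype.ext ?_
  change C.w - (C.ε C.w : 𝕜) • C.w = 0
  rw [C.ε_w, one_smul, sub_self]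

theorem incl_pr (x : C.C) : C.incl (C.pr x) = x - (C.ε x : 𝕜) • C.w := rfl

theorem pr_incl (x : C.bar) : C.pr (C.incl x) = x := by
  refine Subtype.ext ?_
  change C.incl x - (C.ε (C.incl x) : 𝕜) • C.w = C.incl x
  have h : C.ε (C.incl x) = (0 : 𝕜) := x.2
  rw [h, zero_smul, sub_zero]

variable {C}

theorem map_incl_pr {M : GrMod 𝒦} {d : ℤ} (f : GrHom d C.C M) (hf : f C.w = 0) (x : C.C) :
    f (C.incl (C.pr x)) = f x := by
  rw [incl_pr, GrHom.map_sub, GrHom.map_smul, hf, smul_zero, sub_zero]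

theorem cv_w (hw : C.δ₂ C.w = tmk C.w C.w) {M N : GrMod 𝒦} {d e : ℤ} (f : GrHom d C.C M)
    (g : GrHom e C.C N) : cv C.δ₂ f g C.w = tmk (f C.w) (g C.w) := by
  rw [cv_apply, hw, tens_tmk _ _ _ C.w_mem, mul_zero, koszulSign_zero, one_smul]

/-- Moves the reduced iterates from C̄ to C, where they are convolution powers of `pr` and the
calculus of `cv` applies. The passage back is possible because these powers do not see `w`. -/
theorem redIter_pr (hw : C.δ₂ C.w = tmk C.w C.w) (n : ℕ) (x : C.C) :
    C.redIter n (C.pr x) = cvIter C.δ₂ C.pr n x := by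
  induction n generalizing x with
  | zero => rfl
  | succ n ih =>
    change (GrHom.id C.bar).tens (C.redIter n) ((C.pr).tens C.pr (C.δ₂ (C.incl (C.pr x)))) =
      cv C.δ₂ C.pr (cvIter C.δ₂ C.pr n) x
    have h : cv C.δ₂ C.pr C.pr (C.incl (C.pr x)) = cv C.δ₂ C.pr C.pr x :=
      map_incl_pr _ (by rw [cv_w hw, pr_w, zero_tmk]) x
    rw [← cv_apply, h, id_tens_cv]
    exact cv_congr rfl (by norm_num) (fun _ => rfl) ih x

namespace IsCurvedAugmented

/-- A recursively defined sequence of maps vanishes where the iterated reduced comultiplication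
does. -/
theorem eq_zero_of_cvIter {d : ℤ} {N : GrMod 𝒦} {M : ℕ → GrMod 𝒦} (F : (n : ℕ) → GrHom d C.C (M n))
    (hw : ∀ n, F n C.w = 0) (γ : GrHom 0 C.C N) (hγ : γ C.w = 0)
    (L : (n : ℕ) → GrHom 0 (N.tensor (M n)) (M (n + 1)))
    (hF : ∀ n c, F (n + 1) c = L n (cv C.δ₂ γ (F n) c)) (n : ℕ) {c : C.C}
    (hc : cvIter C.δ₂ C.pr n c = 0) : F n c = 0 := by
  -- `F n` factors through the iterate `cvIter` of the same index: `F 0` and `γ` kill `w`, hence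
  -- factor through `pr`, and the recursion for `F` matches that of the iterates.
  have key : ∀ n, ∃ K : GrHom d (C.bar.tpow (n + 1)) (M n),
      ∀ c, F n c = K (cvIter C.δ₂ C.pr n c) := by
    intro n
    induction n with
    | zero =>
      refine ⟨((GrHom.runit C.bar).comp (C.incl.comp (F 0))).cast (by ring), fun c => ?_⟩
      rw [← map_incl_pr _ (hw 0)]
      exact congrArg (fun t => F 0 (C.incl t)) (rsmul_one (C.pr c)).symm
    | succ n ih =>
      obtain ⟨K, hK⟩ := ih
      refine ⟨(((C.incl.comp γ).tens K).comp (L n)).cast (by ring), fun c => ?_⟩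
      refine (hF n c).trans (congrArg (L n) ?_)
      refine Eq.trans ?_ (tens_cv (δ := C.δ₂) C.pr (cvIter C.δ₂ C.pr n) (C.incl.comp γ) K c).symm
      rw [zero_mul, koszulSign_zero, one_smul]
      exact cv_congr (by norm_num) (zero_add _).symm (fun c => (map_incl_pr γ hγ c).symm) hK c
  obtain ⟨K, hK⟩ := key n
  rw [hK, hc, GrHom.map_zero]

variable (hC : C.IsCurvedAugmented)
include hC

theorem exists_cvIter_eq_zero (x : C.C) : ∃ n, cvIter C.δ₂ C.pr n x = 0 := by
  obtain ⟨n, _, h⟩ := hC.conilpotent (C.pr x)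
  exact ⟨n, by rw [← redIter_pr hC.δ₂_w, h]⟩

theorem cvIter_w (n : ℕ) : cvIter C.δ₂ C.pr n C.w = 0 := by
  cases n with
  | zero => exact (congrArg (TensorConstr.toPowOne C.bar) C.pr_w).trans (GrHom.map_zero _)
  | succ n =>
    refine (cv_w hC.δ₂_w C.pr (cvIter C.δ₂ C.pr n)).trans ?_
    rw [pr_w, zero_tmk]; rfl

theorem cvIter_mono {m n : ℕ} (hmn : m ≤ n) {c : C.C} (hc : cvIter C.δ₂ C.pr m c = 0) :
    cvIter C.δ₂ C.pr n c = 0 := by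
  induction n, hmn using Nat.le_induction with
  | base => exact hc
  | succ n _ ih =>
    -- The sequence of iterates shifted by one obeys the recursion with γ = `pr`, so vanishing of
    -- the n-th iterate forces that of the next.
    exact eq_zero_of_cvIter (M := fun n => C.bar.tpow (n + 2))
      (fun n => cvIter C.δ₂ C.pr (n + 1)) (fun n => hC.cvIter_w (n + 1)) C.pr C.pr_w
      (fun n => GrHom.id (C.bar.tpow (n + 3))) (fun n c => rfl) n ih

/-- The conilpotent induction principle. -/
theorem eq_zero_of_recursion {d : ℤ} {M N : GrMod 𝒦} {E : GrHom d C.C M} (hw : E C.w = 0)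
    {γ : GrHom 0 C.C N} (hγ : γ C.w = 0) (L : GrHom 0 (N.tensor M) M)
    (hE : ∀ c, E c = L (cv C.δ₂ γ E c)) (c : C.C) : E c = 0 := by
  obtain ⟨n, hn⟩ := hC.exists_cvIter_eq_zero c
  -- A fixed point of the recursion is a constant sequence `F`.
  exact eq_zero_of_cvIter (M := fun _ => M) (fun _ => E) (fun _ => hw) γ hγ (fun _ => L)
    (fun _ => hE) n hn

end IsCurvedAugmented

end CoalgData

/-! ### Conilpotency and cofreeness of the tensor coalgebra. -/

namespace TensorConstr

variable {X M : GrMod 𝒦}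

theorem map_inj_zero {d : ℤ} (f : GrHom d X.T M) (h : f (tone X) = 0) (w : X.tpow 0) :
    f (inj X 0 w) = 0 := by
  refine (congrArg f (inj_zero_apply (𝕜 := 𝕜) (X := X) w)).trans ?_
  exact (f.toLin.map_smul (show 𝕜 from w) _).trans (by rw [h, smul_zero])

theorem tmk_tone_smul (r : 𝕜) (z : X.T) : tmk (tone X) (r • z) = r • tmk (tone X) z := by
  rw [← oneTensor_apply, GrHom.map_smul, oneTensor_apply]

/-- The right part of any cut of a word of length `m` has length at most `m`. -/
theorem id_tens_comul_inj {R : GrHom 0 X.T M} {m : ℕ}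
    (hR : ∀ k ≤ m, ∀ w, R (inj X k w) = 0) (w : X.tpow m) :
    (GrHom.id X.T).tens R (comul X (inj X m w)) = 0 := by
  induction m with
  | zero =>
    have h : R (tone X) = 0 := hR 0 le_rfl _
    refine map_inj_zero ((comul X).comp ((GrHom.id X.T).tens R)) ?_ w
    rw [GrHom.comp_apply, comul_tone, tens_tmk_of_deg_zero, h, tmk_zero]
  | succ m ih =>
    refine tensor_ind (p := fun u => (GrHom.id X.T).tens R (comul X (injS X m u)) = 0) ?_ ?_ ?_ w
    · simp only [GrHom.map_zero]
    · intro i j x v _ _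
      have h : R (injS X m (tmk x v)) = 0 := hR (m + 1) le_rfl _
      rw [← cons_tmk_inj, comul_cons, GrHom.map_add, tens_consT,
        ih (fun k hk => hR k (by omega)), tmk_zero, GrHom.map_zero, tens_tmk_of_deg_zero,
        cons_tmk_inj, h, tmk_zero, add_zero]
    · intro a b ha hb
      simp only [GrHom.map_add, ha, hb, add_zero]

/-- A word of length `m` cannot be cut into n + 1 > m nonempty pieces, and `pr` discards empty
pieces. -/
theorem cvIter_comul_inj {I : GrMod 𝒦} {pr : GrHom 0 X.T I} (hpr : pr (tone X) = 0) {m n : ℕ}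
    (hmn : m ≤ n) (w : X.tpow m) : cvIter (comul X) pr n (inj X m w) = 0 := by
  induction n generalizing m with
  | zero =>
    obtain rfl : m = 0 := by omega
    exact map_inj_zero _ ((congrArg (toPowOne I) hpr).trans (GrHom.map_zero _)) w
  | succ n ih =>
    change cv (comul X) pr (cvIter (comul X) pr n) (inj X m w) = 0
    have hpr' : ∀ y, pr.tens (cvIter (comul X) pr n) (tmk (tone X) y) = 0 := fun y => by
      rw [tens_tmk_of_deg_zero, hpr, zero_tmk]
    rcases m with _ | m
    · refine map_inj_zero _ ?_ w
      rw [cv_apply, comul_tone, hpr']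
    · refine tensor_ind (p := fun u => cv (comul X) pr (cvIter (comul X) pr n) (injS X m u) = 0)
        ?_ ?_ ?_ w
      · simp only [GrHom.map_zero]
      · intro i j x v _ _
        have h : ∀ u : X.T.tensor X.T, pr.tens (cvIter (comul X) pr n) u =
            pr.tens (GrHom.id _) ((GrHom.id X.T).tens (cvIter (comul X) pr n) u) :=
          fun u => (tens_id_id_tens _ _ _).symm
        rw [← cons_tmk_inj, cv_apply, comul_cons, GrHom.map_add, hpr', zero_add, h, tens_consT,
          id_tens_comul_inj (fun k hk w => ih (by omega) w), tmk_zero, GrHom.map_zero,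
          GrHom.map_zero]
      · intro a b ha hb
        simp only [GrHom.map_add, ha, hb, add_zero]

/-- Vanishing is required for all indices from N on, so that the bounds for two summands combine to
their maximum. -/
theorem exists_cvIter_comul_eq_zero {I : GrMod 𝒦} {pr : GrHom 0 X.T I} (hpr : pr (tone X) = 0)
    (z : X.T) : ∃ N, ∀ n, N ≤ n → cvIter (comul X) pr n z = 0 := by
  refine inj_ind (p := fun z => ∃ N, ∀ n, N ≤ n → cvIter (comul X) pr n z = 0) ?_ ?_ z
  · intro m w
    exact ⟨m, fun n hn => cvIter_comul_inj hpr hn w⟩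
  · rintro a b ⟨N, hN⟩ ⟨K, hK⟩
    refine ⟨max N K, fun n hn => ?_⟩
    rw [GrHom.map_add, hN n (le_trans (le_max_left _ _) hn), hK n (le_trans (le_max_right _ _) hn),
      add_zero]

theorem comul_cons_eq (u : X.tensor X.T) : comul X (cons X u) = tmk (tone X) (cons X u) +
      consT X X.T ((GrHom.id X).tens (comul X) u) := by
  refine tensor_ind (p := fun u => comul X (cons X u) = tmk (tone X) (cons X u) +
      consT X X.T ((GrHom.id X).tens (comul X) u)) ?_ ?_ ?_ u
  · simp only [GrHom.map_zero, tmk_zero, add_zero]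
  · intro i j x w _ _
    rw [comul_cons, tens_tmk_of_deg_zero]; rfl
  · intro a b ha hb
    simp only [GrHom.map_add, tmk_add, ha, hb]; abel

section Comap

variable {C : CoalgData 𝒦}

/-- A coalgebra map to the tensor coalgebra is determined recursively by its component on the
generators. -/
theorem coalgHom_recursion {G : GrHom 0 C.C X.T}
    (hG : ∀ c, G.tens G (C.δ₂ c) = comul X (G c)) (hε : ∀ c, proj₀ X (G c) = C.ε c)
    {γ : GrHom 0 C.C X} (hγ : ∀ c, p₁ X (G c) = γ c) (c : C.C) :
    G c = (C.ε c : 𝕜) • tone X + cons X (cv C.δ₂ γ G c) := by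
  have h1 : uncons X (G c) = cv C.δ₂ γ G c := by
    rw [uncons_eq_cv, cv_map hG]
    exact cv_congr (by norm_num) (by norm_num) hγ (fun _ => rfl) c
  rw [← h1, ← hε]
  exact eq_tone_add_cons (G c)

variable (hC : C.IsCurvedAugmented)
include hC

theorem map_w_of_recursion {G : GrHom 0 C.C X.T} {γ : GrHom 0 C.C X} (hw : γ C.w = 0)
    (hG : ∀ c, G c = (C.ε c : 𝕜) • tone X + cons X (cv C.δ₂ γ G c)) : G C.w = tone X := by
  rw [hG, CoalgData.cv_w hC.δ₂_w, hw, zero_tmk, GrHom.map_zero, add_zero, C.ε_w, one_smul]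

/-- The uniqueness half of cofreeness: two solutions with the same component differ by a solution of
the homogeneous recursion E = cons (γ ⋆ E), and conilpotency leaves only zero. -/
theorem eq_of_recursion {G G' : GrHom 0 C.C X.T} {γ : GrHom 0 C.C X} (hw : γ C.w = 0)
    (hG : ∀ c, G c = (C.ε c : 𝕜) • tone X + cons X (cv C.δ₂ γ G c))
    (hG' : ∀ c, G' c = (C.ε c : 𝕜) • tone X + cons X (cv C.δ₂ γ G' c)) (c : C.C) :
    G c = G' c := by
  have h := hC.eq_zero_of_recursion (E := G - G')
    (by rw [GrHom.sub_apply, map_w_of_recursion hC hw hG, map_w_of_recursion hC hw hG', sub_self])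
    hw (cons X) (fun c => by
      rw [GrHom.sub_apply, cv_sub_right, GrHom.map_sub]
      nth_rw 1 [hG, hG']
      abel) c
  exact sub_eq_zero.1 h

/-- The defect G ⋆ G − ΔG solves a homogeneous recursion: in both terms the contribution of the cut
before the first letter is 1 ⊗ G, and it cancels. -/
theorem comul_of_recursion {G : GrHom 0 C.C X.T} {γ : GrHom 0 C.C X} (hw : γ C.w = 0)
    (hG : ∀ c, G c = (C.ε c : 𝕜) • tone X + cons X (cv C.δ₂ γ G c)) (c : C.C) :
    G.tens G (C.δ₂ c) = comul X (G c) := by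
  have hGw := map_w_of_recursion hC hw hG
  have h := hC.eq_zero_of_recursion
    (E := (cv C.δ₂ G G).cast (add_zero 0) - (G.comp (comul X)).cast (add_zero 0)) (γ := γ)
    (by
      rw [GrHom.sub_apply, GrHom.cast_apply, GrHom.cast_apply, GrHom.comp_apply,
        CoalgData.cv_w hC.δ₂_w, hGw, comul_tone, sub_self])
    hw (consT X X.T) (fun c => ?_) c
  · exact sub_eq_zero.1 h
  · have h1 : cv C.δ₂ G G c = tmk (tone X) (G c) + consT X X.T (cv C.δ₂ γ (cv C.δ₂ G G) c) := by
      have e1 : cv C.δ₂ G G c = cv C.δ₂ ((C.ε.comp (ofElem (tone_mem X))).cast (add_zero 0) +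
          ((cv C.δ₂ γ G).comp (cons X)).cast (by norm_num)) G c :=
        cv_congr rfl rfl hG (fun _ => rfl) c
      rw [e1, cv_add_left, cv_cast_left, cv_cast_left, cv_ofElem_left hC.counit_left, consT_apply,
        ← assoc_cv hC.coassoc, assocInv_assoc, tens_id_cv, zero_mul, koszulSign_zero, one_smul]
    have h2 : comul X (G c) = tmk (tone X) (G c) +
        consT X X.T (cv C.δ₂ γ (G.comp (comul X)) c) := by
      rw [hG c, GrHom.map_add, GrHom.map_smul, comul_tone, comul_cons_eq, id_tens_cv, tmk_add,
        add_assoc]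
      refine congrArg (· + _) ?_
      exact (tmk_tone_smul (C.ε c : 𝕜) (tone X)).symm
    rw [GrHom.sub_apply, GrHom.cast_apply, GrHom.cast_apply, GrHom.comp_apply, cv_sub_right,
      cv_cast_right, cv_cast_right, h1, h2, GrHom.map_sub]
    abel

end Comap

/-! ### Existence of the coalgebra map with a prescribed component on generators. -/

section CompPow

variable {C : CoalgData 𝒦}

/-- The components of the coalgebra map to the tensor coalgebra with component `γ` on the
generators. -/
noncomputable def compPow (γ : GrHom 0 C.C X) : (n : ℕ) → GrHom 0 C.C (X.tpow n)
  | 0 => C.ε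
  | n + 1 => (cv C.δ₂ γ (compPow γ n)).cast (add_zero 0)

variable (hC : C.IsCurvedAugmented) {γ : GrHom 0 C.C X} (hγ : γ C.w = 0)
include hC hγ

theorem compPow_succ_w (n : ℕ) : compPow γ (n + 1) C.w = 0 := by
  refine (CoalgData.cv_w hC.δ₂_w γ (compPow γ n)).trans ?_
  rw [hγ, zero_tmk]; rfl

/-- The components γ^{⊗n} of the iterated coproduct of `c` define an element of the direct product;
conilpotency makes all but finitely many vanish, so that it lies in the direct sum. -/
theorem exists_projT_eq_compPow (c : C.C) : ∃ z : X.T, ∀ n, projT X n z = compPow γ n c := by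
  classical
  obtain ⟨N, hN⟩ := hC.exists_cvIter_eq_zero c
  have h : ∀ n, N ≤ n → compPow γ (n + 1) c = 0 := fun n hn =>
    CoalgData.IsCurvedAugmented.eq_zero_of_cvIter (M := fun n => X.tpow (n + 1))
      (fun n => compPow γ (n + 1)) (compPow_succ_w hC hγ) γ hγ (fun n => GrHom.id (X.tpow (n + 2)))
      (fun n c => rfl) n (hC.cvIter_mono hn hN)
  -- The component of index `n + 1` vanishes for n ≥ N, so the indices 0, …, N suffice.
  refine ⟨∑ n ∈ Finset.range (N + 1), inj X n (compPow γ n c), fun n => ?_⟩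
  rw [_root_.map_sum]
  by_cases hn : n ≤ N
  · rw [Finset.sum_eq_single_of_mem n (Finset.mem_range.2 (by omega))
      (fun m _ hm => projT_inj_ne (Ne.symm hm) _)]
    exact projT_inj_same _ _
  · obtain ⟨k, rfl⟩ : ∃ k, n = k + 1 := ⟨n - 1, by omega⟩
    rw [h k (by omega)]
    refine Finset.sum_eq_zero fun m hm => projT_inj_ne ?_ _
    have := Finset.mem_range.1 hm
    omega

/-- The coalgebra map to the tensor coalgebra with component `γ` on the generators. -/
noncomputable def comap : GrHom 0 C.C X.T where
  toLin :=
    -- The choice is harmless: an element is determined by its components, which depend linearly on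
    -- `c`.
    { toFun := fun c => (exists_projT_eq_compPow hC hγ c).choose
      map_add' := fun a b => projT_ext fun n => by
        rw [GrHom.map_add, (exists_projT_eq_compPow hC hγ (a + b)).choose_spec,
          (exists_projT_eq_compPow hC hγ a).choose_spec,
          (exists_projT_eq_compPow hC hγ b).choose_spec, GrHom.map_add]
      map_smul' := fun r a => projT_ext fun n => by
        rw [RingHom.id_apply, GrHom.map_smul, (exists_projT_eq_compPow hC hγ (r • a)).choose_spec,
          (exists_projT_eq_compPow hC hγ a).choose_spec, GrHom.map_smul] }
  map_deg {i c} hc n := by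
    have h : projT X n (exists_projT_eq_compPow hC hγ c).choose ∈ (X.tpow n).deg (i + 0) := by
      rw [(exists_projT_eq_compPow hC hγ c).choose_spec]
      exact (compPow γ n).map_deg hc
    exact h

theorem projT_comap (n : ℕ) (c : C.C) : projT X n (comap hC hγ c) = compPow γ n c :=
  (exists_projT_eq_compPow hC hγ c).choose_spec n

theorem comap_recursion (c : C.C) : comap hC hγ c =
    (C.ε c : 𝕜) • tone X + cons X (cv C.δ₂ γ (comap hC hγ) c) := by
  refine T_ext_components ?_ fun n => ?_
  · rw [GrHom.map_add, GrHom.map_smul, proj₀_cons, add_zero, ← projT_zero, projT_comap]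
    exact (_root_.mul_one (C.ε c : 𝕜)).symm.trans
      (congrArg (fun r : 𝕜 => (C.ε c : 𝕜) * r) (proj₀_tone X).symm)
  · rw [GrHom.map_add, GrHom.map_smul, projS_tone, smul_zero, zero_add, projS_cons, id_tens_cv]
    refine (projT_comap hC hγ (n + 1) c).trans ?_
    exact cv_congr rfl (by norm_num) (fun _ => rfl) (fun c => (projT_comap hC hγ n c).symm) c

theorem proj₀_comap (c : C.C) : proj₀ X (comap hC hγ c) = C.ε c := by
  rw [← projT_zero, projT_comap]; rfl

theorem p₁_comap (c : C.C) : p₁ X (comap hC hγ c) = γ c := by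
  rw [comap_recursion, GrHom.map_add, GrHom.map_smul, p₁_tone, smul_zero, zero_add, p₁_cons,
    id_tens_cv]
  have h := map_sr (δ := C.δ₂) (GrHom.id C.C) C.ε γ c
  rw [sr_apply, cv_apply, hC.counit_right] at h
  rw [h, zero_mul, koszulSign_zero, one_smul, sr_apply]
  exact congrArg (runit X) (cv_congr (by norm_num) (by norm_num) (fun _ => rfl)
    (fun c => proj₀_comap hC hγ c) c)

theorem comap_w : comap hC hγ C.w = tone X := map_w_of_recursion hC hγ (comap_recursion hC hγ)

theorem comul_comap (c : C.C) :
    (comap hC hγ).tens (comap hC hγ) (C.δ₂ c) = comul X (comap hC hγ c) :=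
  comul_of_recursion hC hγ (comap_recursion hC hγ) c

end CompPow

end TensorConstr

end Conilpotency

/-! ### Twisting cochains and the Maurer-Cartan equation. -/

section Twisting

variable {𝕜 : Type u} [Ring 𝕜] {𝒦 : ℤ → AddSubgroup 𝕜} [GradedRing 𝒦]
  [IsGradedStronglyCommutative 𝒦]

open GrHom

namespace GrHom

variable {M N : GrMod 𝒦} {d e : ℤ}

theorem id_tens_ofElem {m : N} (hm : m ∈ N.deg d) (u : M.tensor (GrMod.unit 𝒦)) :
    (GrHom.id M).tens (ofElem hm) u = tmk (runit M u) m := by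
  refine tensor_ind (p := fun u => (GrHom.id M).tens (ofElem hm) u = tmk (runit M u) m) ?_ ?_ ?_ u
  · simp only [GrHom.map_zero, zero_tmk]
  · intro i j x c _ _
    rw [tens_tmk_of_deg_zero]
    exact (tmk_rsmul x m (c : 𝕜)).symm
  · intro a b ha hb
    simp only [GrHom.map_add, add_tmk, ha, hb]

/-- Two signs appear, from the map of degree d passing x and from the scalar passing m. Both are
trivial for even d, which covers the unit and the curvature element. -/
theorem ofElem_tens_id {m : N} (hd : Even d) (hm : m ∈ N.deg d) (u : (GrMod.unit 𝒦).tensor M) :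
    (ofElem hm).tens (GrHom.id M) u = tmk m (lunit M u) := by
  refine tensor_ind (p := fun u => (ofElem hm).tens (GrHom.id M) u = tmk m (lunit M u)) ?_ ?_ ?_ u
  · simp only [GrHom.map_zero, tmk_zero]
  · intro i j c x hc hx
    rw [tens_tmk _ _ _ hx, lunit_tmk, tmk_smul _ hc hm, koszulSign_even (hd.mul_right j),
      koszulSign_even (hd.mul_left i), one_smul, one_smul, ofElem_apply, smul_tmk]; rfl
  · intro a b ha hb
    simp only [GrHom.map_add, tmk_add, ha, hb]

theorem rsmul_rsmul (M : GrMod 𝒦) {i : ℤ} {a b : 𝕜} (ha : a ∈ 𝒦 i) (hb : b ∈ 𝒦 d) (x : M) :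
    rsmul M b (rsmul M a x) = rsmul M (a * b) x := by
  refine M.induction (p := fun x => rsmul M b (rsmul M a x) = rsmul M (a * b) x) ?_ ?_ ?_ x
  · simp only [_root_.map_zero]
  · intro j x hx
    rw [rsmul_apply M hx ha, _root_.map_zsmul, rsmul_apply M (M.smul_mem ha hx) hb,
      rsmul_apply M hx (SetLike.mul_mem_graded ha hb), smul_smul b,
      IsGradedStronglyCommutative.comm (𝒦 := 𝒦) ha hb, smul_assoc, smul_smul, smul_smul]
    congr 1
    rw [← koszulSign_add, ← koszulSign_add, show j * i + (i + j) * d + i * d =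
      (j * (i + d)) + 2 * (i * d) by ring, koszulSign_add, koszulSign_even (n := 2 * _) (by simp),
      _root_.mul_one]
  · intro a b ha hb
    simp only [_root_.map_add, ha, hb]

/-- The Koszul sign (-1)^{d|x|} of the tensor product is the sign of the right action of u on x. A
scalar inserted on the left therefore also acts as right multiplication. -/
theorem lunit_ofElem_tens_id {u : 𝕜} (hu : u ∈ (GrMod.unit 𝒦).deg d)
    (z : (GrMod.unit 𝒦).tensor M) :
    lunit M ((ofElem hu).tens (GrHom.id M) z) = rmul M hu (lunit M z) := by
  refine tensor_ind (p := fun z => lunit M ((ofElem hu).tens (GrHom.id M) z) =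
    rmul M hu (lunit M z)) ?_ ?_ ?_ z
  · simp only [GrHom.map_zero]
  · intro i j c x hc hx
    rw [tens_tmk _ _ _ hx, GrHom.map_zsmul, lunit_tmk, lunit_tmk, GrHom.map_smul, rmul_apply,
      rsmul_apply M hx hu, ofElem_apply, smul_comm c, smul_smul, mul_comm d j]; rfl
  · intro a b ha hb
    simp only [GrHom.map_add, ha, hb]

theorem runit_id_tens_ofElem {u : 𝕜} (hu : u ∈ (GrMod.unit 𝒦).deg d)
    (z : M.tensor (GrMod.unit 𝒦)) :
    runit M ((GrHom.id M).tens (ofElem hu) z) = rmul M hu (runit M z) := by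
  refine tensor_ind (p := fun z => runit M ((GrHom.id M).tens (ofElem hu) z) =
    rmul M hu (runit M z)) ?_ ?_ ?_ z
  · simp only [GrHom.map_zero]
  · intro i j x c hx hc
    rw [tens_tmk_of_deg_zero, rmul_apply]
    exact (rsmul_rsmul M hc hu x).symm
  · intro a b ha hb
    simp only [GrHom.map_add, ha, hb]

end GrHom

namespace AlgData

/-- The axioms of a unital algebra with a degree `1` derivation. -/
structure IsAlgebraWithDerivation (A : AlgData 𝒦) : Prop where
  assoc : ∀ x y z : A.A, A.m₂ (tmk x (A.m₂ (tmk y z))) = A.m₂ (tmk (A.m₂ (tmk x y)) z)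
  leibniz : ∀ z : A.A.tensor A.A,
    A.m₁ (A.m₂ z) = A.m₂ ((GrHom.id A.A).tens A.m₁ z) + A.m₂ (A.m₁.tens (GrHom.id A.A) z)
  mul_one : ∀ x : A.A, A.m₂ (tmk x A.one) = x
  one_mul : ∀ x : A.A, A.m₂ (tmk A.one x) = x
  m₁_one : A.m₁ A.one = 0

theorem IsUnitComplementedCurved.isAlgebraWithDerivation {A : AlgData 𝒦}
    (h : A.IsUnitComplementedCurved) : A.IsAlgebraWithDerivation :=
  ⟨h.assoc, h.leibniz, h.mul_one, h.one_mul, h.m₁_one⟩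

/-- The unit `η : 𝕜 → A`. -/
def η (A : AlgData 𝒦) : GrHom 0 (GrMod.unit 𝒦) A.A := ofElem A.one_mem

namespace IsAlgebraWithDerivation

variable {A : AlgData 𝒦} (hA : A.IsAlgebraWithDerivation)
include hA

theorem m₂_assoc (z : (A.A.tensor A.A).tensor A.A) :
    A.m₂ ((GrHom.id A.A).tens A.m₂ (GrHom.assoc A.A A.A A.A z)) =
      A.m₂ (A.m₂.tens (GrHom.id A.A) z) := by
  refine tensor_ext_left (f := ((GrHom.assoc A.A A.A A.A).comp
    ((GrHom.id A.A).tens A.m₂)).comp A.m₂) (g := (A.m₂.tens (GrHom.id A.A)).comp A.m₂) ?_ z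
  intro i j k x y z _ _ _
  rw [GrHom.comp_apply, GrHom.comp_apply, GrHom.comp_apply, assoc_tmk, tens_tmk_of_deg_zero,
    tens_tmk_of_deg_zero]
  exact hA.assoc x y z

theorem m₂_η_tens_id (u : (GrMod.unit 𝒦).tensor A.A) :
    A.m₂ (A.η.tens (GrHom.id A.A) u) = lunit A.A u := by
  rw [η, ofElem_tens_id (by simp), hA.one_mul]

theorem m₂_id_tens_η (u : A.A.tensor (GrMod.unit 𝒦)) :
    A.m₂ ((GrHom.id A.A).tens A.η u) = runit A.A u := by
  rw [η, id_tens_ofElem, hA.mul_one]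

variable {C : GrMod 𝒦} {δ : GrHom 0 C (C.tensor C)} {d e k : ℤ}

theorem m₂_cv_η_left (s : GrHom d C (GrMod.unit 𝒦)) (f : GrHom e C A.A) (c : C) :
    A.m₂ (cv δ (s.comp A.η) f c) = sl δ s f c := by
  have h := tens_id_cv (δ := δ) s f A.η c
  rw [mul_zero, koszulSign_zero, one_smul] at h
  rw [← h, hA.m₂_η_tens_id, sl_apply]

theorem m₂_cv_η_right (f : GrHom e C A.A) (s : GrHom d C (GrMod.unit 𝒦)) (c : C) :
    A.m₂ (cv δ f (s.comp A.η) c) = sr δ f s c := by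
  rw [← id_tens_cv, hA.m₂_id_tens_η, sr_apply]

theorem m₂_cv_assoc
    (hδ : ∀ x, (GrHom.id C).tens δ (δ x) = GrHom.assoc C C C (δ.tens (GrHom.id C) (δ x)))
    (f : GrHom d C A.A) (g : GrHom e C A.A) (h : GrHom k C A.A) (c : C) :
    A.m₂ (cv δ f ((cv δ g h).comp A.m₂) c) = A.m₂ (cv δ ((cv δ f g).comp A.m₂) h c) := by
  rw [← id_tens_cv, ← assoc_cv hδ, hA.m₂_assoc, tens_id_cv, mul_zero, koszulSign_zero, one_smul]

end IsAlgebraWithDerivation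

end AlgData

namespace CoalgData

/-- The axioms of a counital coalgebra with a degree `1` coderivation. -/
structure IsCoalgebraWithCoderivation (C : CoalgData 𝒦) : Prop where
  coassoc : ∀ x : C.C, (GrHom.id C.C).tens C.δ₂ (C.δ₂ x) =
    GrHom.assoc C.C C.C C.C (C.δ₂.tens (GrHom.id C.C) (C.δ₂ x))
  coleibniz : ∀ x : C.C, C.δ₂ (C.δ₁ x) =
    (GrHom.id C.C).tens C.δ₁ (C.δ₂ x) + C.δ₁.tens (GrHom.id C.C) (C.δ₂ x)
  counit_right : ∀ x : C.C, GrHom.runit C.C ((GrHom.id C.C).tens C.ε (C.δ₂ x)) = x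
  counit_left : ∀ x : C.C, GrHom.lunit C.C (C.ε.tens (GrHom.id C.C) (C.δ₂ x)) = x
  ε_δ₁ : ∀ x : C.C, C.ε (C.δ₁ x) = 0

theorem IsCurvedAugmented.isCoalgebraWithCoderivation {C : CoalgData 𝒦}
    (h : C.IsCurvedAugmented) : C.IsCoalgebraWithCoderivation :=
  ⟨h.coassoc, h.coleibniz, h.counit_right, h.counit_left, h.ε_δ₁⟩

namespace IsCoalgebraWithCoderivation

variable {C : CoalgData 𝒦} (hC : C.IsCoalgebraWithCoderivation) {M N : GrMod 𝒦} {d e : ℤ}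
include hC

theorem sl_ε (f : GrHom d C.C M) (c : C.C) : sl C.δ₂ C.ε f c = f c := by
  have h := map_sl (δ := C.δ₂) C.ε (GrHom.id C.C) f c
  rw [sl_apply, cv_apply, hC.counit_left] at h
  rw [h]
  exact congrArg (lunit M) (cv_congr rfl (by simp) (fun _ => rfl) (fun _ => rfl) c)

theorem sr_ε (f : GrHom d C.C M) (c : C.C) : sr C.δ₂ f C.ε c = f c := by
  have h := map_sr (δ := C.δ₂) (GrHom.id C.C) C.ε f c
  rw [sr_apply, cv_apply, hC.counit_right, zero_mul, koszulSign_zero, one_smul] at h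
  rw [h]
  exact congrArg (runit M) (cv_congr (f := f) (f' := (GrHom.id C.C).comp f) (zero_add d).symm rfl
    (fun _ => rfl) (fun _ => rfl) c)

theorem cv_ε_left {m : M} (hd : Even d) (hm : m ∈ M.deg d) (f : GrHom e C.C N) (c : C.C) :
    cv C.δ₂ (C.ε.comp (ofElem hm)) f c = tmk m (f c) := by
  have h := tens_id_cv (δ := C.δ₂) C.ε f (ofElem hm) c
  rw [koszulSign_even (hd.mul_left e), one_smul] at h
  rw [← h, ofElem_tens_id hd, ← sl_apply, hC.sl_ε]

theorem cv_ε_right {m : M} (hm : m ∈ M.deg d) (f : GrHom e C.C N) (c : C.C) :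
    cv C.δ₂ f (C.ε.comp (ofElem hm)) c = tmk (f c) m := by
  rw [← id_tens_cv, id_tens_ofElem, ← sr_apply, hC.sr_ε]

/-- The constant functional ε u yields right multiplication by u from this side as well as in
`sr_scalar`. For `f` of degree 0 the two agree, so (id, ε u) does not change δ₁. -/
theorem sl_scalar {u : 𝕜} (hu : u ∈ (GrMod.unit 𝒦).deg d) (f : GrHom 0 C.C M) (c : C.C) :
    sl C.δ₂ (C.ε.comp (ofElem hu)) f c = rmul M hu (f c) := by
  have h := tens_id_cv (δ := C.δ₂) C.ε f (ofElem hu) c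
  rw [zero_mul, koszulSign_zero, one_smul] at h
  rw [sl_apply, ← h, lunit_ofElem_tens_id, ← sl_apply, hC.sl_ε]

theorem sr_scalar {u : 𝕜} (hu : u ∈ (GrMod.unit 𝒦).deg d) (f : GrHom e C.C M) (c : C.C) :
    sr C.δ₂ f (C.ε.comp (ofElem hu)) c = rmul M hu (f c) := by
  rw [sr_apply, ← id_tens_cv, runit_id_tens_ofElem, ← sr_apply, hC.sr_ε]

end IsCoalgebraWithCoderivation

end CoalgData

/-- The Maurer-Cartan equation for twisting cochains `C → A`. -/
def IsTwisting (C : CoalgData 𝒦) (A : AlgData 𝒦) (τ : GrHom 1 C.C A.A) : Prop :=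
  ∀ c, A.m₁ (τ c) = (C.δ₀ c : 𝕜) • A.one - τ (C.δ₁ c) - A.m₂ (cv C.δ₂ τ τ c) +
    (C.ε c : 𝕜) • A.m₀

namespace IsTwisting

variable {C : CoalgData 𝒦} {A : AlgData 𝒦} {τ : GrHom 1 C.C A.A}

/-- Obtained by applying m₁ to the Maurer-Cartan equation and substituting the equation again.
Neither curvature nor Bianchi axioms are assumed, so the identity transports these from the
coalgebra to the algebra or back. -/
theorem m₁_m₁ (hC : C.IsCoalgebraWithCoderivation) (hA : A.IsAlgebraWithDerivation)
    (h : IsTwisting C A τ) (c : C.C) :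
    A.m₁ (A.m₁ (τ c)) = A.m₂ (tmk A.m₀ (τ c)) - A.m₂ (tmk (τ c) A.m₀) +
      (C.ε c : 𝕜) • A.m₁ A.m₀ + τ (C.δ₁ (C.δ₁ c)) - (C.δ₀ (C.δ₁ c) : 𝕜) • A.one -
      sr C.δ₂ τ C.δ₀ c + sl C.δ₂ C.δ₀ τ c := by
  have hτ : ∀ c, (τ.comp A.m₁) c = ((C.δ₀.comp A.η).cast (by norm_num) -
      (C.δ₁.comp τ).cast (by norm_num) - ((cv C.δ₂ τ τ).comp A.m₂).cast (by norm_num) +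
      (C.ε.comp (ofElem A.m₀_mem)).cast (by norm_num) : GrHom 2 C.C A.A) c := fun c => h c
  -- The minus sign arises because m₁ ⊗ 1 has to pass the odd map τ in the second factor.
  have h1 : A.m₁ (A.m₂ (cv C.δ₂ τ τ c)) =
      A.m₂ (cv C.δ₂ τ (τ.comp A.m₁) c) - A.m₂ (cv C.δ₂ (τ.comp A.m₁) τ c) := by
    rw [hA.leibniz, id_tens_cv, tens_id_cv, koszulSign_odd (by decide), neg_one_smul,
      GrHom.map_neg, sub_eq_add_neg]
  have h2 : A.m₂ (cv C.δ₂ τ (τ.comp A.m₁) c) = sr C.δ₂ τ C.δ₀ c -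
      A.m₂ (cv C.δ₂ τ (C.δ₁.comp τ) c) - A.m₂ (cv C.δ₂ ((cv C.δ₂ τ τ).comp A.m₂) τ c) +
      A.m₂ (tmk (τ c) A.m₀) := by
    rw [cv_congr (δ := C.δ₂) (f := τ) rfl (by norm_num) (fun _ => rfl) hτ, cv_add_right,
      cv_sub_right, cv_sub_right, cv_cast_right, cv_cast_right, cv_cast_right, cv_cast_right,
      GrHom.map_add, GrHom.map_sub, GrHom.map_sub, hA.m₂_cv_η_right, hA.m₂_cv_assoc hC.coassoc,
      hC.cv_ε_right]
  have h3 : A.m₂ (cv C.δ₂ (τ.comp A.m₁) τ c) = sl C.δ₂ C.δ₀ τ c -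
      A.m₂ (cv C.δ₂ (C.δ₁.comp τ) τ c) - A.m₂ (cv C.δ₂ ((cv C.δ₂ τ τ).comp A.m₂) τ c) +
      A.m₂ (tmk A.m₀ (τ c)) := by
    rw [cv_congr (δ := C.δ₂) (g := τ) (by norm_num) rfl hτ (fun _ => rfl), cv_add_left,
      cv_sub_left, cv_sub_left, cv_cast_left, cv_cast_left, cv_cast_left, cv_cast_left,
      GrHom.map_add, GrHom.map_sub, GrHom.map_sub, hA.m₂_cv_η_left, hC.cv_ε_left (by decide)]
  have h4 : A.m₂ (cv C.δ₂ τ τ (C.δ₁ c)) = -A.m₂ (cv C.δ₂ τ (C.δ₁.comp τ) c) +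
      A.m₂ (cv C.δ₂ (C.δ₁.comp τ) τ c) := by
    rw [cv_coderivation hC.coleibniz, koszulSign_odd (by decide), neg_one_smul, GrHom.map_add,
      GrHom.map_neg]
  have h5 : ((C.ε (C.δ₁ c) : 𝕜)) • A.m₀ = 0 := by rw [hC.ε_δ₁]; exact zero_smul _ _
  -- The cubic terms (τ ⋆ τ) ⋆ τ and τ ⋆ (τ ⋆ τ) cancel by associativity, and the terms with δ₁ on
  -- one factor cancel against (τ ⋆ τ)(δ₁ c).
  rw [h c, GrHom.map_add, GrHom.map_sub, GrHom.map_sub, GrHom.map_smul, hA.m₁_one, smul_zero,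
    h (C.δ₁ c), h1, h2, h3, h4, h5, GrHom.map_smul]
  abel

/-- Twisting cochains are preserved by homomorphisms of curved algebras. -/
theorem push {B : AlgData 𝒦} (h : IsTwisting C A τ) {f : GrHom 0 A.A B.A}
    (h₂ : ∀ z, B.m₂ (f.tens f z) = f (A.m₂ z)) (h₁ : ∀ x, B.m₁ (f x) = f (A.m₁ x))
    (h₀ : f A.m₀ = B.m₀) (hone : f A.one = B.one) :
    IsTwisting C B ((τ.comp f).cast (add_zero 1)) := by
  intro c
  rw [GrHom.cast_apply, GrHom.comp_apply, h₁, h c, GrHom.map_add, GrHom.map_sub, GrHom.map_sub,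
    GrHom.map_smul, GrHom.map_smul, hone, h₀, ← h₂, tens_cv, mul_zero, koszulSign_zero, one_smul,
    cv_cast_left, cv_cast_right]
  rfl

end IsTwisting

/-! ### Pullback of twisting cochains along morphisms of curved coalgebras. -/

namespace CACoalg

variable {C D : CACoalg 𝒦} {A : AlgData 𝒦}

/-- The pullback of a cochain along a morphism of curved coalgebras. -/
def pull (g : Hom C D) (τ : GrHom 1 D.C A.A) : GrHom 1 C.C A.A :=
  (g.g₁.comp τ).cast (zero_add 1) + (g.g₀.comp A.η).cast (add_zero 1)

theorem pull_apply (g : Hom C D) (τ : GrHom 1 D.C A.A) (c : C.C) :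
    pull g τ c = τ (g.g₁ c) + (g.g₀ c : 𝕜) • A.one := rfl

/-- In the convolution square of g₁τ + g₀η, the mixed terms match the correction in the morphism
condition for δ₁ and the term g₀ ⋆ g₀ matches that in the condition for δ₀. -/
theorem isTwisting_pull (hA : A.IsAlgebraWithDerivation) {τ : GrHom 1 D.C A.A}
    (h : IsTwisting D.toCoalgData A τ) (g : Hom C D) : IsTwisting C.toCoalgData A (pull g τ) := by
  intro c
  have h0 := g.map_δ₀ c
  rw [← cv_apply, ← sl_apply, sub_sub, sub_eq_iff_eq_add] at h0
  -- The odd map τ passes the odd functional g₀ in g₁ ⊗ g₀, which turns the minus sign of `map_δ₁`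
  -- into a plus.
  have h1 : τ (D.δ₁ (g.g₁ c)) = τ (g.g₁ (C.δ₁ c)) + sl C.δ₂ g.g₀ (g.g₁.comp τ) c +
      sr C.δ₂ (g.g₁.comp τ) g.g₀ c := by
    rw [← g.map_δ₁, ← cv_apply, ← cv_apply, ← sl_apply, ← sr_apply, GrHom.map_add, GrHom.map_sub,
      map_sl, map_sr, koszulSign_odd (by decide), neg_one_smul, sub_neg_eq_add]
    abel
  have h2 : A.m₂ (cv C.δ₂ (pull g τ) (pull g τ) c) = A.m₂ (cv D.δ₂ τ τ (g.g₁ c)) +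
      sr C.δ₂ (g.g₁.comp τ) g.g₀ c + sl C.δ₂ g.g₀ (g.g₁.comp τ) c +
      (sl C.δ₂ g.g₀ g.g₀ c : 𝕜) • A.one := by
    rw [pull, cv_add_left, cv_add_right, cv_add_right, cv_map g.map_δ₂]
    simp only [cv_cast_left, cv_cast_right, GrHom.map_add, hA.m₂_cv_η_left, hA.m₂_cv_η_right]
    have e : (sl C.δ₂ g.g₀ g.g₀ c : 𝕜) • A.one = sl C.δ₂ g.g₀ (g.g₀.comp A.η) c :=
      map_sl (δ := C.δ₂) g.g₀ g.g₀ A.η c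
    rw [e]
    abel
  have h3 : (C.δ₀ c : 𝕜) • A.one = (D.δ₀ (g.g₁ c) : 𝕜) • A.one +
      ((g.g₀ (C.δ₁ c) : 𝕜) • A.one + (sl C.δ₂ g.g₀ g.g₀ c : 𝕜) • A.one) :=
    (congrArg A.η h0).trans ((GrHom.map_add _ _ _).trans (congrArg _ (GrHom.map_add _ _ _)))
  rw [pull_apply, pull_apply, GrHom.map_add, GrHom.map_smul, hA.m₁_one, smul_zero, add_zero,
    h (g.g₁ c), h1, h2, h3, g.map_ε]
  abel

theorem pull_comp {E : CACoalg 𝒦} (f : Hom C D) (g : Hom D E) (τ : GrHom 1 E.C A.A) (c : C.C) :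
    pull (compHom f g) τ c = pull f (pull g τ) c := by
  rw [pull_apply, pull_apply, pull_apply, add_assoc, ← add_smul, add_comm (g.g₀ _ : 𝕜)]
  rfl

/-- The automorphism `(id, ε u)` of a curved coalgebra for a scalar `u` of degree `1`. -/
noncomputable def scalarHom (C : CACoalg 𝒦) {u : 𝕜} (hu : u ∈ 𝒦 1) : Hom C C where
  g₁ := GrHom.id C.C
  g₀ := (C.ε.comp (ofElem (M := GrMod.unit 𝒦) hu)).cast (zero_add 1)
  map_δ₂ x := tens_id _
  map_δ₁ x := by
    have hC := C.isCurvedAugmented.isCoalgebraWithCoderivation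
    rw [← cv_apply, ← cv_apply, cv_cast_left, cv_cast_right, ← sl_apply, ← sr_apply,
      hC.sl_scalar, hC.sr_scalar, sub_self, add_zero]
    rfl
  map_δ₀ x := by
    have hC := C.isCurvedAugmented.isCoalgebraWithCoderivation
    rw [← cv_apply, cv_cast_left, cv_cast_right, ← id_tens_cv, lunit_unit_eq_runit,
      runit_id_tens_ofElem, ← sr_apply, hC.sr_ε, GrHom.cast_apply, GrHom.comp_apply,
      GrHom.comp_apply, hC.ε_δ₁, GrHom.map_zero, sub_zero]
    -- The quadratic term is a multiple of u², which is zero by strong commutativity; commutativity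
    -- alone would only give 2u² = 0.
    have h : rmul (GrMod.unit 𝒦) (c := u) hu (ofElem (M := GrMod.unit 𝒦) hu (C.ε x)) = 0 := by
      rw [ofElem_apply, GrHom.map_smul, rmul_apply, rsmul_apply (GrMod.unit 𝒦) hu hu]
      exact (congrArg (fun a : 𝕜 => (C.ε x : 𝕜) • koszulSign (1 * 1) • a)
        (IsGradedStronglyCommutative.sq (𝒦 := 𝒦) odd_one hu)).trans (by
          rw [smul_zero, smul_zero])
    exact (congrArg (C.δ₀ x - ·) h).trans (sub_zero _)
  map_ε _ := rfl
  map_w := rfl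

theorem pull_scalarHom (C : CACoalg 𝒦) {u : 𝕜} (hu : u ∈ 𝒦 1) (τ : GrHom 1 C.C A.A) (c : C.C) :
    pull (scalarHom C hu) τ c = τ c + ((C.ε c : 𝕜) * u) • A.one := rfl

end CACoalg

end Twisting

/-! ### The cobar construction. -/

section CobarConstruction

variable {𝕜 : Type u} [Ring 𝕜] {𝒦 : ℤ → AddSubgroup 𝕜} [GradedRing 𝒦]
  [IsGradedStronglyCommutative 𝒦]

open GrHom TensorConstr

theorem TensorConstr.algLift_mul {X : GrMod 𝒦} {A : AlgData 𝒦} (hA : A.IsAlgebraWithDerivation)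
    (φ : GrHom 0 X A.A) (z : X.T.tensor X.T) :
    A.m₂ ((algLift A φ).tens (algLift A φ) z) = algLift A φ (mul X z) := by
  have key : ∀ a b, A.m₂ (tmk (algLift A φ a) (algLift A φ b)) = algLift A φ (mul X (tmk a b)) := by
    intro a b
    refine T_ind (p := fun a => A.m₂ (tmk (algLift A φ a) (algLift A φ b)) =
      algLift A φ (mul X (tmk a b))) ?_ ?_ ?_ a
    · intro c
      rw [mul_smul_tone_left, GrHom.map_smul, GrHom.map_smul, algLift_tone, smul_tmk,
        GrHom.map_smul, hA.one_mul]
    · intro i j x w _ _ ih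
      rw [mul_cons, algLift_cons, algLift_cons, ← ih, hA.assoc]
    · intro a a' ha ha'
      simp only [GrHom.map_add, add_tmk, ha, ha']
  refine tensor_ext_apply (f := ((algLift A φ).tens (algLift A φ)).comp A.m₂)
    (g := (mul X).comp (algLift A φ)) (fun i j a b _ _ => ?_) z
  rw [GrHom.comp_apply, GrHom.comp_apply, tens_tmk_of_deg_zero, key]

namespace CACoalg

variable (C : CACoalg 𝒦)

theorem proj_w : C.proj C.w = 0 := C.pr_w

theorem lift_proj (c : C.C) : C.lift (C.proj c) = c - (C.ε c : 𝕜) • C.w := rfl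

theorem proj_lift (x : C.X) : C.proj (C.lift x) = x := C.pr_incl x

theorem ε_lift (x : C.X) : (C.ε (C.lift x) : 𝕜) = 0 :=
  LinearMap.mem_ker.1 (show C.bar from x).2

variable {C} in
theorem map_lift_proj {M : GrMod 𝒦} {d : ℤ} (f : GrHom d C.C M) (c : C.C) :
    f (C.lift (C.proj c)) = f c - (C.ε c : 𝕜) • f C.w := by
  rw [lift_proj, GrHom.map_sub, GrHom.map_smul]

/-- These axioms hold for any derivation of a tensor algebra. They suffice for `IsTwisting.m₁_m₁`,
before anything is known about m₁². -/
theorem cobar_isAlgebraWithDerivation : C.cobarObj.IsAlgebraWithDerivation where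
  assoc := TensorConstr.mul_assoc
  leibniz := der_leibniz _
  mul_one := mul_tone_right
  one_mul := mul_tone_left
  m₁_one := der_tone _

/-- The universal twisting cochain of the cobar construction. -/
def cobarTwist : GrHom 1 C.C C.X.T := (C.proj.comp (gen C.X)).cast (add_zero 1)

theorem cobarTwist_apply (c : C.C) : C.cobarTwist c = gen C.X (C.proj c) := rfl

theorem cobarTwist_w : C.cobarTwist C.w = 0 := by
  rw [cobarTwist_apply, proj_w, GrHom.map_zero]

theorem cobarTwist_lift (x : C.X) : C.cobarTwist (C.lift x) = gen C.X x := by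
  rw [cobarTwist_apply, proj_lift]

theorem mul_gen_tens_gen {X : GrMod 𝒦} (u : X.tensor X) :
    mul X ((gen X).tens (gen X) u) = inj X 2 ((GrHom.id X).tens (toPowOne X) u) := by
  refine tensor_ext_apply (f := ((gen X).tens (gen X)).comp (mul X))
    (g := ((GrHom.id X).tens (toPowOne X)).comp (injS X 1)) (fun i j x y _ _ => ?_) u
  rw [GrHom.comp_apply, GrHom.comp_apply, tens_tmk_of_deg_zero, tens_tmk_of_deg_zero, mul_gen]
  exact cons_tmk_inj x 1 (toPowOne X y)

/-- The differential is prescribed on C̄ only. For arbitrary c the element of C̄ in question is c −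
ε(c) w, and the corrections −ε(c) times the values of the formulas at w assemble to ε(c) m₀. This
accounts for the choice of the curvature element. -/
theorem isTwisting_cobarTwist : IsTwisting C.toCoalgData C.cobarObj C.cobarTwist := by
  intro c
  have hC := C.isCurvedAugmented
  have h0 : inj C.X 0 (C.ξ₀ (C.proj c)) = (C.δ₀ c : 𝕜) • tone C.X -
      (C.ε c : 𝕜) • inj C.X 0 (C.δ₀ C.w) := by
    refine (congrArg (inj C.X 0) (map_lift_proj C.δ₀ c)).trans ?_
    rw [← inj_zero_apply]
    exact ((inj C.X 0).map_sub _ _).trans (congrArg _ ((inj C.X 0).map_smul _ _))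
  have h1 : gen C.X (C.ξ₁ (C.proj c)) = - C.cobarTwist (C.δ₁ c) +
      (C.ε c : 𝕜) • gen C.X (C.proj (C.δ₁ C.w)) := by
    have e : C.ξ₁ (C.proj c) = -(C.proj (C.δ₁ c) - (C.ε c : 𝕜) • C.proj (C.δ₁ C.w)) :=
      congrArg Neg.neg (map_lift_proj (C.δ₁.comp C.proj) c)
    rw [e, GrHom.map_neg, GrHom.map_sub, GrHom.map_smul, cobarTwist_apply]
    abel
  -- No correction occurs for ξ₂: since w is grouplike and has zero projection, the convolution of
  -- `proj` with itself vanishes at w.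
  have h2 : inj C.X 2 ((GrHom.id C.X).tens (toPowOne C.X) (C.ξ₂ (C.proj c))) =
      -mul C.X (cv C.δ₂ C.cobarTwist C.cobarTwist c) := by
    have e : C.ξ₂ (C.proj c) = -cv C.δ₂ C.proj C.proj c := by
      refine congrArg Neg.neg ((map_lift_proj (C.δ₂.comp (C.proj.tens C.proj)) c).trans ?_)
      rw [GrHom.comp_apply, GrHom.comp_apply, ← cv_apply, ← cv_apply,
        CoalgData.cv_w hC.δ₂_w, proj_w, zero_tmk, smul_zero, sub_zero]

    rw [e, ← mul_gen_tens_gen, GrHom.map_neg, GrHom.map_neg, tens_cv, mul_zero, koszulSign_zero,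
      one_smul]
    exact congrArg (fun t => -mul C.X t)
      (cv_congr (add_zero 1) (add_zero 1) (fun _ => rfl) (fun _ => rfl) c)
  have h : der C.cobarGen (gen C.X (C.proj c)) = inj C.X 0 (C.ξ₀ (C.proj c)) +
      gen C.X (C.ξ₁ (C.proj c)) +
      inj C.X 2 ((GrHom.id C.X).tens (toPowOne C.X) (C.ξ₂ (C.proj c))) := der_gen _ _
  change der C.cobarGen (gen C.X (C.proj c)) = (C.δ₀ c : 𝕜) • tone C.X - C.cobarTwist (C.δ₁ c) -
    mul C.X (cv C.δ₂ C.cobarTwist C.cobarTwist c) + (C.ε c : 𝕜) • C.cobarM₀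
  rw [h, h0, h1, h2, cobarM₀, smul_add, smul_neg]
  abel

/-- The terms of `IsTwisting.m₁_m₁` that involve δ₁² and δ₀ cancel by the curvature and Bianchi
axioms of C. -/
theorem m₁_m₁_cobarTwist (c : C.C) : C.cobarObj.m₁ (C.cobarObj.m₁ (C.cobarTwist c)) =
    C.cobarObj.m₂ (tmk C.cobarObj.m₀ (C.cobarTwist c)) -
      C.cobarObj.m₂ (tmk (C.cobarTwist c) C.cobarObj.m₀) +
      (C.ε c : 𝕜) • C.cobarObj.m₁ C.cobarObj.m₀ := by
  have hC := C.isCurvedAugmented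
  rw [C.isTwisting_cobarTwist.m₁_m₁ hC.isCoalgebraWithCoderivation
    C.cobar_isAlgebraWithDerivation, hC.curvature, GrHom.map_sub, hC.bianchi, ← cv_apply,
    ← cv_apply, ← sl_apply, ← sr_apply, map_sl, map_sr, koszulSign_even (by decide), one_smul]
  have e1 : sr C.δ₂ ((GrHom.id C.C).comp C.cobarTwist) C.δ₀ c = sr C.δ₂ C.cobarTwist C.δ₀ c :=
    congrArg (runit _) (cv_congr (zero_add 1) rfl (fun _ => rfl) (fun _ => rfl) c)
  have e2 : sl C.δ₂ C.δ₀ ((GrHom.id C.C).comp C.cobarTwist) c = sl C.δ₂ C.δ₀ C.cobarTwist c :=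
    congrArg (lunit _) (cv_congr rfl (zero_add 1) (fun _ => rfl) (fun _ => rfl) c)
  rw [e1, e2, show ((0 : GrMod.unit 𝒦) : 𝕜) • C.cobarObj.one = 0 from zero_smul _ _]
  abel

/-- At w the universal cochain is zero and ε is one, so only m₁(m₀) survives. -/
theorem cobar_bianchi : C.cobarObj.m₁ C.cobarObj.m₀ = 0 := by
  have h := C.m₁_m₁_cobarTwist C.w
  rw [cobarTwist_w, GrHom.map_zero, GrHom.map_zero, tmk_zero, zero_tmk, GrHom.map_zero, sub_zero,
    zero_add, C.ε_w, one_smul] at h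
  exact h.symm

/-- On generators this is `m₁_m₁_cobarTwist` at elements of C̄, where ε is zero. It extends to words
because the square of an odd derivation and the commutator with m₀ are both derivations. -/
theorem cobar_curvature (z : C.X.T) : C.cobarObj.m₁ (C.cobarObj.m₁ z) =
    C.cobarObj.m₂ (tmk C.cobarObj.m₀ z) - C.cobarObj.m₂ (tmk z C.cobarObj.m₀) := by
  have hgen : ∀ x, der C.cobarGen (C.cobarGen x) =
      mul C.X (tmk C.cobarM₀ (gen C.X x)) - mul C.X (tmk (gen C.X x) C.cobarM₀) := by
    intro x
    have h := C.m₁_m₁_cobarTwist (C.lift x)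
    rw [cobar_bianchi, smul_zero, add_zero, cobarTwist_lift] at h
    rw [← der_gen C.cobarGen x]
    exact h
  change der C.cobarGen (der C.cobarGen z) = mul C.X (tmk C.cobarM₀ z) - mul C.X (tmk z C.cobarM₀)
  refine T_ind (p := fun z => der C.cobarGen (der C.cobarGen z) =
    mul C.X (tmk C.cobarM₀ z) - mul C.X (tmk z C.cobarM₀)) ?_ ?_ ?_ z
  · intro c
    -- Scalars commute with m₀ without sign, its degree being even.
    have h : mul C.X (tmk C.cobarM₀ (c • tone C.X)) = c • C.cobarM₀ := by
      refine scalar_induction (𝒦 := 𝒦)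
        (p := fun c => mul C.X (tmk C.cobarM₀ (c • tone C.X)) = c • C.cobarM₀) ?_ ?_ ?_ c
      · rw [zero_smul, zero_smul, tmk_zero, GrHom.map_zero]
      · intro i c hc
        rw [tmk_smul _ hc C.cobarM₀_mem, koszulSign_even (by simp), one_smul, GrHom.map_smul,
          mul_tone_right]
      · intro a b ha hb
        rw [add_smul, add_smul, tmk_add, GrHom.map_add, ha, hb]
    rw [h, GrHom.map_smul, der_tone, smul_zero, GrHom.map_zero, mul_smul_tone_left, sub_self]
  · intro i j x w hx hw ih
    rw [← mul_gen, der_mul _ _ hw, GrHom.map_add, GrHom.map_zsmul,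
      der_mul _ _ ((der C.cobarGen).map_deg hw), der_mul _ _ hw, ih, der_gen, hgen, tmk_sub,
      sub_tmk, GrHom.map_sub, GrHom.map_sub]
    simp only [TensorConstr.mul_assoc, smul_add, smul_smul, koszulSign_mul_self, one_smul]
    -- The degree of the derivative of w exceeds that of w by one, so the two cross terms of the
    -- squared derivation have opposite signs.
    have hs : koszulSign (1 * (j + 1)) = -koszulSign (1 * j) := by
      rw [one_mul, one_mul, koszulSign_add, koszulSign_odd odd_one, mul_neg_one]
    rw [hs, neg_smul]
    abel
  · intro a b ha hb
    simp only [GrHom.map_add, tmk_add, add_tmk, ha, hb]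
    abel

theorem cobar_isUnitComplementedCurved : C.cobarObj.IsUnitComplementedCurved where
  assoc := TensorConstr.mul_assoc
  leibniz := der_leibniz _
  curvature := C.cobar_curvature
  bianchi := C.cobar_bianchi
  mul_one := mul_tone_right
  one_mul := mul_tone_left
  m₁_one := der_tone _

/-- The cobar construction as a curved algebra. -/
noncomputable abbrev cobar : UCCAlg 𝒦 := ⟨C.cobarObj, C.cobar_isUnitComplementedCurved⟩

variable {C} {A : AlgData 𝒦}

/-! ### Homomorphisms out of the cobar construction from twisting cochains. -/

section Criterion

variable {f : GrHom 0 C.X.T A.A} (hA : A.IsAlgebraWithDerivation)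
  (h₂ : ∀ z, A.m₂ (f.tens f z) = f (mul C.X z)) (hone : f (tone C.X) = A.one)
  (hf : IsTwisting C.toCoalgData A ((C.cobarTwist.comp f).cast (add_zero 1)))
include h₂ hone hf

/-- Two Maurer-Cartan equations are compared: that of the composite with `f`, and the image under
`f` of the universal one. By multiplicativity and unitality of `f` they differ only in the curvature
term. -/
theorem m₁_sub_of_isTwisting (c : C.C) :
    A.m₁ (f (C.cobarTwist c)) = f (C.cobarObj.m₁ (C.cobarTwist c)) +
      (C.ε c : 𝕜) • (A.m₀ - f C.cobarObj.m₀) := by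
  have h := hf c
  rw [cv_cast_left, cv_cast_right] at h
  have e : A.m₂ (cv C.δ₂ (C.cobarTwist.comp f) (C.cobarTwist.comp f) c) =
      f (mul C.X (cv C.δ₂ C.cobarTwist C.cobarTwist c)) := by
    rw [← h₂, tens_cv, mul_zero, koszulSign_zero, one_smul]
  rw [e] at h
  refine h.trans ?_
  rw [C.isTwisting_cobarTwist c, GrHom.map_add, GrHom.map_sub, GrHom.map_sub, GrHom.map_smul,
    GrHom.map_smul, smul_sub]
  change (C.δ₀ c : 𝕜) • A.one - f (C.cobarTwist (C.δ₁ c)) - _ + _ =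
    (C.δ₀ c : 𝕜) • f (tone C.X) - _ - f (mul C.X _) + _ + _
  rw [hone]
  abel

/-- The comparison at w, where the cochain is zero and ε is one, involves the curvature elements
alone. -/
theorem map_m₀_of_isTwisting : f C.cobarObj.m₀ = A.m₀ := by
  have h := m₁_sub_of_isTwisting h₂ hone hf C.w
  rw [cobarTwist_w, GrHom.map_zero, GrHom.map_zero, GrHom.map_zero, GrHom.map_zero, zero_add,
    C.ε_w, one_smul] at h
  exact (sub_eq_zero.1 h.symm).symm

include hA in
theorem map_m₁_of_isTwisting (z : C.X.T) : A.m₁ (f z) = f (C.cobarObj.m₁ z) := by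
  -- On C̄ the counit is zero, so the curvature term of the comparison drops out.
  have hgen : ∀ x, A.m₁ (f (gen C.X x)) = f (C.cobarGen x) := by
    intro x
    have h := m₁_sub_of_isTwisting h₂ hone hf (C.lift x)
    rw [ε_lift, zero_smul, add_zero, cobarTwist_lift] at h
    rw [h, ← der_gen C.cobarGen x]
  change A.m₁ (f z) = f (der C.cobarGen z)
  have h₂' : ∀ a b, f (mul C.X (tmk a b)) = A.m₂ (tmk (f a) (f b)) := fun a b => by
    rw [← h₂, tens_tmk_of_deg_zero]
  refine T_ext (f := f.comp A.m₁) (g := (der C.cobarGen).comp f) ?_ ?_ z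
  · rw [GrHom.comp_apply, GrHom.comp_apply, hone, der_tone, hA.m₁_one, GrHom.map_zero]
  · intro i j x w hx hw ih
    rw [GrHom.comp_apply, GrHom.comp_apply] at ih ⊢
    rw [← mul_gen, der_mul _ _ hw, h₂', hA.leibniz, GrHom.map_add, GrHom.map_zsmul, h₂', h₂',
      tens_tmk_of_deg_zero, tens_tmk _ _ _ (f.map_deg_zero hw), GrHom.map_zsmul, ih, der_gen,
      hgen]; rfl

end Criterion

/-- The homomorphism of curved algebras from the cobar construction given by a twisting cochain. -/
noncomputable def cobarDesc {A : UCCAlg 𝒦} (f : GrHom 0 C.X.T A.A)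
    (h₂ : ∀ z, A.m₂ (f.tens f z) = f (mul C.X z)) (hone : f (tone C.X) = A.one)
    (hf : IsTwisting C.toCoalgData A.toAlgData ((C.cobarTwist.comp f).cast (add_zero 1)))
    {u : 𝕜} (hu : u ∈ 𝒦 1) : UCCAlg.Hom C.cobar A where
  f₁ := f
  und := u
  und_mem := hu
  map_m₂ := h₂
  map_m₁ := map_m₁_of_isTwisting A.isUnitComplementedCurved.isAlgebraWithDerivation h₂ hone hf
  map_m₀ := map_m₀_of_isTwisting h₂ hone hf
  map_one := hone

theorem algHom_eq_algLift {X : GrMod 𝒦} (D : CACoalg 𝒦) (φ : GrHom 0 X D.X.T) (z : X.T) :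
    algHom φ z = algLift D.cobarObj φ z := by
  refine T_ext (f := algHom φ) (g := algLift D.cobarObj φ) ?_ ?_ z
  · rw [algHom_tone, algLift_tone]
  · intro i j x w _ _ ih
    rw [algHom_cons, algLift_cons, ih]

variable {D E : CACoalg 𝒦}

theorem Hom.und_mem (g : Hom C D) : g.und ∈ 𝒦 1 := g.g₀.map_deg' C.w_mem (zero_add 1)

theorem und_comp (f : Hom C D) (g : Hom D E) : (compHom f g).und = f.und + g.und := by
  change (f.g₀ C.w : 𝕜) + g.g₀ (f.g₁ C.w) = _
  rw [f.map_w]; rfl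

theorem cobarMap₁_gen (g : Hom C D) (x : C.X) : cobarMap₁ g (gen C.X x) =
    D.cobarTwist (g.g₁ (C.lift x)) + (g.g₀ (C.lift x) : 𝕜) • tone D.X := by
  rw [gen_eq_cons, cobarMap₁, algHom_cons, algHom_tone, mul_tone_right, ← inj_zero_apply]; rfl

/-- The universal cochain depends only on the projection of c to C̄, so g₀ enters through c − ε(c)
w; this is the origin of the correction by the scalar component. -/
theorem cobarMap₁_cobarTwist (g : Hom C D) (c : C.C) : cobarMap₁ g (C.cobarTwist c) =
    D.cobarTwist (g.g₁ c) + ((g.g₀ c : 𝕜) - (C.ε c : 𝕜) * g.und) • tone D.X := by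
  rw [cobarTwist_apply, cobarMap₁_gen]
  have e1 : D.cobarTwist (g.g₁ (C.lift (C.proj c))) = D.cobarTwist (g.g₁ c) := by
    rw [map_lift_proj g.g₁, g.map_w, GrHom.map_sub, GrHom.map_smul, cobarTwist_w, smul_zero,
      sub_zero]
  rw [e1, map_lift_proj g.g₀]; rfl

theorem cobarMap₁_mul (g : Hom C D) (z : C.X.T.tensor C.X.T) :
    mul D.X ((cobarMap₁ g).tens (cobarMap₁ g) z) = cobarMap₁ g (mul C.X z) := by
  rw [tens_congr (f := cobarMap₁ g) (g := cobarMap₁ g) rfl rfl (algHom_eq_algLift D _)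
    (algHom_eq_algLift D _)]
  exact (algLift_mul D.cobar_isAlgebraWithDerivation _ z).trans (algHom_eq_algLift D _ _).symm

/-- By `cobarMap₁_cobarTwist`, this cochain is the pullback of the universal one of D along (id,
−ε·und) followed by g. -/
theorem isTwisting_cobarMap₁ (g : Hom C D) : IsTwisting C.toCoalgData D.cobarObj
    ((C.cobarTwist.comp (cobarMap₁ g)).cast (add_zero 1)) := by
  have h := isTwisting_pull D.cobar_isAlgebraWithDerivation D.isTwisting_cobarTwist
    (compHom (scalarHom C (neg_mem g.und_mem)) g)
  have e : (C.cobarTwist.comp (cobarMap₁ g)).cast (add_zero 1) =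
      pull (A := D.cobarObj) (compHom (scalarHom C (neg_mem g.und_mem)) g) D.cobarTwist :=
    GrHom.ext fun c => by
    rw [GrHom.cast_apply, GrHom.comp_apply, cobarMap₁_cobarTwist, pull_comp, pull_scalarHom,
      pull_apply, sub_smul, mul_neg, neg_smul]
    change _ = _ + _ • tone D.X + -(_ • tone D.X)
    abel
  rw [e]; exact h

/-- The cobar construction on morphisms. -/
noncomputable def cobarMap (g : Hom C D) : UCCAlg.Hom C.cobar D.cobar :=
  cobarDesc (A := D.cobar) (cobarMap₁ g) (cobarMap₁_mul g) (algHom_tone _) (isTwisting_cobarMap₁ g) g.und_mem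

/-- A homomorphism from the cobar construction is determined by the twisting cochain. -/
theorem cobar_hom_ext {A : UCCAlg 𝒦} {f g : UCCAlg.Hom C.cobar A}
    (h : ∀ c, f.f₁ (C.cobarTwist c) = g.f₁ (C.cobarTwist c)) (hu : f.und = g.und) : f = g := by
  refine UCCAlg.Hom.ext (GrHom.ext fun z => ?_) hu
  refine T_ext (f := f.f₁) (g := g.f₁) (f.map_one.trans g.map_one.symm) ?_ z
  intro i j x w _ _ ih
  have key : ∀ k : UCCAlg.Hom C.cobar A, k.f₁ (cons C.X (tmk x w)) =
      A.m₂ (tmk (k.f₁ (C.cobarTwist (C.lift x))) (k.f₁ w)) := fun k => by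
    rw [← tens_tmk_of_deg_zero, k.map_m₂, cobarTwist_lift]
    exact congrArg k.f₁ (mul_gen x w).symm
  rw [key, key, h, ih]

variable (𝒦) in
/-- The cobar functor. -/
noncomputable def cobarFunctor : CACoalg 𝒦 ⥤ UCCAlg 𝒦 where
  obj := cobar
  map g := cobarMap g
  map_id C := by
    refine cobar_hom_ext (fun c => ?_) rfl
    refine (cobarMap₁_cobarTwist (idHom C) c).trans ?_
    have h : ((idHom C).g₀ c : 𝕜) - (C.ε c : 𝕜) * (idHom C).und = 0 :=
      (sub_eq_zero.2 (mul_zero (C.ε c : 𝕜)).symm)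
    rw [h, zero_smul, add_zero]; rfl
  map_comp {C D E} f g := by
    refine cobar_hom_ext (fun c => ?_) ?_
    · refine (cobarMap₁_cobarTwist (compHom f g) c).trans ?_
      have h : cobarMap₁ g (cobarMap₁ f (C.cobarTwist c)) = E.cobarTwist (g.g₁ (f.g₁ c)) +
          (((f.g₀ c : 𝕜) + (g.g₀ (f.g₁ c) : 𝕜)) - (C.ε c : 𝕜) * (compHom f g).und) • tone E.X := by
        rw [cobarMap₁_cobarTwist, GrHom.map_add, GrHom.map_smul, cobarMap₁_cobarTwist, und_comp,
          f.map_ε, show cobarMap₁ g (tone D.X) = tone E.X from algHom_tone _, add_assoc, ← add_smul]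
        congr 2
        rw [mul_add]; abel
      exact h.symm
    · exact (und_comp f g).trans (add_comm _ _)

end CACoalg

end CobarConstruction

/-! ### The bar construction. -/

section BarCoalgebra

variable {𝕜 : Type u} [Ring 𝕜] {𝒦 : ℤ → AddSubgroup 𝕜} [GradedRing 𝒦]
  [IsGradedStronglyCommutative 𝒦]

open GrHom TensorConstr

theorem GrHom.cv_id_comp {C M N : GrMod 𝒦} {δ : GrHom 0 C (C.tensor C)} {d e : ℤ}
    (f : GrHom d C M) (g : GrHom e C N) (c : C) :
    cv δ f ((GrHom.id C).comp g) c = cv δ f g c :=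
  cv_congr rfl (zero_add e) (fun _ => rfl) (fun _ => rfl) c

namespace UCCAlg

variable (A : UCCAlg 𝒦)

theorem lift_proj (a : A.A) : A.lift (A.proj a) = a - (A.v a : 𝕜) • A.one := rfl

theorem v_lift (x : A.X) : A.v (A.lift x) = 0 := LinearMap.mem_ker.1 (show A.bar from x).2

theorem proj_lift (x : A.X) : A.proj (A.lift x) = x := by
  refine Subtype.ext ?_
  change A.lift x - (A.v (A.lift x) : 𝕜) • A.one = A.lift x
  rw [show (A.v (A.lift x) : 𝕜) = 0 from A.v_lift x, zero_smul, sub_zero]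

theorem proj_one : A.proj A.one = 0 := by
  refine Subtype.ext ?_
  change A.one - (A.v A.one : 𝕜) • A.one = 0
  rw [A.v_one, one_smul, sub_self]

/-- The part of the axioms that holds for any coderivation with low components; it makes
`IsTwisting.m₁_m₁` available. -/
theorem barObj_isCoalgebraWithCoderivation : A.barObj.IsCoalgebraWithCoderivation where
  coassoc := comul_coassoc
  coleibniz := coder_coleibniz _ _ _
  counit_right := comul_counit_right
  counit_left := comul_counit_left
  ε_δ₁ := proj₀_coder _ _ _

/-- The universal twisting cochain of the bar construction. -/
noncomputable def barTwist : GrHom 1 A.X.T A.A := ((p₁ A.X).comp A.lift).cast (zero_add 1)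

theorem barTwist_apply (z : A.X.T) : A.barTwist z = A.lift (p₁ A.X z) := rfl

theorem barTwist_tone : A.barTwist (tone A.X) = 0 := by
  rw [barTwist_apply, p₁_tone, GrHom.map_zero]

theorem cv_barTwist (z : A.X.T) : A.lift.tens A.lift ((GrHom.id A.X).tens (p₁ A.X)
    (uncons A.X z)) = cv (comul A.X) A.barTwist A.barTwist z := by
  rw [id_tens_p₁_uncons, tens_cv, zero_mul, koszulSign_zero, one_smul]
  exact cv_congr (zero_add 1) (zero_add 1) (fun _ => rfl) (fun _ => rfl) z

/-- The failure of the Maurer-Cartan equation without its linear terms. -/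
noncomputable def barDefect (z : A.X.T) : A.A :=
  (proj₀ A.X z : 𝕜) • A.m₀ - A.m₁ (A.barTwist z) -
    A.m₂ (cv (comul A.X) A.barTwist A.barTwist z)

theorem p₁_coder_eq (z : A.X.T) :
    p₁ A.X (coder A.b₀ A.b₁ A.b₂ z) = A.proj (A.barDefect z) := by
  rw [p₁_coder, ofLow_apply, barDefect, ← cv_barTwist, GrHom.map_sub, GrHom.map_sub,
    GrHom.map_smul, sub_eq_add_neg, sub_eq_add_neg]
  rfl

theorem barδ₀_eq (z : A.X.T) : A.barδ₀ z = -A.v (A.barDefect z) := by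
  rw [barδ₀, ofLow_apply, barDefect, ← cv_barTwist, GrHom.map_sub, GrHom.map_sub]
  change -A.v ((proj₀ A.X z : 𝕜) • A.m₀) + A.v (A.m₁ (A.barTwist z)) +
    A.v (A.m₂ (A.lift.tens A.lift ((GrHom.id A.X).tens (p₁ A.X) (uncons A.X z)))) = _
  abel

/-- The cogenerator part of the coderivation and −δ₀ are the two components of the single element
`barDefect z` along A = Ā ⊕ 𝕜·1. Putting them together makes the Maurer-Cartan equation a
rearrangement of the definition of the defect. -/
theorem barTwist_coder (z : A.X.T) : A.barTwist (coder A.b₀ A.b₁ A.b₂ z) =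
    A.barDefect z + (A.barδ₀ z : 𝕜) • A.one := by
  rw [barTwist_apply, p₁_coder_eq, lift_proj, barδ₀_eq, sub_eq_add_neg]
  exact congrArg _ (neg_smul _ _).symm

theorem isTwisting_barTwist : IsTwisting A.barObj A.toAlgData A.barTwist := by
  intro z
  change A.m₁ (A.barTwist z) = (A.barδ₀ z : 𝕜) • A.one -
    A.barTwist (coder A.b₀ A.b₁ A.b₂ z) - A.m₂ (cv (comul A.X) A.barTwist A.barTwist z) +
    (proj₀ A.X z : 𝕜) • A.m₀
  rw [barTwist_coder, barDefect]
  abel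

/-- In `IsTwisting.m₁_m₁` the curvature and Bianchi axioms of A remove all terms with m₁² and m₀. -/
theorem barTwist_coder_coder (z : A.X.T) :
    A.barTwist (coder A.b₀ A.b₁ A.b₂ (coder A.b₀ A.b₁ A.b₂ z)) =
      (A.barδ₀ (coder A.b₀ A.b₁ A.b₂ z) : 𝕜) • A.one + sr (comul A.X) A.barTwist A.barδ₀ z -
        sl (comul A.X) A.barδ₀ A.barTwist z := by
  have hA := A.isUnitComplementedCurved
  have h := A.isTwisting_barTwist.m₁_m₁ A.barObj_isCoalgebraWithCoderivation
    hA.isAlgebraWithDerivation z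
  rw [hA.curvature, hA.bianchi, smul_zero, add_zero] at h
  refine sub_eq_zero.1 (Eq.trans ?_ (sub_eq_zero.2 h.symm))
  abel

/-- The component of `barTwist_coder_coder` along v: the universal cochain takes values in Ker v, so
only the multiple of the unit remains. -/
theorem bar_bianchi (z : A.X.T) : A.barδ₀ (coder A.b₀ A.b₁ A.b₂ z) = 0 := by
  have h := congrArg A.v (A.barTwist_coder_coder z)
  have e1 : ∀ z, (A.barTwist.comp A.v) z = (0 : GrHom 1 A.X.T (GrMod.unit 𝒦)) z :=
    fun z => A.v_lift _
  have e2 : A.v (sr (comul A.X) A.barTwist A.barδ₀ z) = 0 := by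
    rw [map_sr, mul_zero, koszulSign_zero, one_smul, sr_apply,
      cv_congr (add_zero 1) rfl e1 (fun _ => rfl), cv_apply, tens_zero_left, GrHom.map_zero]
  have e3 : A.v (sl (comul A.X) A.barδ₀ A.barTwist z) = 0 := by
    rw [map_sl, sl_apply,
      cv_congr rfl (add_zero 1) (fun _ => rfl) e1, cv_apply, tens_zero_right, GrHom.map_zero]
  rw [barTwist_apply, v_lift, GrHom.map_sub, GrHom.map_add, e2, e3, GrHom.map_smul, A.v_one,
    sub_zero, add_zero] at h
  exact (h.trans (_root_.mul_one (A.barδ₀ _ : 𝕜))).symm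

/-- The component of `barTwist_coder_coder` in Ā[1], where the multiple of the unit disappears; δ₀
is even, so no sign arises. -/
theorem p₁_coder_coder (z : A.X.T) : p₁ A.X (coder A.b₀ A.b₁ A.b₂ (coder A.b₀ A.b₁ A.b₂ z)) =
    sr (comul A.X) (p₁ A.X) A.barδ₀ z - sl (comul A.X) A.barδ₀ (p₁ A.X) z := by
  have h := congrArg A.proj (A.barTwist_coder_coder z)
  have e1 : ∀ z, (A.barTwist.comp A.proj) z = p₁ A.X z := fun z => A.proj_lift _
  rw [barTwist_apply, proj_lift, GrHom.map_sub, GrHom.map_add, GrHom.map_smul, proj_one, smul_zero,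
    zero_add, map_sr, map_sl, koszulSign_even (by decide), one_smul] at h
  rw [h, sr_apply, sl_apply, cv_congr (by norm_num) rfl e1 (fun _ => rfl),
    cv_congr rfl (by norm_num) (fun _ => rfl) e1]
  rfl

/-- A map with `E z = x ⊗ E w` for `z = x ⊗ w` vanishes. -/
theorem _root_.TensorConstr.eq_zero_of_uncons {X : GrMod 𝒦} {d : ℤ} {E : GrHom d X.T X.T}
    (h₀ : ∀ z, proj₀ X (E z) = 0)
    (h : ∀ z, uncons X (E z) = (GrHom.id X).tens E (uncons X z)) (z : X.T) : E z = 0 := by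
  have hE : ∀ z, E z = cons X ((GrHom.id X).tens E (uncons X z)) := fun z => by
    rw [← h]
    conv_lhs => rw [eq_tone_add_cons (E z), h₀]
    exact (congrArg (· + _) (zero_smul 𝕜 (tone X))).trans (zero_add _)
  refine T_ext (f := E) (g := (0 : GrHom d X.T X.T)) ?_ ?_ z
  · rw [hE, uncons_tone, GrHom.map_zero, GrHom.map_zero]; rfl
  · intro i j x w _ _ ih
    rw [hE, uncons_cons, tens_tmk_of_deg_zero, ih, GrHom.zero_apply, tmk_zero, GrHom.map_zero]; rfl

/-- The defect E of the equation has no component in 𝕜 and satisfies uncons E = (1 ⊗ E) uncons,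
hence vanishes by `eq_zero_of_uncons`. The second property is a computation with uncons = p₁ ⋆ 1
that uses p₁D² from `p₁_coder_coder`. -/
theorem bar_curvature (z : A.X.T) : coder A.b₀ A.b₁ A.b₂ (coder A.b₀ A.b₁ A.b₂ z) =
    runit A.X.T ((GrHom.id A.X.T).tens A.barδ₀ (comul A.X z)) -
      lunit A.X.T (A.barδ₀.tens (GrHom.id A.X.T) (comul A.X z)) := by
  have hC := A.barObj_isCoalgebraWithCoderivation
  set D := coder A.b₀ A.b₁ A.b₂ with hD
  set I := GrHom.id A.X.T
  have hE := eq_zero_of_uncons (E := (D.comp D).cast (one_add_one_eq_two) -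
    (sr (comul A.X) I A.barδ₀).cast (zero_add 2) +
    (sl (comul A.X) A.barδ₀ I).cast (add_zero 2)) ?_ ?_ z
  · rw [← cv_apply, ← cv_apply, ← sr_apply, ← sl_apply]
    refine sub_eq_zero.1 (Eq.trans ?_ hE)
    rw [GrHom.add_apply, GrHom.sub_apply]
    exact sub_sub_eq_add_sub _ _ _ |>.trans (sub_add_eq_add_sub _ _ _).symm
  · intro z
    have e1 : proj₀ A.X (sr (comul A.X) I A.barδ₀ z) = A.barδ₀ z := by
      rw [map_sr, mul_zero, koszulSign_zero, one_smul, sr_apply, ← lunit_unit_eq_runit]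
      exact (congrArg (lunit _) (cv_congr (add_zero 0) rfl (fun _ => rfl) (fun _ => rfl) z)).trans
        (hC.sl_ε A.barδ₀ z)
    have e2 : proj₀ A.X (sl (comul A.X) A.barδ₀ I z) = A.barδ₀ z := by
      rw [map_sl, sl_apply, lunit_unit_eq_runit]
      exact (congrArg (runit _) (cv_congr rfl (add_zero 0) (fun _ => rfl) (fun _ => rfl) z)).trans
        (hC.sr_ε A.barδ₀ z)
    rw [GrHom.add_apply, GrHom.sub_apply, GrHom.cast_apply, GrHom.cast_apply, GrHom.cast_apply,
      GrHom.map_add, GrHom.map_sub, e1, e2, GrHom.comp_apply, hD, proj₀_coder, zero_sub,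
      neg_add_cancel]
  · intro z
    -- The mixed terms p₁D ⋆ D occur twice with opposite signs, D being odd.
    have e1 : uncons A.X (D (D z)) = cv (comul A.X) (p₁ A.X) (D.comp D) z +
        cv (comul A.X) (D.comp (D.comp (p₁ A.X))) I z := by
      rw [uncons_eq_cv, cv_coderivation hC.coleibniz, mul_zero, koszulSign_zero, one_smul,
        cv_coderivation hC.coleibniz, cv_coderivation hC.coleibniz, mul_zero, koszulSign_zero,
        one_smul, koszulSign_odd (by decide), neg_one_smul]
      have a1 : cv (comul A.X) (p₁ A.X) (D.comp (D.comp I)) z =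
          cv (comul A.X) (p₁ A.X) (D.comp D) z :=
        cv_congr rfl (by norm_num) (fun _ => rfl) (fun _ => rfl) z
      rw [a1]
      abel
    have e2 : uncons A.X (sr (comul A.X) I A.barδ₀ z) =
        cv (comul A.X) (p₁ A.X) (sr (comul A.X) I A.barδ₀) z := by
      rw [cv_sr_right hC.coassoc, map_sr, mul_zero, koszulSign_zero, one_smul, sr_apply, sr_apply]
      exact congrArg _ (cv_congr (by norm_num) rfl uncons_eq_cv (fun _ => rfl) z)
    have e3 : uncons A.X (sl (comul A.X) A.barδ₀ I z) =
        cv (comul A.X) (sl (comul A.X) A.barδ₀ (p₁ A.X)) I z := by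
      rw [cv_sl_left hC.coassoc, map_sl, sl_apply, sl_apply]
      exact congrArg _ (cv_congr rfl (by norm_num) (fun _ => rfl) uncons_eq_cv z)
    have e4 : cv (comul A.X) (D.comp (D.comp (p₁ A.X))) I z =
        cv (comul A.X) (sr (comul A.X) (p₁ A.X) A.barδ₀) I z -
          cv (comul A.X) (sl (comul A.X) A.barδ₀ (p₁ A.X)) I z := by
      have a : ∀ w, (D.comp (D.comp (p₁ A.X))) w = ((sr (comul A.X) (p₁ A.X) A.barδ₀).cast
          (by norm_num) - (sl (comul A.X) A.barδ₀ (p₁ A.X)).cast (by norm_num) :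
          GrHom 2 A.X.T A.X) w := A.p₁_coder_coder
      rw [cv_congr (by norm_num) rfl a (fun _ => rfl), cv_sub_left, cv_cast_left, cv_cast_left]
    -- The terms with δ₀ between p₁ and 1, one from p₁D² and one from 1 ⊗ E, coincide by
    -- coassociativity and cancel.
    have e5 : cv (comul A.X) (p₁ A.X) (sl (comul A.X) A.barδ₀ I) z =
        cv (comul A.X) (sr (comul A.X) (p₁ A.X) A.barδ₀) I z := cv_sl_right hC.coassoc _ _ _ _
    rw [uncons_eq_cv z, id_tens_cv, GrHom.add_apply, GrHom.sub_apply, GrHom.cast_apply,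
      GrHom.cast_apply, GrHom.cast_apply, GrHom.comp_apply, GrHom.map_add, GrHom.map_sub, e1, e2,
      e3, e4]
    rw [cv_id_comp, cv_add_right, cv_sub_right, cv_cast_right, cv_cast_right, cv_cast_right, e5]
    abel

theorem barObj_isCurvedAugmented : A.barObj.IsCurvedAugmented where
  coassoc := comul_coassoc
  coleibniz := coder_coleibniz _ _ _
  curvature := A.bar_curvature
  bianchi := A.bar_bianchi
  counit_right := comul_counit_right
  counit_left := comul_counit_left
  ε_δ₁ := proj₀_coder _ _ _
  δ₂_w := comul_tone
  conilpotent x := by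
    obtain ⟨N, hN⟩ := exists_cvIter_comul_eq_zero (pr := A.barObj.pr) A.barObj.pr_w
      (A.barObj.incl x)
    -- Conilpotency asks for an iterate of index at least one.
    refine ⟨max N 1, le_max_right _ _, ?_⟩
    have h := CoalgData.redIter_pr (C := A.barObj) comul_tone (max N 1) (A.barObj.incl x)
    rw [CoalgData.pr_incl] at h
    exact h.trans (hN _ (le_max_left _ _))

/-- The bar construction as a curved coalgebra. -/
noncomputable abbrev barCoalg : CACoalg 𝒦 := ⟨A.barObj, A.barObj_isCurvedAugmented⟩

/-! ### Morphisms into the bar construction from twisting cochains. -/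

section Criterion

variable {A} {C : CACoalg 𝒦} {G : GrHom 0 C.C A.X.T} {g₀ : GrHom 1 C.C (GrMod.unit 𝒦)}
  (hG : ∀ c, G.tens G (C.δ₂ c) = comul A.X (G c)) (hε : ∀ c, proj₀ A.X (G c) = C.ε c)
  (hτ : IsTwisting C.toCoalgData A.toAlgData
    ((G.comp A.barTwist).cast (zero_add 1) + (g₀.comp A.η).cast (add_zero 1)))
include hG hε hτ

/-- The difference between the Maurer-Cartan equation assumed here and that of `barTwist` at `G c`.
Its components along v and in Ā[1] yield the morphism conditions for δ₀ and, on cogenerators, for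
δ₁. -/
theorem barTwist_coder_of_isTwisting (c : C.C) :
    A.barTwist (coder A.b₀ A.b₁ A.b₂ (G c)) = A.barTwist (G (C.δ₁ c)) +
      (A.barδ₀ (G c) - (C.δ₀ c - g₀ (C.δ₁ c) - sl C.δ₂ g₀ g₀ c) : 𝕜) • A.one +
      sr C.δ₂ (G.comp A.barTwist) g₀ c + sl C.δ₂ g₀ (G.comp A.barTwist) c := by
  have hA := A.isUnitComplementedCurved.isAlgebraWithDerivation
  have h := hτ c
  have h2 : A.m₂ (cv C.δ₂ ((G.comp A.barTwist).cast (zero_add 1) + (g₀.comp A.η).cast (add_zero 1))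
      ((G.comp A.barTwist).cast (zero_add 1) + (g₀.comp A.η).cast (add_zero 1)) c) =
      A.m₂ (cv (comul A.X) A.barTwist A.barTwist (G c)) +
      sr C.δ₂ (G.comp A.barTwist) g₀ c + sl C.δ₂ g₀ (G.comp A.barTwist) c +
      (sl C.δ₂ g₀ g₀ c : 𝕜) • A.one := by
    rw [cv_add_left, cv_add_right, cv_add_right, cv_map hG]
    simp only [cv_cast_left, cv_cast_right, GrHom.map_add, hA.m₂_cv_η_left, hA.m₂_cv_η_right]
    have e : (sl C.δ₂ g₀ g₀ c : 𝕜) • A.one = sl C.δ₂ g₀ (g₀.comp A.η) c :=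
      map_sl (δ := C.δ₂) g₀ g₀ A.η c
    rw [e]
    abel
  have h3 : A.m₁ (A.barTwist (G c)) = (A.barδ₀ (G c) : 𝕜) • A.one -
      A.barTwist (coder A.b₀ A.b₁ A.b₂ (G c)) -
      A.m₂ (cv (comul A.X) A.barTwist A.barTwist (G c)) + (proj₀ A.X (G c) : 𝕜) • A.m₀ :=
    A.isTwisting_barTwist (G c)
  rw [h2] at h
  have h4 : A.m₁ (A.barTwist (G c) + (g₀ c : 𝕜) • A.one) = (C.δ₀ c : 𝕜) • A.one -
      (A.barTwist (G (C.δ₁ c)) + (g₀ (C.δ₁ c) : 𝕜) • A.one) -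
      (A.m₂ (cv (comul A.X) A.barTwist A.barTwist (G c)) +
      sr C.δ₂ (G.comp A.barTwist) g₀ c + sl C.δ₂ g₀ (G.comp A.barTwist) c +
      (sl C.δ₂ g₀ g₀ c : 𝕜) • A.one) + (C.ε c : 𝕜) • A.m₀ := h
  rw [GrHom.map_add, GrHom.map_smul, hA.m₁_one, smul_zero, add_zero, h3, hε] at h4
  rw [sub_smul, sub_smul, sub_smul]
  refine sub_eq_zero.1 (Eq.trans ?_ (sub_eq_zero.2 h4.symm))
  abel

theorem barδ₀_of_isTwisting (c : C.C) :
    C.δ₀ c - g₀ (C.δ₁ c) - sl C.δ₂ g₀ g₀ c = A.barδ₀ (G c) := by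
  have h := congrArg A.v (barTwist_coder_of_isTwisting hG hε hτ c)
  have e1 : ∀ c, ((G.comp A.barTwist).comp A.v) c = (0 : GrHom 1 C.C (GrMod.unit 𝒦)) c :=
    fun z => A.v_lift _
  have e2 : A.v (sr C.δ₂ (G.comp A.barTwist) g₀ c) = 0 := by
    rw [map_sr, mul_zero, koszulSign_zero, one_smul, sr_apply,
      cv_congr (by norm_num) rfl e1 (fun _ => rfl), cv_apply, tens_zero_left, GrHom.map_zero]
  have e3 : A.v (sl C.δ₂ g₀ (G.comp A.barTwist) c) = 0 := by
    rw [map_sl, sl_apply,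
      cv_congr rfl (by norm_num) (fun _ => rfl) e1, cv_apply, tens_zero_right, GrHom.map_zero]
  rw [barTwist_apply, v_lift, GrHom.map_add, GrHom.map_add, GrHom.map_add, e2, e3, GrHom.map_smul,
    A.v_one, barTwist_apply, v_lift, zero_add, add_zero, add_zero] at h
  exact (sub_eq_zero.1 (h.trans (_root_.mul_one (_ : 𝕜))).symm).symm

theorem p₁_coder_of_isTwisting (c : C.C) : p₁ A.X (coder A.b₀ A.b₁ A.b₂ (G c)) =
    p₁ A.X (G (C.δ₁ c)) + sl C.δ₂ g₀ (G.comp (p₁ A.X)) c - sr C.δ₂ (G.comp (p₁ A.X)) g₀ c := by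
  have h := congrArg A.proj (barTwist_coder_of_isTwisting hG hε hτ c)
  have e1 : ∀ z, ((G.comp A.barTwist).comp A.proj) z = (G.comp (p₁ A.X)) z :=
    fun z => A.proj_lift _
  rw [barTwist_apply, proj_lift, GrHom.map_add, GrHom.map_add, GrHom.map_add, GrHom.map_smul,
    proj_one, smul_zero, barTwist_apply, proj_lift, add_zero, map_sr, map_sl,
    koszulSign_odd (by decide), neg_one_smul] at h
  rw [h, sr_apply, sl_apply, cv_congr (by norm_num) rfl e1 (fun _ => rfl),
    cv_congr rfl (by norm_num) (fun _ => rfl) e1, sr_apply, sl_apply]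
  abel

/-- The defect E has no component in 𝕜, and the computation of `bar_curvature` adapted to G gives E
= cons (γ ⋆ E), where γ is the component of G on generators. The source is no longer a tensor
coalgebra, so conilpotency of C replaces induction on words. -/
theorem coder_of_isTwisting (hw : G C.w = tone A.X) (c : C.C) :
    G (C.δ₁ c) + (sl C.δ₂ g₀ G c - sr C.δ₂ G g₀ c) = coder A.b₀ A.b₁ A.b₂ (G c) := by
  have hC := C.isCurvedAugmented
  have hB := A.barObj_isCoalgebraWithCoderivation
  set D := coder A.b₀ A.b₁ A.b₂ with hD
  set γ := (G.comp (p₁ A.X)).cast (zero_add 0) with hγ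
  set E : GrHom 1 C.C A.X.T := (C.δ₁.comp G).cast (add_zero 1) +
    ((sl C.δ₂ g₀ G).cast (add_zero 1) - (sr C.δ₂ G g₀).cast (zero_add 1)) -
    (G.comp D).cast (zero_add 1) with hE
  have hγw : γ C.w = 0 := (congrArg (p₁ A.X) hw).trans p₁_tone
  have e0 : ∀ c, proj₀ A.X (E c) = 0 := by
    intro c
    have e1 : proj₀ A.X (sr C.δ₂ G g₀ c) = g₀ c := by
      rw [map_sr, mul_zero, koszulSign_zero, one_smul, sr_apply, ← lunit_unit_eq_runit]
      exact (congrArg (lunit _) (cv_congr (add_zero 0) rfl hε (fun _ => rfl) c)).trans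
        (hC.isCoalgebraWithCoderivation.sl_ε g₀ c)
    have e2 : proj₀ A.X (sl C.δ₂ g₀ G c) = g₀ c := by
      rw [map_sl, sl_apply, lunit_unit_eq_runit]
      exact (congrArg (runit _) (cv_congr rfl (add_zero 0) (fun _ => rfl) hε c)).trans
        (hC.isCoalgebraWithCoderivation.sr_ε g₀ c)
    rw [hE, GrHom.sub_apply, GrHom.add_apply, GrHom.sub_apply, GrHom.cast_apply, GrHom.cast_apply,
      GrHom.cast_apply, GrHom.cast_apply, GrHom.map_sub, GrHom.map_add, GrHom.map_sub, e1, e2,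
      GrHom.comp_apply, GrHom.comp_apply, hε, hC.ε_δ₁, hD, proj₀_coder, sub_self, add_zero,
      sub_zero]
  have eG : ∀ c, uncons A.X (G c) = cv C.δ₂ γ G c := fun c => by
    rw [uncons_eq_cv, cv_map hG]
    exact cv_congr (add_zero 0) (add_zero 0) (fun _ => rfl) (fun _ => rfl) c
  have e1 : ∀ c, uncons A.X (E c) = cv C.δ₂ γ E c := by
    intro c
    have u1 : uncons A.X (G (C.δ₁ c)) = cv C.δ₂ γ (C.δ₁.comp G) c +
        cv C.δ₂ (C.δ₁.comp γ) G c := by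
      rw [eG, cv_coderivation hC.coleibniz, mul_zero, koszulSign_zero, one_smul]
    have u2 : uncons A.X (sl C.δ₂ g₀ G c) = cv C.δ₂ (sl C.δ₂ g₀ γ) G c := by
      rw [cv_sl_left hC.coassoc, map_sl, sl_apply, sl_apply]
      exact congrArg _ (cv_congr rfl (add_zero 0) (fun _ => rfl) eG c)
    have u3 : uncons A.X (sr C.δ₂ G g₀ c) = cv C.δ₂ γ (sr C.δ₂ G g₀) c := by
      rw [cv_sr_right hC.coassoc, map_sr, mul_zero, koszulSign_zero, one_smul, sr_apply, sr_apply]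
      exact congrArg _ (cv_congr (add_zero 0) rfl eG (fun _ => rfl) c)
    have u4 : uncons A.X (D (G c)) = cv C.δ₂ γ (G.comp D) c +
        cv C.δ₂ (G.comp (D.comp (p₁ A.X))) G c := by
      rw [uncons_eq_cv, cv_coderivation hB.coleibniz, mul_zero, koszulSign_zero, one_smul]
      change cv (comul A.X) _ _ (G c) + cv (comul A.X) _ _ (G c) = _
      rw [cv_map hG, cv_map hG]
      exact congrArg₂ (· + ·) (cv_congr (zero_add 0) (by norm_num) (fun _ => rfl) (fun _ => rfl) c)
        (cv_congr rfl (add_zero 0) (fun _ => rfl) (fun _ => rfl) c)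
    have u5 : cv C.δ₂ (G.comp (D.comp (p₁ A.X))) G c = cv C.δ₂ (C.δ₁.comp γ) G c +
        cv C.δ₂ (sl C.δ₂ g₀ γ) G c - cv C.δ₂ (sr C.δ₂ γ g₀) G c := by
      have a : ∀ c, (G.comp (D.comp (p₁ A.X))) c = ((C.δ₁.comp γ).cast (add_zero 1) +
          (sl C.δ₂ g₀ γ).cast (add_zero 1) - (sr C.δ₂ γ g₀).cast (zero_add 1) :
          GrHom 1 C.C A.X) c := fun c => by
        refine (p₁_coder_of_isTwisting hG hε hτ c).trans ?_
        rw [GrHom.sub_apply, GrHom.add_apply, GrHom.cast_apply, GrHom.cast_apply,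
          GrHom.cast_apply, sl_apply, sr_apply, sl_apply, sr_apply, hγ, cv_cast_left,
          cv_cast_right]
        rfl
      rw [cv_congr (by norm_num) rfl a (fun _ => rfl), cv_sub_left, cv_add_left, cv_cast_left,
        cv_cast_left, cv_cast_left]
    have u6 : cv C.δ₂ γ (sl C.δ₂ g₀ G) c = cv C.δ₂ (sr C.δ₂ γ g₀) G c :=
      cv_sl_right hC.coassoc _ _ _ _
    rw [hE, cv_sub_right, cv_add_right, cv_sub_right, GrHom.sub_apply, GrHom.add_apply,
      GrHom.sub_apply, GrHom.map_sub, GrHom.map_add, GrHom.map_sub]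
    simp only [GrHom.cast_apply, cv_cast_right]
    rw [GrHom.comp_apply, GrHom.comp_apply, u1, u2, u3, u4, u5, u6]
    abel
  have e2 : ∀ c, E c = cons A.X (cv C.δ₂ γ E c) := fun c => by
    rw [← e1]
    conv_lhs => rw [eq_tone_add_cons (E c), e0]
    exact (congrArg (· + _) (zero_smul 𝕜 (tone A.X))).trans (zero_add _)
  have hEw : E C.w = 0 := by
    rw [e2, CoalgData.cv_w hC.δ₂_w, hγw, zero_tmk, GrHom.map_zero]
  exact sub_eq_zero.1 (hC.eq_zero_of_recursion hEw hγw (cons A.X) e2 c)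

/-- The morphism of curved coalgebras to the bar construction given by a twisting cochain. -/
noncomputable def barDesc (hw : G C.w = tone A.X) : CACoalg.Hom C A.barCoalg where
  g₁ := G
  g₀ := g₀
  map_δ₂ := hG
  map_δ₁ := coder_of_isTwisting hG hε hτ hw
  map_δ₀ := barδ₀_of_isTwisting hG hε hτ
  map_ε := hε
  map_w := hw

end Criterion

end UCCAlg

end BarCoalgebra

/-! ### Functoriality of the bar construction and the adjunction. -/

section Adjunction

variable {𝕜 : Type u} [Ring 𝕜] {𝒦 : ℤ → AddSubgroup 𝕜} [GradedRing 𝒦]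
  [IsGradedStronglyCommutative 𝒦]

open GrHom TensorConstr

namespace UCCAlg

variable {A B D : UCCAlg 𝒦}

theorem barMap₀_apply (f : Hom A B) (z : A.X.T) : (barMap₀ f z : 𝕜) =
    (proj₀ A.X z : 𝕜) * f.und + (B.v (f.f₁ (A.barTwist z)) : 𝕜) :=
  (ofLow_apply _ _ _ z).trans (add_zero _)

theorem barMap₀_tone (f : Hom A B) : (barMap₀ f (tone A.X) : 𝕜) = f.und := by
  rw [barMap₀_apply, barTwist_tone, GrHom.map_zero, GrHom.map_zero, proj₀_tone, one_mul]
  exact add_zero _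

theorem barTwist_barMap₁ (f : Hom A B) (z : A.X.T) : B.barTwist (barMap₁ f z) =
    f.f₁ (A.barTwist z) - (B.v (f.f₁ (A.barTwist z)) : 𝕜) • B.one := by
  rw [barTwist_apply, barMap₁, p₁_map]
  exact B.lift_proj _

/-- The v-part lost in `barMap₁` is restored by `barMap₀`. Hence pulling back the universal cochain
of B along Bar f agrees with pushing forward that of A along f, up to the term ε·und. -/
theorem barTwist_barMap (f : Hom A B) (z : A.X.T) :
    B.barTwist (barMap₁ f z) + (barMap₀ f z : 𝕜) • B.one =
      f.f₁ (A.barTwist z) + ((proj₀ A.X z : 𝕜) * f.und) • B.one := by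
  rw [barTwist_barMap₁, barMap₀_apply, add_smul]
  abel

/-- By `barTwist_barMap`, this cochain is the universal one pushed forward along f and pulled back
along (id, ε·und). -/
theorem isTwisting_barMap (f : Hom A B) : IsTwisting A.barObj B.toAlgData
    (((barMap₁ f).comp B.barTwist).cast (zero_add 1) + ((barMap₀ f).comp B.η).cast (add_zero 1)) := by
  have h := CACoalg.isTwisting_pull (C := A.barCoalg)
    B.isUnitComplementedCurved.isAlgebraWithDerivation
    (A.isTwisting_barTwist.push f.map_m₂ f.map_m₁ f.map_m₀ f.map_one)
    (CACoalg.scalarHom A.barCoalg f.und_mem)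
  have e : ((barMap₁ f).comp B.barTwist).cast (zero_add 1) +
      ((barMap₀ f).comp B.η).cast (add_zero 1) =
      CACoalg.pull (CACoalg.scalarHom A.barCoalg f.und_mem)
        ((A.barTwist.comp f.f₁).cast (add_zero 1)) := GrHom.ext (barTwist_barMap f)
  rw [e]
  exact h

/-- The bar construction on morphisms. -/
noncomputable def barMap (f : Hom A B) : CACoalg.Hom A.barCoalg B.barCoalg :=
  barDesc (C := A.barCoalg) (G := barMap₁ f) (g₀ := barMap₀ f) (comul_map _) (proj₀_map _)
    (isTwisting_barMap f) (map_tone _)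

variable (𝒦) in
/-- The bar functor. -/
noncomputable def barFunctor : UCCAlg 𝒦 ⥤ CACoalg 𝒦 where
  obj := barCoalg
  map f := barMap f
  map_id A := by
    refine CACoalg.Hom.ext (GrHom.ext fun z => ?_) (GrHom.ext fun z => ?_)
    · exact map_id _ (fun x => A.proj_lift x) z
    · refine (barMap₀_apply (𝟙 A : Hom A A) z).trans ?_
      exact (congrArg₂ (· + ·) (mul_zero _) (A.v_lift _)).trans (add_zero _)
  map_comp {A B D} f g := by
    refine CACoalg.Hom.ext (GrHom.ext fun z => ?_) (GrHom.ext fun z => ?_)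
    · refine map_comp _ _ _ (fun x => ?_) z
      -- The two sides differ by a multiple of the unit, which g preserves and the last projection
      -- kills.
      change D.proj (Hom.f₁ g (Hom.f₁ f (A.lift x))) =
        D.proj (Hom.f₁ g (B.lift (B.proj (Hom.f₁ f (A.lift x)))))
      rw [lift_proj, GrHom.map_sub, GrHom.map_smul, Hom.map_one, GrHom.map_sub, GrHom.map_smul,
        proj_one, smul_zero, sub_zero]
    · refine (barMap₀_apply (f ≫ g : Hom A D) z).trans ?_
      -- The v-part contributed by `barMap₀ f` cancels against the multiple of the unit removed by
      -- `barMap₁ f`, on which `g` and v act trivially.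
      have h : (barMap₀ f z : 𝕜) + barMap₀ g (barMap₁ f z) =
          (proj₀ A.X z : 𝕜) * (Hom.und g + Hom.und f) +
            D.v (Hom.f₁ g (Hom.f₁ f (A.barTwist z))) := by
        rw [barMap₀_apply, barMap₀_apply, barTwist_barMap₁, GrHom.map_sub, GrHom.map_smul,
          Hom.map_one, GrHom.map_sub, GrHom.map_smul, D.v_one, barMap₁, proj₀_map, mul_add,
          smul_eq_mul, _root_.mul_one]
        change (_ + _ + (_ + (_ - _)) : 𝕜) = _
        abel
      exact h.symm

end UCCAlg

/-- The twisting cochains `C → A` vanishing on `w`. -/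
def TwistingCochain (C : CACoalg 𝒦) (A : UCCAlg 𝒦) : Type u :=
  {τ : GrHom 1 C.C A.A // IsTwisting C.toCoalgData A.toAlgData τ ∧ τ C.w = 0}

/-! ### Both Hom sets as sets of twisting cochains. -/

namespace TwistingCochain

variable {C : CACoalg 𝒦} {A : UCCAlg 𝒦}

/-- The homomorphism from the cobar construction corresponding to a twisting cochain. -/
noncomputable def toAlg (τ : TwistingCochain C A) : GrHom 0 C.X.T A.A :=
  algLift A.toAlgData ((C.lift.comp τ.1).cast (by norm_num))

/-- The condition τ(w) = 0 enters here: `cobarTwist` sees only C̄, so a homomorphism cannot remember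
a value at w. -/
theorem toAlg_cobarTwist (τ : TwistingCochain C A) (c : C.C) :
    τ.toAlg (C.cobarTwist c) = τ.1 c := by
  rw [CACoalg.cobarTwist_apply, gen_eq_cons, toAlg, algLift_cons, algLift_tone,
    A.isUnitComplementedCurved.mul_one]
  refine (CACoalg.map_lift_proj τ.1 c).trans ?_
  rw [τ.2.2, smul_zero, sub_zero]

/-- Twisting cochains correspond to homomorphisms from the cobar construction. -/
noncomputable def cobarEquiv (C : CaCoalg 𝒦) (A : UccAlg 𝒦) :
    ((⟨C.obj.cobar⟩ : UccAlg 𝒦) ⟶ A) ≃ TwistingCochain C.obj A.obj where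
  toFun f := ⟨(C.obj.cobarTwist.comp (UCCAlg.Hom.f₁ f.hom)).cast (add_zero 1),
    C.obj.isTwisting_cobarTwist.push (UCCAlg.Hom.map_m₂ f.hom) (UCCAlg.Hom.map_m₁ f.hom)
      (UCCAlg.Hom.map_m₀ f.hom) (UCCAlg.Hom.map_one f.hom),
    (congrArg (UCCAlg.Hom.f₁ f.hom) C.obj.cobarTwist_w).trans (GrHom.map_zero _)⟩
  invFun τ := ⟨CACoalg.cobarDesc τ.toAlg
    (algLift_mul A.obj.isUnitComplementedCurved.isAlgebraWithDerivation _) (algLift_tone _)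
    (by
      have e : (C.obj.cobarTwist.comp τ.toAlg).cast (add_zero 1) = τ.1 :=
        GrHom.ext τ.toAlg_cobarTwist
      rw [e]
      exact τ.2.1) (zero_mem (𝒦 1)), rfl⟩
  left_inv f := by
    refine WideSubcategory.hom_ext _ (CACoalg.cobar_hom_ext (fun c => ?_) f.property.symm)
    exact toAlg_cobarTwist _ c
  right_inv τ := Subtype.ext (GrHom.ext τ.toAlg_cobarTwist)

/-- The component on the generators of the coalgebra map to the bar construction corresponding to
a twisting cochain. -/
def toGen (τ : TwistingCochain C A) : GrHom 0 C.C A.X := (τ.1.comp A.proj).cast (by norm_num)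

theorem toGen_w (τ : TwistingCochain C A) : τ.toGen C.w = 0 :=
  (congrArg A.proj τ.2.2).trans (GrHom.map_zero _)

/-- The functional corresponding to a twisting cochain. -/
def toUnit (τ : TwistingCochain C A) : GrHom 1 C.C (GrMod.unit 𝒦) :=
  (τ.1.comp A.v).cast (add_zero 1)

/-- The coalgebra map to the bar construction corresponding to a twisting cochain. -/
noncomputable def toCoalg (τ : TwistingCochain C A) : GrHom 0 C.C A.X.T :=
  comap C.isCurvedAugmented τ.toGen_w

/-- `toGen` and `toUnit` are the components of τ along A = Ā ⊕ 𝕜·1, and pulling back the universal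
cochain adds them up. -/
theorem barTwist_toCoalg (τ : TwistingCochain C A) (c : C.C) :
    A.barTwist (τ.toCoalg c) + (τ.toUnit c : 𝕜) • A.one = τ.1 c := by
  rw [UCCAlg.barTwist_apply, toCoalg, p₁_comap]
  refine (congrArg (· + _) (A.lift_proj (τ.1 c))).trans ?_
  exact sub_add_cancel _ _

/-- The morphism to the bar construction corresponding to a twisting cochain. -/
noncomputable def toBar (τ : TwistingCochain C A) : CACoalg.Hom C A.barCoalg :=
  UCCAlg.barDesc (G := τ.toCoalg) (g₀ := τ.toUnit) (comul_comap _ _) (proj₀_comap _ _)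
    (by
      have e : (τ.toCoalg.comp A.barTwist).cast (zero_add 1) +
          (τ.toUnit.comp A.η).cast (add_zero 1) = τ.1 := GrHom.ext τ.barTwist_toCoalg
      rw [e]
      exact τ.2.1) (comap_w _ _)

/-- The pullback of a twisting cochain. -/
def pull {C D : CaCoalg 𝒦} (f : C ⟶ D) (τ : TwistingCochain D.obj A) :
    TwistingCochain C.obj A :=
  ⟨CACoalg.pull f.hom τ.1, CACoalg.isTwisting_pull
    A.isUnitComplementedCurved.isAlgebraWithDerivation τ.2.1 f.hom, by
      rw [CACoalg.pull_apply, CACoalg.Hom.map_w, τ.2.2, zero_add]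
      exact (congrArg (fun r : 𝕜 => r • A.one) f.property).trans (zero_smul _ _)⟩

/-- The universal twisting cochain of the bar construction. -/
noncomputable def ofBar (A : UCCAlg 𝒦) : TwistingCochain A.barCoalg A :=
  ⟨A.barTwist, A.isTwisting_barTwist, A.barTwist_tone⟩

/-- The pushforward of a twisting cochain. -/
def push {A B : UCCAlg 𝒦} (τ : TwistingCochain C A) (f : UCCAlg.Hom A B) : TwistingCochain C B :=
  ⟨(τ.1.comp f.f₁).cast (add_zero 1), τ.2.1.push f.map_m₂ f.map_m₁ f.map_m₀ f.map_one,
    (congrArg f.f₁ τ.2.2).trans (GrHom.map_zero _)⟩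

/-- Twisting cochains correspond to morphisms to the bar construction. -/
noncomputable def barEquiv (C : CaCoalg 𝒦) (A : UccAlg 𝒦) :
    (C ⟶ (⟨A.obj.barCoalg⟩ : CaCoalg 𝒦)) ≃ TwistingCochain C.obj A.obj where
  toFun g := pull g (ofBar A.obj)
  invFun τ := ⟨τ.toBar, congrArg A.obj.v τ.2.2 |>.trans (GrHom.map_zero _)⟩
  left_inv g := by
    refine WideSubcategory.hom_ext _ (CACoalg.Hom.ext (GrHom.ext fun c => ?_)
      (GrHom.ext fun c => ?_))
    -- Both coalgebra maps have the same component on generators, hence agree by cofreeness.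
    · refine eq_of_recursion C.obj.isCurvedAugmented (toGen_w _)
        (comap_recursion C.obj.isCurvedAugmented (toGen_w (pull g (ofBar A.obj))))
        (coalgHom_recursion (CACoalg.Hom.map_δ₂ g.hom) (CACoalg.Hom.map_ε g.hom) fun c => ?_) c
      change _ = A.obj.proj (A.obj.barTwist (CACoalg.Hom.g₁ g.hom c) +
        (CACoalg.Hom.g₀ g.hom c : 𝕜) • A.obj.one)
      rw [GrHom.map_add, GrHom.map_smul, UCCAlg.proj_one, smul_zero, add_zero,
        UCCAlg.barTwist_apply, UCCAlg.proj_lift]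
    · change A.obj.v (A.obj.barTwist (CACoalg.Hom.g₁ g.hom c) +
        (CACoalg.Hom.g₀ g.hom c : 𝕜) • A.obj.one) = _
      rw [GrHom.map_add, GrHom.map_smul, UCCAlg.barTwist_apply, UCCAlg.v_lift, A.obj.v_one,
        zero_add]
      exact _root_.mul_one (_ : 𝕜)
  right_inv τ := Subtype.ext (GrHom.ext τ.barTwist_toCoalg)

/-- Precomposition becomes pullback because w f₀ = 0; in general `cobarMap₁_cobarTwist` would
contribute an additional multiple of ε. -/
theorem cobarEquiv_comp_left {C D : CaCoalg 𝒦} {A : UccAlg 𝒦} (f : C ⟶ D)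
    (g : (⟨D.obj.cobar⟩ : UccAlg 𝒦) ⟶ A) (f' : (⟨C.obj.cobar⟩ : UccAlg 𝒦) ⟶ ⟨D.obj.cobar⟩)
    (hf : f'.hom = CACoalg.cobarMap f.hom) :
    cobarEquiv C A (f' ≫ g) = pull f (cobarEquiv D A g) := by
  refine Subtype.ext (GrHom.ext fun c => ?_)
  change UCCAlg.Hom.f₁ g.hom (UCCAlg.Hom.f₁ f'.hom (C.obj.cobarTwist c)) = _
  rw [hf]
  change UCCAlg.Hom.f₁ g.hom (CACoalg.cobarMap₁ f.hom (C.obj.cobarTwist c)) =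
    UCCAlg.Hom.f₁ g.hom (D.obj.cobarTwist (CACoalg.Hom.g₁ f.hom c)) +
      (CACoalg.Hom.g₀ f.hom c : 𝕜) • A.obj.one
  rw [CACoalg.cobarMap₁_cobarTwist, show CACoalg.Hom.und f.hom = 0 from f.property, mul_zero,
    sub_zero]
  have key : ∀ (k : UCCAlg.Hom D.obj.cobar A.obj) (z : D.obj.X.T) (r : 𝕜),
      k.f₁ (z + r • tone D.obj.X) = k.f₁ z + r • A.obj.one := fun k z r => by
    rw [GrHom.map_add, GrHom.map_smul]
    exact congrArg (fun t => k.f₁ z + r • t) k.map_one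
  exact key g.hom _ _

theorem cobarEquiv_comp_right {C : CaCoalg 𝒦} {A B : UccAlg 𝒦}
    (f : (⟨C.obj.cobar⟩ : UccAlg 𝒦) ⟶ A) (g : A ⟶ B) :
    cobarEquiv C B (f ≫ g) = push (cobarEquiv C A f) g.hom := rfl

theorem barEquiv_comp_left {C D : CaCoalg 𝒦} {A : UccAlg 𝒦} (f : C ⟶ D)
    (g : D ⟶ (⟨A.obj.barCoalg⟩ : CaCoalg 𝒦)) :
    barEquiv C A (f ≫ g) = pull f (barEquiv D A g) :=
  Subtype.ext (GrHom.ext fun c => CACoalg.pull_comp f.hom g.hom _ c)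

/-- Postcomposition becomes pushforward because the scalar component of g is zero, which removes the
term ε·und of `barTwist_barMap`. -/
theorem barEquiv_comp_right {C : CaCoalg 𝒦} {A B : UccAlg 𝒦}
    (f : C ⟶ (⟨A.obj.barCoalg⟩ : CaCoalg 𝒦)) (g : A ⟶ B)
    (g' : (⟨A.obj.barCoalg⟩ : CaCoalg 𝒦) ⟶ ⟨B.obj.barCoalg⟩)
    (hg : g'.hom = UCCAlg.barMap g.hom) :
    barEquiv C B (f ≫ g') = push (barEquiv C A f) g.hom := by
  refine Subtype.ext (GrHom.ext fun c => ?_)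
  refine (CACoalg.pull_comp f.hom g'.hom _ c).trans ?_
  rw [hg, CACoalg.pull_apply, CACoalg.pull_apply]
  refine (congrArg (· + _) (UCCAlg.barTwist_barMap g.hom (CACoalg.Hom.g₁ f.hom c))).trans ?_
  rw [show UCCAlg.Hom.und g.hom = 0 from g.property, mul_zero, zero_smul, add_zero]
  change _ = UCCAlg.Hom.f₁ g.hom (A.obj.barTwist (CACoalg.Hom.g₁ f.hom c) +
    (CACoalg.Hom.g₀ f.hom c : 𝕜) • A.obj.one)
  rw [GrHom.map_add, GrHom.map_smul, UCCAlg.Hom.map_one]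

end TwistingCochain

variable (𝒦) in
/-- The bar functor restricted to the morphisms with vanishing scalar component. -/
noncomputable def barRestricted : UccAlg 𝒦 ⥤ CaCoalg 𝒦 where
  obj A := ⟨A.obj.barCoalg⟩
  map f := ⟨UCCAlg.barMap f.hom, (UCCAlg.barMap₀_tone f.hom).trans f.property⟩
  map_id A := WideSubcategory.hom_ext _ ((UCCAlg.barFunctor 𝒦).map_id A.obj)
  map_comp f g := WideSubcategory.hom_ext _ ((UCCAlg.barFunctor 𝒦).map_comp f.hom g.hom)

variable (𝒦) in
/-- The cobar functor restricted to the morphisms with vanishing scalar component. -/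
noncomputable def cobarRestricted : CaCoalg 𝒦 ⥤ UccAlg 𝒦 where
  obj C := ⟨C.obj.cobar⟩
  map g := ⟨CACoalg.cobarMap g.hom, g.property⟩
  map_id C := WideSubcategory.hom_ext _ ((CACoalg.cobarFunctor 𝒦).map_id C.obj)
  map_comp f g := WideSubcategory.hom_ext _ ((CACoalg.cobarFunctor 𝒦).map_comp f.hom g.hom)

open TwistingCochain in
variable (𝒦) in
/-- The adjunction between the cobar and the bar functor. -/
noncomputable def cobarBarAdjunction : cobarRestricted 𝒦 ⊣ barRestricted 𝒦 :=
  Adjunction.mkOfHomEquiv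
    { homEquiv := fun C A => (cobarEquiv C A).trans (barEquiv C A).symm
      homEquiv_naturality_left_symm := fun {C D A} f g => by
        -- Compared as twisting cochains: precomposition is pullback on both sides.
        refine (cobarEquiv C A).injective ?_
        exact ((cobarEquiv C A).apply_symm_apply _).trans ((barEquiv_comp_left f g).trans
          ((congrArg (pull f) ((cobarEquiv D A).apply_symm_apply (barEquiv D A g)).symm).trans
            (cobarEquiv_comp_left f _ ((cobarRestricted 𝒦).map f) rfl).symm))
      homEquiv_naturality_right := fun {C A B} f g => by
        -- Compared as twisting cochains: postcomposition is pushforward on both sides.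
        refine (barEquiv C B).injective ?_
        exact ((barEquiv C B).apply_symm_apply _).trans ((cobarEquiv_comp_right f g).trans
          ((congrArg (fun τ => push τ g.hom)
            ((barEquiv C A).apply_symm_apply (cobarEquiv C A f)).symm).trans
            (barEquiv_comp_right _ g ((barRestricted 𝒦).map g) rfl).symm)) }

end Adjunction

theorem mainTheorem2 {𝕜 : Type u} [Ring 𝕜] (𝒦 : ℤ → AddSubgroup 𝕜) [GradedRing 𝒦]
    [IsGradedStronglyCommutative 𝒦] :
    ∃ (Bar : UCCAlg 𝒦 ⥤ CACoalg 𝒦) (Cobar : CACoalg 𝒦 ⥤ UCCAlg 𝒦),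
      IsBarConstruction Bar ∧ IsCobarConstruction Cobar ∧
      ∃ (bar : UccAlg 𝒦 ⥤ CaCoalg 𝒦) (cobar : CaCoalg 𝒦 ⥤ UccAlg 𝒦),
        bar ⋙ wideSubcategoryInclusion (caMorphisms 𝒦) =
          wideSubcategoryInclusion (uccMorphisms 𝒦) ⋙ Bar ∧
        cobar ⋙ wideSubcategoryInclusion (uccMorphisms 𝒦) =
          wideSubcategoryInclusion (caMorphisms 𝒦) ⋙ Cobar ∧
        Nonempty (cobar ⊣ bar) :=
  ⟨UCCAlg.barFunctor 𝒦, CACoalg.cobarFunctor 𝒦,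
    ⟨fun _ => rfl, fun _ => HEq.rfl, fun _ => HEq.rfl⟩,
    ⟨fun _ => rfl, fun _ => HEq.rfl, fun _ => rfl⟩,
    -- The squares commute on the nose, since the restricted functors have the same underlying
    -- objects and morphisms and only add the vanishing of the scalar component.
    barRestricted 𝒦, cobarRestricted 𝒦, rfl, rfl, ⟨cobarBarAdjunction 𝒦⟩⟩
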